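/- Let $n\ge 0$ be an integer, and let ${\cal S}=\{\Delta_i\}_{i\in I}$ be a finite family of disjoint copies of the standard $n$-simplex. A face-pairing ${\cal P}$ on ${\cal S}$ is a set of simplicial homeomorphisms between codimension-1 faces of the $\Delta_i$'s (induced by bijections of their vertices) such that each codimension-1 face appears exactly once as the source or target of an element of ${\cal P}$. (If $n=0$, these faces are empty and nothing is glued.) Let $X={\cal S}/{\cal P}$ be the resulting quotient space. Let $\Delta_i^\partial$ be $\Delta_i$ without the open stars of its vertices in its second barycentric subdivision, and let $X^\partial$ be the space obtained from the $\Delta_i^\partial$'s by the restrictions of the glueings in ${\cal P}$. Both $X$ and $X^\partial$ carry the PL structure inherited from their pieces. Manifolds are understood in the PL category: every point has an open neighbourhood with a PL homeomorphism (a chart) onto an open subset of $\mathbb{R}^n$ or, where a boundary is allowed, onto a relatively open subset of a closed half-space of $\mathbb{R}^n$. Such a manifold is orientable if it has an atlas of PL charts, with values in open subsets of $\mathbb{R}^n$ or of closed half-spaces of $\mathbb{R}^n$, all of whose transition maps preserve orientation (they have positive Jacobian determinant at the interior points of their domain at which they are differentiable). Consider the condition **Ori**: the natural orientation (given by the ordering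 of the vertices) of some of the $\Delta_i$'s can be reversed in such a way that every element of ${\cal P}$ reverses the orientations which the simplices induce on their codimension-1 faces. Then: 1. if $X$ is a (closed) $n$-manifold, then $X$ is orientable if and only if **Ori** holds; 2. if $X^\partial$ is an $n$-manifold with boundary, then $X^\partial$ is orientable if and only if **Ori** holds. -/

import Mathlib

noncomputable section

namespace SimplexGluing

/-- A face-pairing on the disjoint `n`-simplices indexed by `ι`. The pair `(i, v)` stands for the
codimension-1 face of the simplex `i` that is opposite to its vertex `v`; the vertices of that face
are the `u ≠ v`. Every face is glued to exactly one face, different from itself, by the simplicial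
homeomorphism that extends the bijection `glue` of vertices. A glueing is recorded together with
its inverse, so that no direction of the glueings is chosen. -/
structure FacePairing (ι : Type*) (n : ℕ) where
  mate : ι × Fin (n + 1) → ι × Fin (n + 1)
  mate_ne : ∀ F, mate F ≠ F
  mate_mate : ∀ F, mate (mate F) = F
  glue : ∀ F : ι × Fin (n + 1), {u : Fin (n + 1) // u ≠ F.2} ≃ {u : Fin (n + 1) // u ≠ (mate F).2}
  glue_symm : ∀ (F : ι × Fin (n + 1)) (u : {u : Fin (n + 1) // u ≠ F.2}),
    (glue (mate F) (glue F u) : Fin (n + 1)) = u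

/-! ### The condition on orientations -/

/-- The ordering `v, e 0, …, e (n - 1)` of all the vertices obtained by putting `v` in front of an
ordering `e` of the vertices of the face opposite to `v`. -/
def fullOrdering {n : ℕ} (v : Fin (n + 1)) (e : Fin n ≃ {u : Fin (n + 1) // u ≠ v}) :
    Equiv.Perm (Fin (n + 1)) :=
  (finSuccEquiv n).trans ((Equiv.optionCongr e).trans (Equiv.optionSubtypeNe v))

/-- The sign (`1` positive, `-1` negative) of the ordering `e` of the vertices of the face opposite
to `v`, with respect to the orientation induced on that face, as a portion of the boundary, by the
simplex. The simplex carries `s` times the natural orientation `0, 1, …, n`. -/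
def inducedSign {n : ℕ} (s : ℤˣ) (v : Fin (n + 1)) (e : Fin n ≃ {u : Fin (n + 1) // u ≠ v}) : ℤˣ :=
  s * Equiv.Perm.sign (fullOrdering v e)

/-- Condition **Ori**: up to reversing the natural orientation of some of the simplices (those
with `ε i = -1`), all the face-pairings reverse the induced orientation. -/
def FacePairing.Ori {ι : Type*} {n : ℕ} (P : FacePairing ι n) : Prop :=
  ∃ ε : ι → ℤˣ, ∀ (F : ι × Fin (n + 1)) (e : Fin n ≃ {u : Fin (n + 1) // u ≠ F.2}),
    inducedSign (ε (P.mate F).1) (P.mate F).2 (e.trans (P.glue F)) = - inducedSign (ε F.1) F.2 e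

/-! ### Barycentric subdivision and truncated simplices -/

/-- The barycentric subdivision of an abstract simplicial complex, given by its set `K` of
simplices: the vertices are the simplices of `K`, the simplices are the nonempty chains. -/
def sdFaces {V : Type*} (K : Set (Finset V)) : Set (Finset (Finset V)) :=
  {c | c.Nonempty ∧ (∀ s ∈ c, s ∈ K) ∧ IsChain (· ⊆ ·) (c : Set (Finset V))}

/-- If the vertex `v` of a complex is placed at `p v`, then the vertex `s` of the subdivision is
placed at the barycentre of the simplex `s`. -/
def sdPos {V E : Type*} [AddCommGroup E] [Module ℝ E] (p : V → E) (s : Finset V) : E :=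
  s.centerMass (fun _ => (1 : ℝ)) p

/-- The open star of the vertex `v`: the union of the interiors of the simplices containing `v`. -/
def openStar {V E : Type*} [AddCommGroup E] [Module ℝ E] (K : Set (Finset V)) (p : V → E) (v : V) :
    Set E :=
  {x | ∃ s ∈ K, v ∈ s ∧ ∃ w : V → ℝ,
    (∀ u ∈ s, 0 < w u) ∧ ∑ u ∈ s, w u = 1 ∧ ∑ u ∈ s, w u • p u = x}

/-- The standard `n`-simplex without the open stars of its vertices in its second barycentric
subdivision. -/
def truncatedSimplex (n : ℕ) : Set (Fin (n + 1) → ℝ) :=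
  stdSimplex ℝ (Fin (n + 1)) \
    ⋃ v : Fin (n + 1),
      openStar (sdFaces (sdFaces {s : Finset (Fin (n + 1)) | s.Nonempty}))
        (sdPos (sdPos fun u => (Pi.single u 1 : Fin (n + 1) → ℝ))) {{v}}

/-! ### The glued spaces -/

section
variable {ι : Type*} {n : ℕ}

/-- The glueings of `P`, restricted to the copies of a subset `A` of the standard simplex: a point
`p` of the face `F` is glued to the point `q` of the face `P.mate F` with the same barycentric
coordinates at corresponding vertices. -/
def FacePairing.Rel (P : FacePairing ι n) (A : Set (Fin (n + 1) → ℝ))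
    (p q : Σ _ : ι, A) : Prop :=
  ∃ F : ι × Fin (n + 1), p.1 = F.1 ∧ q.1 = (P.mate F).1 ∧
    p.2.1 F.2 = 0 ∧ q.2.1 (P.mate F).2 = 0 ∧
    ∀ u : {u : Fin (n + 1) // u ≠ F.2}, q.2.1 (P.glue F u) = p.2.1 u

/-- The space obtained from disjoint copies of `A` by the glueings of `P`: the quotient by the
equivalence relation generated by the glueings, with the quotient topology. -/
def FacePairing.Glued (P : FacePairing ι n) (A : Set (Fin (n + 1) → ℝ)) : Type _ :=
  Quot (P.Rel A)

instance (P : FacePairing ι n) (A : Set (Fin (n + 1) → ℝ)) : TopologicalSpace (P.Glued A) :=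
  inferInstanceAs (TopologicalSpace (Quot (P.Rel A)))

/-- The projection of the `i`-th copy of `A` to the glued space. -/
def FacePairing.proj (P : FacePairing ι n) (A : Set (Fin (n + 1) → ℝ)) (i : ι) (x : A) :
    P.Glued A :=
  Quot.mk _ ⟨i, x⟩

end

/-! ### Piecewise-linear charts, manifolds and orientability -/

/-- `f` is piecewise-linear on the open subset `U` of the polyhedron `A`: every point of `U` has a
neighbourhood in `A` that is covered by finitely many (compact, convex) polytopes such that `f` is
affine on the part of `U` in each of them. -/
def IsPLOn {E F : Type*} [AddCommGroup E] [Module ℝ E] [TopologicalSpace E]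
    [AddCommGroup F] [Module ℝ F] {A : Set E} (f : A → F) (U : Set A) : Prop :=
  ∀ a ∈ U, ∃ K : Set (Set E), K.Finite ∧
    (∀ C ∈ K, (∃ t : Finset E, C = convexHull ℝ (t : Set E)) ∧
      ∃ g : E →ᵃ[ℝ] F, ∀ x ∈ U, x.1 ∈ C → f x = g x.1) ∧
    {x : A | ∃ C ∈ K, x.1 ∈ C} ∈ nhds a

section
variable {ι : Type*} {n : ℕ}

/-- A PL chart of the glued space: a homeomorphism from an open subset (`source`) onto a relatively
open subset (`target`) of a closed half-space `{y | 0 ≤ ℓ y}` of `ℝⁿ` (all of `ℝⁿ` when `ℓ = 0`),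
which is piecewise-linear for the PL structure of the glued space, that is, in each of the pieces
of which this space is made. -/
structure PLChart (P : FacePairing ι n) (A : Set (Fin (n + 1) → ℝ)) extends
    PartialEquiv (P.Glued A) (Fin n → ℝ) where
  open_source : IsOpen source
  continuousOn_toFun : ContinuousOn toFun source
  continuousOn_invFun : ContinuousOn invFun target
  exists_halfSpace : ∃ (ℓ : (Fin n → ℝ) →ₗ[ℝ] ℝ) (O : Set (Fin n → ℝ)),
    IsOpen O ∧ target = O ∩ {y | 0 ≤ ℓ y}
  isPLOn : ∀ i : ι, IsPLOn (fun x : A => toFun (P.proj A i x)) {x : A | P.proj A i x ∈ source}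

/-- The glued space is a PL `n`-manifold, possibly with boundary. -/
def IsPLManifoldWithBoundary (P : FacePairing ι n) (A : Set (Fin (n + 1) → ℝ)) : Prop :=
  T2Space (P.Glued A) ∧ SecondCountableTopology (P.Glued A) ∧
    ∀ x : P.Glued A, ∃ φ : PLChart P A, x ∈ φ.source

/-- The glued space is a PL `n`-manifold without boundary. -/
def IsPLManifold (P : FacePairing ι n) (A : Set (Fin (n + 1) → ℝ)) : Prop :=
  T2Space (P.Glued A) ∧ SecondCountableTopology (P.Glued A) ∧
    ∀ x : P.Glued A, ∃ φ : PLChart P A, x ∈ φ.source ∧ IsOpen φ.target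

/-- The transition map from `φ` to `ψ` preserves the orientation of `ℝⁿ`: it has positive Jacobian
determinant at all the interior points of its domain at which it is differentiable (the transition
map is piecewise-linear, so these points are dense). -/
def OrientedTransition {P : FacePairing ι n} {A : Set (Fin (n + 1) → ℝ)} (φ ψ : PLChart P A) :
    Prop :=
  ∀ y ∈ interior (φ.target ∩ φ.invFun ⁻¹' ψ.source),
    DifferentiableAt ℝ (fun z => ψ.toFun (φ.invFun z)) y →
      0 < (fderiv ℝ (fun z => ψ.toFun (φ.invFun z)) y).det

/-- The glued space is orientable: it has an atlas of PL charts all of whose transition maps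
preserve the orientation. -/
def Orientable (P : FacePairing ι n) (A : Set (Fin (n + 1) → ℝ)) : Prop :=
  ∃ 𝒜 : Set (PLChart P A), (∀ x : P.Glued A, ∃ φ ∈ 𝒜, x ∈ φ.source) ∧
    ∀ φ ∈ 𝒜, ∀ ψ ∈ 𝒜, OrientedTransition φ ψ

end

/-- `X = 𝒮/𝒫`, obtained by glueing the simplices, is a (closed) PL manifold. -/
def FacePairing.XIsManifold {ι : Type*} {n : ℕ} (P : FacePairing ι n) : Prop :=
  IsPLManifold P (stdSimplex ℝ (Fin (n + 1)))

/-- `X` is orientable. -/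
def FacePairing.XIsOrientable {ι : Type*} {n : ℕ} (P : FacePairing ι n) : Prop :=
  Orientable P (stdSimplex ℝ (Fin (n + 1)))

/-- `X^∂`, obtained by glueing the truncated simplices, is a PL manifold with boundary. -/
def FacePairing.XBoundaryIsManifold {ι : Type*} {n : ℕ} (P : FacePairing ι n) : Prop :=
  IsPLManifoldWithBoundary P (truncatedSimplex n)

/-- `X^∂` is orientable. -/
def FacePairing.XBoundaryIsOrientable {ι : Type*} {n : ℕ} (P : FacePairing ι n) : Prop :=
  Orientable P (truncatedSimplex n)

end SimplexGluing

end

set_option linter.unusedSectionVars false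

namespace SimplexGluing

open Set Filter Topology Module

/-! ### Piecewise-affine maps -/

section PiecewiseAffine

variable {E : Type*} [NormedAddCommGroup E] [NormedSpace ℝ E] [FiniteDimensional ℝ E]

/-! The proof rests on one fact about ℝⁿ, `det_mul_det_pos`: all affine branches of a continuous
injective piecewise-affine map on a convex open set have determinants of the same sign. Two branches
meeting along a hyperplane differ by a map `x ↦ x + ℓ(x) w`; if its determinant `1 + ℓ(w)` were
negative, one side would be folded onto the other (`det_mul_det_pos_of_crossing`). Finitely many
affine subspaces of codimension two do not disconnect a convex open set (`sign_propagation`), so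
these simple crossings suffice. No homology or degree theory is used.

On the combinatorial side, `ori_iff` turns **Ori** into the equation `ε' * sign π = -ε` for each
glued pair of faces, where `π` extends the glueing by exchanging the opposite vertices. Unfolding
two simplices along a common face gives local coordinates in ℝⁿ in which the second simplex enters
through `π` followed by a reflection, hence with determinant `-sign π` (`det_foldMap`). So **Ori**
says that the simplices, oriented by `ε`, are coherently oriented across every face.

From **Ori** to an orientation: compare a chart with the oriented simplices at the points where it
is affine. The comparison is locally constant away from the images of the faces of codimension two,
by the basic fact applied to the unfolding read in the chart. Over a convex piece of the target it
is therefore constant, and a reflection makes it positive (`exists_chart_signSet_eq_empty`); the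
charts with positive comparison form an oriented atlas.

From an orientation to **Ori**: the charts of an oriented atlas all have the same sign on a convex
open part of the interior of each simplex (`exists_sign_of_oriented`), which defines `ε`. A chart at
the barycentre of a face, composed with the unfolding, is an injective piecewise-affine map whose
branches on the two sides have the same sign, and this is the required equation
(`mul_sign_perm_eq_neg`).

Both spaces are treated together, as glueings of a subset `A` of the simplex invariant under
permutations of the coordinates; the second direction also needs `A` to contain all points with
coordinates below some `c > 1/n`, hence the barycentres of the faces. Truncated simplices have this
property for `n ≥ 2`. In dimensions 0 and 1 **Ori** holds for every face-pairing. -/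

theorem dense_notMem_affineSubspaces {𝒲 : Set (AffineSubspace ℝ E)} (hf : 𝒲.Finite)
    (h : ∀ W ∈ 𝒲, W ≠ ⊤) : Dense {x : E | ∀ W ∈ 𝒲, x ∉ W} := by
  borelize E
  -- Proper affine subspaces are null for Haar measure, and a conull set is dense.
  have : ∀ᵐ x ∂(MeasureTheory.Measure.addHaar : MeasureTheory.Measure E), ∀ W ∈ 𝒲, x ∉ W := by
    rw [MeasureTheory.ae_ball_iff hf.countable]
    intro W hW
    exact MeasureTheory.measure_eq_zero_iff_ae_notMem.1
      (MeasureTheory.Measure.addHaar_affineSubspace _ W (h W hW))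
  exact MeasureTheory.Measure.dense_of_ae this

theorem isClosed_affineSubspace (W : AffineSubspace ℝ E) : IsClosed (W : Set E) :=
  AffineSubspace.closed_of_finiteDimensional W

theorem affineSubspace_ne_top_of_finrank_lt {W : AffineSubspace ℝ E}
    (h : finrank ℝ W.direction < finrank ℝ E) : W ≠ ⊤ := by
  rintro rfl
  rw [AffineSubspace.direction_top, finrank_top] at h
  exact lt_irrefl _ h

theorem affineSpan_insert_ne_top {W : AffineSubspace ℝ E}
    (h : finrank ℝ W.direction + 2 ≤ finrank ℝ E) (x : E) :
    affineSpan ℝ (insert x (W : Set E)) ≠ ⊤ := by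
  apply affineSubspace_ne_top_of_finrank_lt
  rw [direction_affineSpan]
  have := finrank_vectorSpan_insert_le W x
  omega

/-- A point `z ≠ x` of the segment determines the line through `x` and `y`, so `z ∈ W` would put `y`
in the span of `x` and `W`. -/
theorem segment_notMem_of_notMem_span {W : AffineSubspace ℝ E} {x y : E} (hx : x ∉ W)
    (hy : y ∉ affineSpan ℝ (insert x (W : Set E))) : ∀ z ∈ segment ℝ x y, z ∉ W := by
  intro z hz hzW
  rw [segment_eq_image_lineMap] at hz
  obtain ⟨t, -, rfl⟩ := hz
  have ht : t ≠ 0 := by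
    rintro rfl
    simp at hzW
    exact hx hzW
  apply hy
  have h1 : x ∈ affineSpan ℝ (insert x (W : Set E)) :=
    subset_affineSpan ℝ _ (mem_insert _ _)
  have h2 : AffineMap.lineMap x y t ∈ affineSpan ℝ (insert x (W : Set E)) :=
    subset_affineSpan ℝ _ (mem_insert_of_mem _ hzW)
  have h3 := AffineMap.lineMap_mem (t⁻¹) h1 h2
  convert h3 using 1
  simp [AffineMap.lineMap_apply, smul_smul, inv_mul_cancel₀ ht]

/-- An open convex set stays connected when finitely many affine subspaces of codimension at least
two are removed; hence a locally constant sign on a dense open subset is constant. -/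
theorem sign_propagation {V : Set E} (hV : Convex ℝ V) (hVo : IsOpen V)
    {𝒮 : Set (AffineSubspace ℝ E)} (h𝒮 : 𝒮.Finite)
    (hc : ∀ W ∈ 𝒮, finrank ℝ W.direction + 2 ≤ finrank ℝ E)
    {R R' : Set E} (hR : IsOpen R) (hR' : IsOpen R') (hd : V ⊆ closure (R ∪ R'))
    (hloc : ∀ y ∈ V, (∀ W ∈ 𝒮, y ∉ W) → y ∉ closure R ∨ y ∉ closure R') :
    V ∩ R = ∅ ∨ V ∩ R' = ∅ := by
  by_contra! hcon
  obtain ⟨h1, h2⟩ := hcon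
  have hdS : Dense {x : E | ∀ W ∈ 𝒮, x ∉ W} := dense_notMem_affineSubspaces h𝒮 fun W hW =>
    affineSubspace_ne_top_of_finrank_lt (by have := hc W hW; omega)
  obtain ⟨x₁, ⟨hx₁V, hx₁R⟩, hx₁S⟩ := hdS.inter_open_nonempty _ (hVo.inter hR) h1
  obtain ⟨x₂, ⟨hx₂V, hx₂R⟩, hx₂S⟩ := hdS.inter_open_nonempty _ (hVo.inter hR') h2
  -- The joins of `x₁` and `x₂` with the members of `𝒮` are still proper, as the codimension drops
  -- by at most one. A point `y` off all of them can be reached from both ends by segments that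
  -- avoid `𝒮`.
  have hdy := dense_notMem_affineSubspaces
    (𝒲 := (fun W : AffineSubspace ℝ E => affineSpan ℝ (insert x₁ (W : Set E))) '' 𝒮 ∪
      (fun W : AffineSubspace ℝ E => affineSpan ℝ (insert x₂ (W : Set E))) '' 𝒮)
    ((h𝒮.image _).union (h𝒮.image _)) (by
      rintro _ (⟨W, hW, rfl⟩ | ⟨W, hW, rfl⟩) <;> exact affineSpan_insert_ne_top (hc W hW) _)
  obtain ⟨y, hyV, hy⟩ := hdy.inter_open_nonempty V hVo ⟨x₁, hx₁V⟩
  set T := segment ℝ x₁ y ∪ segment ℝ x₂ y with hT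
  have hTc : IsPreconnected T :=
    IsPreconnected.union y (right_mem_segment ℝ _ _) (right_mem_segment ℝ _ _)
      (convex_segment _ _).isPreconnected (convex_segment _ _).isPreconnected
  have hTV : T ⊆ V := union_subset (hV.segment_subset hx₁V hyV) (hV.segment_subset hx₂V hyV)
  have hTS : ∀ z ∈ T, ∀ W ∈ 𝒮, z ∉ W := by
    rintro z (hz | hz) W hW
    · exact segment_notMem_of_notMem_span (hx₁S W hW) (hy _ (Or.inl ⟨W, hW, rfl⟩)) z hz
    · exact segment_notMem_of_notMem_span (hx₂S W hW) (hy _ (Or.inr ⟨W, hW, rfl⟩)) z hz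
  have hx₁T : x₁ ∈ T := Or.inl (left_mem_segment ℝ _ _)
  have hx₂T : x₂ ∈ T := Or.inr (left_mem_segment ℝ _ _)
  -- By `hloc` the complements of the two closures cover the connected broken line `T`, and each
  -- meets `T`; a common point would contradict the density of `R ∪ R'`.
  obtain ⟨z, hzT, hz1, hz2⟩ := hTc (closure R)ᶜ (closure R')ᶜ isClosed_closure.isOpen_compl
    isClosed_closure.isOpen_compl (fun z hz => hloc z (hTV hz) (hTS z hz))
    ⟨x₂, hx₂T, (hloc x₂ hx₂V hx₂S).resolve_right (not_not.2 (subset_closure hx₂R))⟩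
    ⟨x₁, hx₁T, (hloc x₁ hx₁V hx₁S).resolve_left (not_not.2 (subset_closure hx₁R))⟩
  have := hd (hTV hzT)
  rw [closure_union] at this
  exact this.elim hz1 hz2

/-- The sets `{f = g}` are closed, finite in number, disjoint for distinct branches, and cover `V`;
hence each of them is also open. -/
theorem exists_eqOn_of_isPreconnected {V : Set E} (hV : IsPreconnected V) (hne : V.Nonempty)
    {f : E → E} (hf : ContinuousOn f V) {𝒢 : Set (E →ᵃ[ℝ] E)} (h𝒢 : 𝒢.Finite)
    (hfg : ∀ x ∈ V, ∃ g ∈ 𝒢, f x = g x)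
    (hd : ∀ g ∈ 𝒢, ∀ g' ∈ 𝒢, g ≠ g' → ∀ x ∈ V, g x ≠ g' x) : ∃ g ∈ 𝒢, EqOn f g V := by
  obtain ⟨x₀, hx₀⟩ := hne
  obtain ⟨g₀, hg₀, h₀⟩ := hfg x₀ hx₀
  refine ⟨g₀, hg₀, ?_⟩
  have : PreconnectedSpace V := Subtype.preconnectedSpace hV
  have hfc : Continuous fun x : V => f x := hf.domRestrict
  have hcl : ∀ g : E →ᵃ[ℝ] E, IsClosed {x : V | f x = g x} := fun g =>
    isClosed_eq hfc (g.continuous_of_finiteDimensional.comp continuous_subtype_val)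
  have hop : {x : V | f x = g₀ x}ᶜ = ⋃ g ∈ 𝒢 \ {g₀}, {x : V | f x = g x} := by
    ext x
    simp only [mem_compl_iff, mem_ofPred_eq, mem_iUnion, exists_prop, Set.mem_sdiff, mem_singleton_iff]
    constructor
    · intro h
      obtain ⟨g, hg, hx⟩ := hfg x x.2
      exact ⟨g, ⟨hg, by rintro rfl; exact h hx⟩, hx⟩
    · rintro ⟨g, ⟨hg, hne⟩, hx⟩ h
      exact hd g hg g₀ hg₀ hne x x.2 (hx.symm.trans h)
  have hclopen : IsClopen {x : V | f x = g₀ x} := by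
    refine ⟨hcl g₀, ?_⟩
    rw [← isClosed_compl_iff, hop]
    exact (h𝒢.subset sdiff_subset).isClosed_biUnion fun g _ => hcl g
  have := hclopen.eq_univ ⟨⟨x₀, hx₀⟩, h₀⟩
  intro x hx
  exact (this.symm ▸ mem_univ (⟨x, hx⟩ : V) : (⟨x, hx⟩ : V) ∈ {x : V | f x = g₀ x})

/-- The affine subspace on which two affine maps agree. -/
def affineEqLocus (g g' : E →ᵃ[ℝ] E) : AffineSubspace ℝ E :=
  (AffineSubspace.mk' (0 : E) ⊥).comap (g - g')

theorem mem_affineEqLocus {g g' : E →ᵃ[ℝ] E} {x : E} :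
    x ∈ affineEqLocus g g' ↔ g x = g' x := by
  simp [affineEqLocus, AffineSubspace.mem_comap, AffineSubspace.mem_mk', sub_eq_zero]

theorem affineEqLocus_ne_top {g g' : E →ᵃ[ℝ] E} (h : g ≠ g') : affineEqLocus g g' ≠ ⊤ := by
  intro ht
  apply h
  ext x
  exact mem_affineEqLocus.1 (ht ▸ AffineSubspace.mem_top ℝ E x)

/-- The loci of coincidence of the distinct members of a family of affine maps. -/
def eqLoci (𝒢 : Set (E →ᵃ[ℝ] E)) : Set (AffineSubspace ℝ E) :=
  {W | ∃ g ∈ 𝒢, ∃ g' ∈ 𝒢, g ≠ g' ∧ W = affineEqLocus g g'}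

theorem finite_eqLoci {𝒢 : Set (E →ᵃ[ℝ] E)} (h : 𝒢.Finite) : (eqLoci 𝒢).Finite := by
  refine ((h.prod h).image fun p => affineEqLocus p.1 p.2).subset ?_
  rintro _ ⟨g, hg, g', hg', -, rfl⟩
  exact ⟨(g, g'), ⟨hg, hg'⟩, rfl⟩

theorem ne_top_of_mem_eqLoci {𝒢 : Set (E →ᵃ[ℝ] E)} {W : AffineSubspace ℝ E}
    (h : W ∈ eqLoci 𝒢) : W ≠ ⊤ := by
  obtain ⟨g, -, g', -, hne, rfl⟩ := h
  exact affineEqLocus_ne_top hne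

theorem eventually_notMem_of_finite {𝒲 : Set (AffineSubspace ℝ E)} (h : 𝒲.Finite) (y : E) :
    ∀ᶠ x in 𝓝 y, ∀ W ∈ 𝒲, x ∈ W → y ∈ W := by
  rw [eventually_all_finite h]
  intro W _
  by_cases hy : y ∈ W
  · exact Eventually.of_forall fun _ _ => hy
  · filter_upwards [(isClosed_affineSubspace W).isOpen_compl.mem_nhds hy] with x hx h
    exact absurd h hx

/-- Away from the coincidence loci, which are finitely many proper subspaces, a small ball meets
none of them, and only one branch can occur on it. -/
theorem exists_eventuallyEq {V : Set E} (hVo : IsOpen V) (hne : V.Nonempty)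
    {f : E → E} (hf : ContinuousOn f V) {𝒢 : Set (E →ᵃ[ℝ] E)} (h𝒢 : 𝒢.Finite)
    (hfg : ∀ x ∈ V, ∃ g ∈ 𝒢, f x = g x) : ∃ z ∈ V, ∃ g ∈ 𝒢, f =ᶠ[𝓝 z] g := by
  obtain ⟨z, hzV, hz⟩ := (dense_notMem_affineSubspaces (finite_eqLoci h𝒢)
    fun W => ne_top_of_mem_eqLoci).inter_open_nonempty V hVo hne
  obtain ⟨r, hr, hball⟩ := Metric.eventually_nhds_iff_ball.1
    ((eventually_notMem_of_finite (finite_eqLoci h𝒢) z).and (hVo.mem_nhds hzV))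
  obtain ⟨g, hg, hgf⟩ := exists_eqOn_of_isPreconnected (V := Metric.ball z r)
    (convex_ball z r).isPreconnected ⟨z, Metric.mem_ball_self hr⟩
    (hf.mono fun x hx => (hball x hx).2) h𝒢 (fun x hx => hfg x (hball x hx).2) (by
      intro g hg g' hg' hne x hx hxe
      have hW : affineEqLocus g g' ∈ eqLoci 𝒢 := ⟨g, hg, g', hg', hne, rfl⟩
      exact hz _ hW ((hball x hx).1 _ hW (mem_affineEqLocus.2 hxe)))
  exact ⟨z, hzV, g, hg, hgf.eventuallyEq_of_mem (Metric.ball_mem_nhds z hr)⟩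

/-- Differing from each of finitely many continuous maps is an open condition, so a failure at one
point would persist on an open set, which meets `T`. -/
theorem forall_exists_eq_of_dense {V T : Set E} (hVo : IsOpen V) (hT : ∀ U, IsOpen U → U ⊆ V →
      U.Nonempty → (U ∩ T).Nonempty)
    {f : E → E} (hf : ContinuousOn f V) {𝒢 : Set (E →ᵃ[ℝ] E)} (h𝒢 : 𝒢.Finite)
    (hfg : ∀ x ∈ V, x ∈ T → ∃ g ∈ 𝒢, f x = g x) : ∀ x ∈ V, ∃ g ∈ 𝒢, f x = g x := by
  intro x hx
  by_contra! hcon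
  have hev : ∀ᶠ x' in 𝓝 x, ∀ g ∈ 𝒢, f x' ≠ g x' := by
    rw [eventually_all_finite h𝒢]
    intro g hg
    exact ((hf.continuousAt (hVo.mem_nhds hx)).tendsto.prodMk_nhds
      (g.continuous_of_finiteDimensional.tendsto x)).eventually
        (isOpen_ne_fun continuous_fst continuous_snd |>.mem_nhds (hcon g hg))
  obtain ⟨U, hU, hUo, hxU⟩ := mem_nhds_iff.1 (hev.and (hVo.mem_nhds hx))
  obtain ⟨z, hzU, hzT⟩ := hT U hUo (fun z hz => (hU hz).2) ⟨x, hxU⟩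
  obtain ⟨g, hg, h⟩ := hfg z (hU hzU).2 hzT
  exact (hU hzU).1 g hg h

theorem eq_of_eventuallyEq {g g' : E →ᵃ[ℝ] E} {z : E} (h : (g : E → E) =ᶠ[𝓝 z] g') : g = g' := by
  by_contra hne
  obtain ⟨U, hU, hUo, hzU⟩ := mem_nhds_iff.1 h
  obtain ⟨x, hxU, hx⟩ := (dense_notMem_affineSubspaces (finite_singleton (affineEqLocus g g'))
    (by rintro _ rfl; exact affineEqLocus_ne_top hne)).inter_open_nonempty U hUo ⟨z, hzU⟩
  exact hx _ rfl (mem_affineEqLocus.2 (hU hxU))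

/-- A nonzero vector of the kernel, suitably scaled, would join `z` to a second point of `U` with
the same image. -/
theorem det_linear_ne_zero_of_injOn {g : E →ᵃ[ℝ] E} {U : Set E} {z : E} (hU : U ∈ 𝓝 z)
    (hg : InjOn g U) : LinearMap.det g.linear ≠ 0 := by
  intro h0
  have hbot : ⊥ < LinearMap.ker g.linear := LinearMap.bot_lt_ker_of_det_eq_zero h0
  obtain ⟨w, hw, hw0⟩ := Submodule.exists_mem_ne_zero_of_ne_bot hbot.ne'
  have hc : Tendsto (fun t : ℝ => z + t • w) (𝓝 0) (𝓝 z) := by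
    have : Continuous fun t : ℝ => z + t • w := by fun_prop
    simpa using this.tendsto 0
  have hev : ∀ᶠ t in 𝓝[≠] (0 : ℝ), z + t • w ∈ U := (hc.eventually hU).filter_mono nhdsWithin_le_nhds
  obtain ⟨t, ht, ht0⟩ := (hev.and self_mem_nhdsWithin).exists
  have : z + t • w = z := by
    apply hg ht (mem_of_mem_nhds hU)
    have := g.map_vadd z (t • w)
    rw [vadd_eq_add, vadd_eq_add, map_smul, LinearMap.mem_ker.1 hw, smul_zero, zero_add,
      add_comm] at this
    exact this
  simp [hw0] at this
  exact ht0 this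

theorem affineMap_add_smul (g : E →ᵃ[ℝ] E) (y w : E) (t : ℝ) :
    g (y + t • w) = g y + t • g.linear w := by
  have := g.map_vadd y (t • w)
  rw [vadd_eq_add, vadd_eq_add, map_smul, add_comm] at this
  rw [this, add_comm]

/-- Two affine branches of an injective map which meet along a hyperplane have the same
orientation. -/
theorem det_mul_det_pos_of_crossing {f : E → E} {y : E} {r : ℝ} (hr : 0 < r)
    (hf : ContinuousOn f (Metric.ball y r)) (hinj : InjOn f (Metric.ball y r))
    {ℓ : E →ₗ[ℝ] ℝ} (hℓ : ℓ ≠ 0) {g₁ g₂ : E →ᵃ[ℝ] E}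
    (h₁ : ∀ z ∈ Metric.ball y r, 0 < ℓ (z - y) → f z = g₁ z)
    (h₂ : ∀ z ∈ Metric.ball y r, ℓ (z - y) < 0 → f z = g₂ z) :
    0 < LinearMap.det g₁.linear * LinearMap.det g₂.linear := by
  obtain ⟨e, he⟩ : ∃ e, ℓ e = 1 := by
    obtain ⟨e, he⟩ : ∃ e, ℓ e ≠ 0 := by
      by_contra! h
      exact hℓ (LinearMap.ext h)
    exact ⟨(ℓ e)⁻¹ • e, by simp [he]⟩
  have hℓc : Continuous ℓ := ℓ.continuous_of_finiteDimensional
  have hlim : ∀ z w : E, Tendsto (fun t : ℝ => z + t • w) (𝓝 0) (𝓝 z) := fun z w => by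
    have : Continuous fun t : ℝ => z + t • w := by fun_prop
    simpa using this.tendsto 0
  have hball : ∀ z ∈ Metric.ball y r, ∀ w, ∀ᶠ t in 𝓝 (0 : ℝ), z + t • w ∈ Metric.ball y r :=
    fun z hz w => (hlim z w).eventually (Metric.isOpen_ball.mem_nhds hz)
  have hy : y ∈ Metric.ball y r := Metric.mem_ball_self hr
  -- Moving off the hyperplane along `e` or `-e` and passing to the limit, both branches give the
  -- value of `f` on the hyperplane itself.
  have key : ∀ z ∈ Metric.ball y r, ℓ (z - y) = 0 → f z = g₁ z ∧ f z = g₂ z := by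
    intro z hz hz0
    have hfz := (hf.continuousAt (Metric.isOpen_ball.mem_nhds hz)).tendsto
    have aux : ∀ (g : E →ᵃ[ℝ] E) (w : E), (∀ᶠ t in 𝓝[>] (0 : ℝ), f (z + t • w) = g (z + t • w)) →
        f z = g z := by
      intro g w h
      have l1 := hfz.comp ((hlim z w).mono_left (nhdsWithin_le_nhds (s := Ioi 0)))
      have l2 := (g.continuous_of_finiteDimensional.tendsto z).comp
        ((hlim z w).mono_left (nhdsWithin_le_nhds (s := Ioi 0)))
      exact tendsto_nhds_unique l1 (l2.congr' (h.mono fun t ht => ht.symm))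
    constructor
    · refine aux g₁ e ?_
      filter_upwards [(hball z hz e).filter_mono nhdsWithin_le_nhds, self_mem_nhdsWithin] with t ht ht0
      apply h₁ _ ht
      rw [add_sub_right_comm, map_add, hz0, map_smul, he]
      simpa using ht0
    · refine aux g₂ (-e) ?_
      filter_upwards [(hball z hz (-e)).filter_mono nhdsWithin_le_nhds, self_mem_nhdsWithin]
        with t ht ht0
      apply h₂ _ ht
      rw [add_sub_right_comm, map_add, hz0, map_smul, map_neg, he]
      simpa using ht0
  have hgy : g₁ y = g₂ y := by
    have := key y hy (by simp)
    exact this.1.symm.trans this.2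
  have hker : ∀ w, ℓ w = 0 → g₁.linear w = g₂.linear w := by
    intro w hw
    obtain ⟨t, ht, ht0⟩ := (((hball y hy w).filter_mono nhdsWithin_le_nhds).and
      (self_mem_nhdsWithin (s := {(0 : ℝ)}ᶜ))).exists
    have := key _ ht (by simp [hw])
    have h3 := this.1.symm.trans this.2
    rw [affineMap_add_smul, affineMap_add_smul, hgy, add_right_inj] at h3
    exact smul_right_injective E (show t ≠ 0 from ht0) h3
  have hopen : ∀ s : ℝ, s ≠ 0 → ∃ z, {x | x ∈ Metric.ball y r ∧ 0 < s * ℓ (x - y)} ∈ 𝓝 z := by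
    intro s hs
    obtain ⟨t, ht, ht0⟩ := (((hball y hy (s • e)).filter_mono nhdsWithin_le_nhds).and
      (self_mem_nhdsWithin (s := Ioi (0 : ℝ)))).exists
    refine ⟨y + t • s • e, IsOpen.mem_nhds ?_ ⟨ht, ?_⟩⟩
    · exact Metric.isOpen_ball.inter (isOpen_lt continuous_const
        (continuous_const.mul (hℓc.comp (continuous_id.sub continuous_const))))
    · have ht0' : 0 < t := ht0
      have : 0 < s * s := mul_self_pos.2 hs
      simp only [add_sub_cancel_left, map_smul, he, smul_eq_mul, mul_one]
      nlinarith
  have hd₁ : LinearMap.det g₁.linear ≠ 0 := by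
    obtain ⟨z, hz⟩ := hopen 1 one_ne_zero
    refine det_linear_ne_zero_of_injOn hz fun a ha b hb hab => hinj ha.1 hb.1 ?_
    rw [h₁ a ha.1 (by simpa using ha.2), h₁ b hb.1 (by simpa using hb.2), hab]
  have hd₂ : LinearMap.det g₂.linear ≠ 0 := by
    obtain ⟨z, hz⟩ := hopen (-1) (by norm_num)
    refine det_linear_ne_zero_of_injOn hz fun a ha b hb hab => hinj ha.1 hb.1 ?_
    rw [h₂ a ha.1 (by simpa using ha.2), h₂ b hb.1 (by simpa using hb.2), hab]
  let L := LinearEquiv.ofIsUnitDet (f := g₁.linear) (v := Module.finBasis ℝ E)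
    (v' := Module.finBasis ℝ E) (by rw [LinearMap.det_toMatrix]; exact hd₁.isUnit)
  have hL : ∀ w, g₁.linear (L.symm w) = w := fun w => L.apply_symm_apply w
  -- The linear parts agree on `ker ℓ`, so they differ only through the image of `e`. This choice of
  -- `w` makes `g₂.linear` the composite of `g₁.linear` with `x ↦ x + ℓ x • w`.
  set w := L.symm (g₂.linear e - g₁.linear e) with hw
  have hcomp : g₂.linear = g₁.linear ∘ₗ LinearMap.transvection ℓ w := by
    ext x
    simp only [LinearMap.comp_apply, LinearMap.transvection.apply, map_add, map_smul, hw, hL]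
    have h0 := hker (x - ℓ x • e) (by simp [he])
    simp only [map_sub, map_smul] at h0
    rw [smul_sub, sub_eq_iff_eq_add.1 h0]
    abel
  have hdet : LinearMap.det g₂.linear = LinearMap.det g₁.linear * (1 + ℓ w) := by
    rw [hcomp, LinearMap.det_comp, LinearMap.transvection.det]
  have hpos : 0 < 1 + ℓ w := by
    by_contra hneg
    have hlt : 1 + ℓ w < 0 := lt_of_le_of_ne (not_lt.1 hneg) (by
      intro h
      rw [h, mul_zero] at hdet
      exact hd₂ hdet)
    -- If `1 + ℓ w < 0`, then `-e` and `-(e + w)` point to opposite sides of the hyperplane, and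
    -- each side's own branch sends them to the same vector, which contradicts injectivity.
    have hq : g₁.linear (e + w) = g₂.linear e := by rw [map_add, hw, hL]; abel
    obtain ⟨t, ⟨ht1, ht2⟩, ht0⟩ := ((((hball y hy (-e)).and (hball y hy (-(e + w)))).filter_mono
      nhdsWithin_le_nhds).and (self_mem_nhdsWithin (s := Ioi (0 : ℝ)))).exists
    have ht0' : 0 < t := ht0
    have e1 := h₂ _ ht1 (by simp [he, ht0'])
    have e2 := h₁ _ ht2 (by
      simp only [add_sub_cancel_left, map_smul, map_neg, map_add, he, smul_eq_mul]
      nlinarith)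
    have e3 : f (y + t • -e) = f (y + t • -(e + w)) := by
      rw [e1, e2, affineMap_add_smul, affineMap_add_smul, hgy, map_neg, map_neg, hq]
    have e4 := hinj ht1 ht2 e3
    have e5 := congrArg (fun x => ℓ (x - y)) e4
    simp only [add_sub_cancel_left, map_smul, map_neg, map_add, he, smul_eq_mul] at e5
    have := mul_left_cancel₀ ht0'.ne' e5
    linarith
  rw [hdet, ← mul_assoc]
  exact mul_pos (mul_self_pos.2 hd₁) hpos

theorem isOpen_setOf_eventuallyEq (f : E → E) (p : (E →ᵃ[ℝ] E) → Prop) :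
    IsOpen {z | ∃ g : E →ᵃ[ℝ] E, f =ᶠ[𝓝 z] g ∧ p g} := by
  rw [isOpen_iff_mem_nhds]
  rintro z ⟨g, hg, hp⟩
  filter_upwards [eventually_eventuallyEq_nhds.2 hg] with x hx using ⟨g, hx, hp⟩

theorem det_linear_ne_zero_of_eventuallyEq {V : Set E} {f : E → E} (hinj : InjOn f V)
    {g : E →ᵃ[ℝ] E} {z : E} (hz : V ∈ 𝓝 z) (h : f =ᶠ[𝓝 z] g) : LinearMap.det g.linear ≠ 0 := by
  refine det_linear_ne_zero_of_injOn (U := {x | x ∈ V ∧ f x = g x}) (inter_mem hz h) ?_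
  intro a ha b hb hab
  exact hinj ha.1 hb.1 (ha.2.trans (hab.trans hb.2.symm))

/-- Hyperplanes of a finite family passing through a point off the subspaces of codimension two
which the family defines coincide. -/
theorem eq_of_mem_of_finrank_inf {W W' : AffineSubspace ℝ E} {y : E} (hW : y ∈ W) (hW' : y ∈ W')
    (hne : W ≠ ⊤) (h : ¬ finrank ℝ (W ⊓ W' : AffineSubspace ℝ E).direction + 2 ≤ finrank ℝ E) :
    W ⊓ W' = W ∧ finrank ℝ W.direction + 1 = finrank ℝ E := by
  have hy : y ∈ W ⊓ W' := ⟨hW, hW'⟩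
  have h1 : W.direction < ⊤ := by
    have := AffineSubspace.direction_lt_of_nonempty (lt_top_iff_ne_top.2 hne) ⟨y, hW⟩
    rwa [AffineSubspace.direction_top] at this
  have h2 := Submodule.finrank_lt h1.ne
  have h3 : (W ⊓ W').direction ≤ W.direction := AffineSubspace.direction_le inf_le_left
  have h4 := Submodule.finrank_mono h3
  have h5 := Submodule.eq_of_le_of_finrank_le h3 (by omega)
  refine ⟨AffineSubspace.eq_of_direction_eq_of_nonempty_of_le h5 ⟨y, hy⟩ inf_le_left, ?_⟩
  rw [← h5] at h2 ⊢
  omega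

theorem exists_linear_of_hyperplane {W : AffineSubspace ℝ E} {y : E} (hy : y ∈ W)
    (h : finrank ℝ W.direction + 1 = finrank ℝ E) :
    ∃ ℓ : E →ₗ[ℝ] ℝ, ℓ ≠ 0 ∧ ∀ x, x ∈ W ↔ ℓ (x - y) = 0 := by
  have hlt : W.direction < ⊤ := by
    rw [lt_top_iff_ne_top]
    intro ht
    rw [ht, finrank_top] at h
    omega
  obtain ⟨ℓ, hℓ, hle⟩ := Submodule.exists_le_ker_of_lt_top _ hlt
  have hker : LinearMap.ker ℓ ≠ ⊤ := fun ht => hℓ (LinearMap.ker_eq_top.1 ht)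
  have h2 := Submodule.finrank_lt hker
  have h3 := Submodule.eq_of_le_of_finrank_le hle (by omega)
  refine ⟨ℓ, hℓ, fun x => ?_⟩
  rw [← AffineSubspace.vsub_right_mem_direction_iff_mem hy x, h3, LinearMap.mem_ker, vsub_eq_sub]

/-- The branches of an injective piecewise-affine map on a convex open set all have the same
orientation. -/
theorem det_mul_det_pos {V : Set E} (hV : Convex ℝ V) (hVo : IsOpen V) {f : E → E}
    (hf : ContinuousOn f V) (hinj : InjOn f V) {𝒢 : Set (E →ᵃ[ℝ] E)} (h𝒢 : 𝒢.Finite)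
    (hfg : ∀ x ∈ V, ∃ g ∈ 𝒢, f x = g x) {x₁ x₂ : E} (hx₁ : x₁ ∈ V) (hx₂ : x₂ ∈ V)
    {g₁ g₂ : E →ᵃ[ℝ] E} (h₁ : f =ᶠ[𝓝 x₁] g₁) (h₂ : f =ᶠ[𝓝 x₂] g₂) :
    0 < LinearMap.det g₁.linear * LinearMap.det g₂.linear := by
  have hfin := finite_eqLoci h𝒢
  -- Off these intersections, all coincidence loci through a point are one and the same hyperplane.
  -- The case `W = W'` also removes the loci that are themselves of codimension at least two.
  set 𝒮 : Set (AffineSubspace ℝ E) := {S | (∃ W ∈ eqLoci 𝒢, ∃ W' ∈ eqLoci 𝒢, S = W ⊓ W') ∧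
    finrank ℝ S.direction + 2 ≤ finrank ℝ E} with h𝒮
  have h𝒮f : 𝒮.Finite := by
    refine ((hfin.prod hfin).image fun p => p.1 ⊓ p.2).subset ?_
    rintro _ ⟨⟨W, hW, W', hW', rfl⟩, -⟩
    exact ⟨(W, W'), ⟨hW, hW'⟩, rfl⟩
  have hdet0 : ∀ z ∈ V, ∀ g : E →ᵃ[ℝ] E, f =ᶠ[𝓝 z] g → LinearMap.det g.linear ≠ 0 :=
    fun z hz g hg => det_linear_ne_zero_of_eventuallyEq hinj (hVo.mem_nhds hz) hg
  have hprop := sign_propagation hV hVo h𝒮f (fun S hS => hS.2)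
    (isOpen_setOf_eventuallyEq f fun g => 0 < LinearMap.det g.linear)
    (isOpen_setOf_eventuallyEq f fun g => LinearMap.det g.linear < 0) ?_ ?_
  · have d1 := hdet0 x₁ hx₁ g₁ h₁
    have d2 := hdet0 x₂ hx₂ g₂ h₂
    rcases hprop with hp | hp
    · have a1 : ¬ 0 < LinearMap.det g₁.linear := fun h =>
        (eq_empty_iff_forall_notMem.1 hp) x₁ ⟨hx₁, g₁, h₁, h⟩
      have a2 : ¬ 0 < LinearMap.det g₂.linear := fun h =>
        (eq_empty_iff_forall_notMem.1 hp) x₂ ⟨hx₂, g₂, h₂, h⟩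
      exact mul_pos_of_neg_of_neg (lt_of_le_of_ne (not_lt.1 a1) d1)
        (lt_of_le_of_ne (not_lt.1 a2) d2)
    · have a1 : ¬ LinearMap.det g₁.linear < 0 := fun h =>
        (eq_empty_iff_forall_notMem.1 hp) x₁ ⟨hx₁, g₁, h₁, h⟩
      have a2 : ¬ LinearMap.det g₂.linear < 0 := fun h =>
        (eq_empty_iff_forall_notMem.1 hp) x₂ ⟨hx₂, g₂, h₂, h⟩
      exact mul_pos (lt_of_le_of_ne (not_lt.1 a1) d1.symm) (lt_of_le_of_ne (not_lt.1 a2) d2.symm)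
  · intro y hy
    rw [mem_closure_iff]
    intro U hU hyU
    obtain ⟨z, hz, g, -, hg⟩ := exists_eventuallyEq (hU.inter hVo) ⟨y, hyU, hy⟩
      (hf.mono inter_subset_right) h𝒢 fun x hx => hfg x hx.2
    refine ⟨z, hz.1, ?_⟩
    rcases (hdet0 z hz.2 g hg).lt_or_gt with h | h
    · exact Or.inr ⟨g, hg, h⟩
    · exact Or.inl ⟨g, hg, h⟩
  · intro y hy hyS
    by_contra! hcon
    obtain ⟨r, hr, hball⟩ := Metric.eventually_nhds_iff_ball.1
      ((eventually_notMem_of_finite hfin y).and (hVo.mem_nhds hy))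
    have hbV : Metric.ball y r ⊆ V := fun x hx => (hball x hx).2
    have hbn := Metric.ball_mem_nhds y hr
    obtain ⟨z, hzb, g, hg, hgp⟩ := mem_closure_iff_nhds.1 hcon.1 _ hbn
    obtain ⟨z', hzb', g', hg', hgn⟩ := mem_closure_iff_nhds.1 hcon.2 _ hbn
    by_cases hW : ∃ W ∈ eqLoci 𝒢, y ∈ W
    · obtain ⟨W, hW, hyW⟩ := hW
      have huniq : ∀ W' ∈ eqLoci 𝒢, y ∈ W' → W' = W ∧ finrank ℝ W'.direction + 1 = finrank ℝ E := by
        intro W' hW' hyW'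
        have hn : ¬ finrank ℝ (W' ⊓ W : AffineSubspace ℝ E).direction + 2 ≤ finrank ℝ E :=
          fun h => hyS _ ⟨⟨W', hW', W, hW, rfl⟩, h⟩ ⟨hyW', hyW⟩
        obtain ⟨e1, e2⟩ := eq_of_mem_of_finrank_inf hyW' hyW (ne_top_of_mem_eqLoci hW') hn
        rw [inf_comm] at hn
        obtain ⟨e3, -⟩ := eq_of_mem_of_finrank_inf hyW hyW' (ne_top_of_mem_eqLoci hW) hn
        rw [inf_comm] at e3
        exact ⟨e1.symm.trans e3, e2⟩
      obtain ⟨ℓ, hℓ, hWℓ⟩ := exists_linear_of_hyperplane hyW (huniq W hW hyW).2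
      have hℓc : Continuous fun x => ℓ (x - y) :=
        ℓ.continuous_of_finiteDimensional.comp (continuous_id.sub continuous_const)
      -- Each open half of the ball is convex and avoids every coincidence locus, so it carries a
      -- single branch.
      have hside : ∀ s : ℝ, s ≠ 0 → ∃ m ∈ 𝒢, EqOn f m {x | x ∈ Metric.ball y r ∧ 0 < s * ℓ (x - y)} := by
        intro s hs
        refine exists_eqOn_of_isPreconnected (Convex.isPreconnected ?_) ?_
          (hf.mono fun x hx => hbV hx.1) h𝒢 (fun x hx => hfg x (hbV hx.1)) ?_
        · have : {x | x ∈ Metric.ball y r ∧ 0 < s * ℓ (x - y)} =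
              Metric.ball y r ∩ {x | s * ℓ y < (s • ℓ) x} := by
            ext x
            simp [mul_sub]
          rw [this]
          exact (convex_ball y r).inter (convex_halfSpace_gt (s • ℓ).isLinear _)
        · obtain ⟨e, he⟩ : ∃ e, ℓ e ≠ 0 := by
            by_contra! h
            exact hℓ (LinearMap.ext h)
          have hlim : Tendsto (fun t : ℝ => y + t • (s * ℓ e) • e) (𝓝 0) (𝓝 y) := by
            have : Continuous fun t : ℝ => y + t • (s * ℓ e) • e := by fun_prop
            simpa using this.tendsto 0
          obtain ⟨t, ht, ht0⟩ := (((hlim.eventually hbn).filter_mono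
            nhdsWithin_le_nhds).and (self_mem_nhdsWithin (s := Ioi (0 : ℝ)))).exists
          refine ⟨_, ht, ?_⟩
          have ht0' : 0 < t := ht0
          have : 0 < (s * ℓ e) * (s * ℓ e) := mul_self_pos.2 (mul_ne_zero hs he)
          simp only [add_sub_cancel_left, map_smul, smul_eq_mul]
          nlinarith
        · intro m hm m' hm' hne x hx hxe
          have hW' : affineEqLocus m m' ∈ eqLoci 𝒢 := ⟨m, hm, m', hm', hne, rfl⟩
          have hx' : x ∈ affineEqLocus m m' := mem_affineEqLocus.2 hxe
          rw [(huniq _ hW' ((hball x hx.1).1 _ hW' hx')).1, hWℓ] at hx'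
          have := hx.2
          rw [hx'] at this
          simp at this
      obtain ⟨m₁, -, hm₁⟩ := hside 1 one_ne_zero
      obtain ⟨m₂, -, hm₂⟩ := hside (-1) (by norm_num)
      have hcross := det_mul_det_pos_of_crossing hr (hf.mono hbV) (hinj.mono hbV) hℓ
        (fun z hz h => hm₁ ⟨hz, by simpa using h⟩) (fun z hz h => hm₂ ⟨hz, by simpa using h⟩)
      -- A branch valid near a point of `W` is also valid at nearby points off `W`, and so is one of
      -- the two branches `m₁`, `m₂`.
      have hbranch : ∀ x ∈ Metric.ball y r, ∀ m : E →ᵃ[ℝ] E, f =ᶠ[𝓝 x] m → m = m₁ ∨ m = m₂ := by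
        intro x hx m hm
        obtain ⟨U, hU, hUo, hxU⟩ := mem_nhds_iff.1
          ((eventually_eventuallyEq_nhds.2 hm).and (Metric.isOpen_ball.mem_nhds hx))
        obtain ⟨u, huU, hu⟩ := (dense_notMem_affineSubspaces (finite_singleton W)
          (by rintro _ rfl; exact ne_top_of_mem_eqLoci hW)).inter_open_nonempty U hUo ⟨x, hxU⟩
        have hu0 : ℓ (u - y) ≠ 0 := fun h => hu W rfl ((hWℓ u).2 h)
        have hub := (hU huU).2
        have hum := (hU huU).1
        rcases hu0.lt_or_gt with h | h
        · right
          refine eq_of_eventuallyEq (hum.symm.trans ?_)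
          filter_upwards [Metric.isOpen_ball.mem_nhds hub,
            (isOpen_lt hℓc continuous_const).mem_nhds h] with v hv hv'
          exact hm₂ ⟨hv, by simpa using hv'⟩
        · left
          refine eq_of_eventuallyEq (hum.symm.trans ?_)
          filter_upwards [Metric.isOpen_ball.mem_nhds hub,
            (isOpen_lt continuous_const hℓc).mem_nhds h] with v hv hv'
          exact hm₁ ⟨hv, by simpa using hv'⟩
      rcases hbranch z hzb g hg with rfl | rfl <;> rcases hbranch z' hzb' g' hg' with rfl | rfl
      · linarith
      · nlinarith
      · nlinarith
      · linarith
    · push Not at hW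
      obtain ⟨m, -, hm⟩ := exists_eqOn_of_isPreconnected (V := Metric.ball y r)
        (convex_ball y r).isPreconnected ⟨y, Metric.mem_ball_self hr⟩ (hf.mono hbV) h𝒢
        (fun x hx => hfg x (hbV hx)) (by
          intro g hg g' hg' hne x hx hxe
          have hW' : affineEqLocus g g' ∈ eqLoci 𝒢 := ⟨g, hg, g', hg', hne, rfl⟩
          exact hW _ hW' ((hball x hx).1 _ hW' (mem_affineEqLocus.2 hxe)))
      have e : ∀ x ∈ Metric.ball y r, ∀ g : E →ᵃ[ℝ] E, f =ᶠ[𝓝 x] g → g = m := fun x hx g hg =>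
        eq_of_eventuallyEq (hg.symm.trans
          (hm.eventuallyEq_of_mem (Metric.isOpen_ball.mem_nhds hx)))
      rw [e z hzb g hg] at hgp
      rw [e z' hzb' g' hg'] at hgn
      linarith

/-- Where a piecewise-affine map is differentiable, its derivative is the linear part of a branch
which occurs on an open set. -/
theorem exists_fderiv_eq {V : Set E} (hVo : IsOpen V) {f : E → E}
    (hf : ContinuousOn f V) {𝒢 : Set (E →ᵃ[ℝ] E)} (h𝒢 : 𝒢.Finite)
    (hfg : ∀ x ∈ V, ∃ g ∈ 𝒢, f x = g x) {y : E} (hy : y ∈ V) (hd : DifferentiableAt ℝ f y) :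
    ∃ m : E →ᵃ[ℝ] E, (fderiv ℝ f y : E →ₗ[ℝ] E) = m.linear ∧ ∃ z ∈ V, f =ᶠ[𝓝 z] m := by
  -- Only the branches realised on an open set are kept. By density these still cover all of `V`.
  set 𝒢' : Set (E →ᵃ[ℝ] E) := {g ∈ 𝒢 | ∃ z ∈ V, f =ᶠ[𝓝 z] g}
  have h𝒢' : 𝒢'.Finite := h𝒢.subset fun g hg => hg.1
  have hfg' : ∀ x ∈ V, ∃ g ∈ 𝒢', f x = g x := by
    refine forall_exists_eq_of_dense hVo (T := {x | ∃ g ∈ 𝒢', f x = g x}) ?_ hf h𝒢'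
      fun x _ hx => hx
    intro U hU hUV hne
    obtain ⟨z, hz, g, hg, h⟩ := exists_eventuallyEq hU hne (hf.mono hUV) h𝒢
      fun x hx => hfg x (hUV hx)
    exact ⟨z, hz, g, ⟨hg, z, hUV hz, h⟩, h.eq_of_nhds⟩
  -- Along the line through `y` in direction `w`, one of the finitely many branches agrees with `f`
  -- at parameters arbitrarily close to 0. The difference quotients at these parameters give the
  -- directional derivative.
  have hcover : ∀ w : E, ∃ g ∈ 𝒢', fderiv ℝ f y w = g.linear w := by
    intro w
    by_contra! hcon
    have hlim : Tendsto (fun t : ℝ => y + t • w) (𝓝 0) (𝓝 y) := by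
      have : Continuous fun t : ℝ => y + t • w := by fun_prop
      simpa using this.tendsto 0
    have hV : ∀ᶠ t in 𝓝[≠] (0 : ℝ), y + t • w ∈ V :=
      (hlim.eventually (hVo.mem_nhds hy)).filter_mono nhdsWithin_le_nhds
    have hline : HasDerivAt (fun t : ℝ => f (y + t • w)) (fderiv ℝ f y w) 0 := by
      have h1 : HasDerivAt (fun t : ℝ => y + t • w) w 0 := by
        simpa using ((hasDerivAt_id (0 : ℝ)).smul_const w).const_add y
      have h2 : HasFDerivAt f (fderiv ℝ f y) (y + (0 : ℝ) • w) := by simpa using hd.hasFDerivAt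
      exact h2.comp_hasDerivAt 0 h1
    have hg0 : ∀ g ∈ 𝒢', ∀ᶠ t in 𝓝[≠] (0 : ℝ), f (y + t • w) ≠ g (y + t • w) := by
      intro g hg
      by_contra hfr
      have hfr : ∃ᶠ t in 𝓝[≠] (0 : ℝ), f (y + t • w) = g (y + t • w) := by
        rwa [Filter.not_eventually, funext fun t => propext not_not] at hfr
      have hgy : f y = g y := by
        have l1 : Tendsto (fun t : ℝ => f (y + t • w)) (𝓝[≠] 0) (𝓝 (f y)) :=
          ((hf.continuousAt (hVo.mem_nhds hy)).tendsto.comp hlim).mono_left nhdsWithin_le_nhds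
        have l2 : Tendsto (fun t : ℝ => g (y + t • w)) (𝓝[≠] 0) (𝓝 (g y)) :=
          ((g.continuous_of_finiteDimensional.tendsto y).comp hlim).mono_left nhdsWithin_le_nhds
        exact tendsto_nhds_unique_of_frequently_eq l1 l2 hfr
      have hgl : HasDerivAt (fun t : ℝ => g (y + t • w)) (g.linear w) 0 := by
        rw [show (fun t : ℝ => g (y + t • w)) = fun t => g y + t • g.linear w from
          funext fun t => affineMap_add_smul g y w t]
        simpa using ((hasDerivAt_id (0 : ℝ)).smul_const (g.linear w)).const_add (g y)
      have s1 := hline.tendsto_slope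
      have s2 := hgl.tendsto_slope
      refine hcon g hg (tendsto_nhds_unique_of_frequently_eq s1 s2 (hfr.mono fun t ht => ?_))
      rw [slope_def_module, slope_def_module, ht, zero_smul, add_zero, hgy]
    obtain ⟨t, ht, htV⟩ := (((eventually_all_finite h𝒢').2 hg0).and hV).exists
    obtain ⟨g, hg, h⟩ := hfg' _ htV
    exact ht g hg h
  by_contra! hcon
  have hne : ∀ g ∈ 𝒢', (fderiv ℝ f y : E →ₗ[ℝ] E) ≠ g.linear := fun g hg he => by
    obtain ⟨z, hz, h⟩ := hg.2
    exact hcon g he z hz h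
  -- If the derivative differed from every branch, finitely many proper subspaces of coincidence
  -- would cover the whole space.
  obtain ⟨w, hw⟩ := (dense_notMem_affineSubspaces
    (h𝒢'.image fun g => affineEqLocus (fderiv ℝ f y : E →ₗ[ℝ] E).toAffineMap g.linear.toAffineMap)
    (by
      rintro _ ⟨g, hg, rfl⟩
      refine affineEqLocus_ne_top fun h => hne g hg ?_
      exact congrArg AffineMap.linear h)).nonempty
  obtain ⟨g, hg, h⟩ := hcover w
  exact hw _ ⟨g, hg, rfl⟩ (mem_affineEqLocus.2 h)

end PiecewiseAffine

noncomputable section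

/-! ### The condition on orientations -/

section Combinatorics

variable {ι : Type*} {n : ℕ}

/-- The permutation of the vertices which extends a glueing and exchanges the opposite vertices. -/
def FacePairing.perm (P : FacePairing ι n) (F : ι × Fin (n + 1)) : Equiv.Perm (Fin (n + 1)) :=
  (Equiv.optionSubtypeNe F.2).symm.trans
    ((Equiv.optionCongr (P.glue F)).trans (Equiv.optionSubtypeNe (P.mate F).2))

theorem FacePairing.perm_self (P : FacePairing ι n) (F : ι × Fin (n + 1)) :
    P.perm F F.2 = (P.mate F).2 := by
  simp [FacePairing.perm]

theorem FacePairing.perm_of_ne (P : FacePairing ι n) (F : ι × Fin (n + 1))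
    (u : {u : Fin (n + 1) // u ≠ F.2}) : P.perm F u = P.glue F u := by
  simp [FacePairing.perm, Equiv.optionSubtypeNe_symm_of_ne u.2]

theorem FacePairing.perm_mate (P : FacePairing ι n) (F : ι × Fin (n + 1)) (u : Fin (n + 1)) :
    P.perm (P.mate F) (P.perm F u) = u := by
  by_cases hu : u = F.2
  · rw [hu, P.perm_self, P.perm_self, P.mate_mate]
  · rw [P.perm_of_ne F ⟨u, hu⟩, P.perm_of_ne, P.glue_symm]

theorem fullOrdering_trans_glue (P : FacePairing ι n) (F : ι × Fin (n + 1))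
    (e : Fin n ≃ {u : Fin (n + 1) // u ≠ F.2}) :
    fullOrdering (P.mate F).2 (e.trans (P.glue F)) = (fullOrdering F.2 e).trans (P.perm F) := by
  ext k
  refine Fin.cases ?_ (fun k => ?_) k
  · simp [fullOrdering, P.perm_self]
  · simp [fullOrdering, P.perm_of_ne]

/-- The sign of the ordering `e` enters both sides as the same factor and cancels, so one ordering
per face decides the condition. -/
theorem FacePairing.ori_iff (P : FacePairing ι n) :
    P.Ori ↔ ∃ ε : ι → ℤˣ, ∀ F, ε (P.mate F).1 * Equiv.Perm.sign (P.perm F) = - ε F.1 := by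
  unfold FacePairing.Ori inducedSign
  refine exists_congr fun ε => forall_congr' fun F => ?_
  simp only [fullOrdering_trans_glue, Equiv.Perm.sign_trans]
  constructor
  · intro h
    have := h (finSuccAboveEquiv F.2)
    rw [← mul_assoc, ← neg_mul] at this
    exact mul_right_cancel this
  · intro h e
    rw [← mul_assoc, h, neg_mul]

/-- With respect to a linear order, the smaller element of each pair receives the sign 1. -/
theorem exists_sign_of_involution {Y : Type*} (τ : Y → Y) (hne : ∀ y, τ y ≠ y)
    (hτ : ∀ y, τ (τ y) = y) : ∃ σ : Y → ℤˣ, ∀ y, σ (τ y) = - σ y := by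
  classical
  let : LinearOrder Y := linearOrderOfSTO (WellOrderingRel : Y → Y → Prop)
  refine ⟨fun y => if y < τ y then 1 else -1, fun y => ?_⟩
  rcases (hne y).lt_or_gt with h | h
  · simp [hτ, h, h.not_gt]
  · simp [hτ, h, h.not_gt]

/-- The two involutions generate a dihedral action and `t = μτ` is its rotation. Since `τ` exchanges
the cycles of `t` without fixing any, the sign can be taken constant on these cycles; then `μ = tτ`
reverses it whenever `τ` does. -/
theorem exists_sign_of_two_involutions {Y : Type*} (τ μ : Equiv.Perm Y) (hτ : τ * τ = 1)
    (hμ : μ * μ = 1) (hτne : ∀ y, τ y ≠ y) (hμne : ∀ y, μ y ≠ y) :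
    ∃ σ : Y → ℤˣ, ∀ y, σ (τ y) = - σ y ∧ σ (μ y) = - σ y := by
  set t : Equiv.Perm Y := μ * τ with ht
  have hτ' : τ⁻¹ = τ := inv_eq_of_mul_eq_one_left hτ
  have hμ' : μ⁻¹ = μ := inv_eq_of_mul_eq_one_left hμ
  have hsemi : SemiconjBy τ t t⁻¹ := by
    change τ * t = t⁻¹ * τ
    rw [ht, mul_inv_rev, hτ', hμ']
    group
  have hk : ∀ (k : ℤ) (x : Y), τ ((t ^ k) x) = (t ^ (-k)) (τ x) := by
    intro k x
    have := (hsemi.zpow_right k).eq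
    rw [inv_zpow'] at this
    exact congrArg (fun p : Equiv.Perm Y => p x) this
  have htτ : ∀ y, t (τ y) = μ y := by
    intro y
    have : τ (τ y) = y := congrArg (fun p : Equiv.Perm Y => p y) hτ
    simp [ht, this]
  have hnot : ∀ x, ¬ t.SameCycle x (τ x) := by
    -- Suppose `t ^ k` sends `x` to `τ x`. For even `k = 2m` the point `t ^ m x` would be fixed by
    -- `τ`; for odd `k = 2m + 1` the point `τ (t ^ m x)` would be fixed by `μ`.
    rintro x ⟨k, hk'⟩
    rcases Int.even_or_odd' k with ⟨m, rfl | rfl⟩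
    · apply hτne ((t ^ m) x)
      rw [hk, ← hk', ← Equiv.Perm.mul_apply, ← zpow_add]
      congr 2
      ring
    · apply hμne (τ ((t ^ m) x))
      change t ((t ^ m) x) = _
      rw [hk, ← hk', ← Equiv.Perm.mul_apply, ← Equiv.Perm.mul_apply, ← zpow_add, ← zpow_one_add]
      congr 2
      ring
  let Q := Quotient (Equiv.Perm.SameCycle.setoid t)
  let τQ : Q → Q := Quotient.map τ (by
    rintro x y ⟨k, rfl⟩
    exact ⟨-k, (hk k x).symm⟩)
  obtain ⟨σ, hσ⟩ := exists_sign_of_involution τQ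
    (by
      intro q
      induction q using Quotient.inductionOn with
      | h x => exact fun h => hnot x (Quotient.exact h).symm)
    (by
      intro q
      induction q using Quotient.inductionOn with
      | h x => exact congrArg _ (congrArg (fun p : Equiv.Perm Y => p x) hτ))
  refine ⟨fun y => σ (Quotient.mk _ y), fun y => ⟨hσ (Quotient.mk _ y), ?_⟩⟩
  rw [← hσ (Quotient.mk _ y)]
  refine congrArg σ (Quotient.sound ?_)
  refine ⟨-1, ?_⟩
  rw [← htτ]
  simp

theorem FacePairing.ori_of_dim_zero (P : FacePairing ι 0) : P.Ori := by
  obtain ⟨σ, hσ⟩ := exists_sign_of_involution P.mate P.mate_ne P.mate_mate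
  refine P.ori_iff.2 ⟨fun i => σ (i, 0), fun F => ?_⟩
  have h1 : ∀ F : ι × Fin 1, ((F.1, 0) : ι × Fin 1) = F := fun F => by
    ext1
    · rfl
    · exact Subsingleton.elim _ _
  simp only
  rw [h1, h1, hσ, show P.perm F = 1 from Equiv.ext fun _ => Subsingleton.elim (α := Fin 1) _ _, map_one, mul_one]

/-- The ends of the segments are permuted by two involutions, the exchange of the ends of each
segment and the glueing. Signs of the ends reversed by both of them orient the resulting circles and
lines. The truncated segments require this separately, since their glued ends have been removed. -/
theorem FacePairing.ori_of_dim_one (P : FacePairing ι 1) : P.Ori := by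
  obtain ⟨σ, hσ⟩ := exists_sign_of_two_involutions
    (Equiv.prodCongrRight fun _ : ι => Equiv.swap (0 : Fin 2) 1)
    (Function.Involutive.toPerm P.mate P.mate_mate)
    (by ext1 ⟨i, v⟩; simp) (Equiv.ext fun F => P.mate_mate F)
    (by
      rintro ⟨i, v⟩ h
      have h' : Equiv.swap (0 : Fin 2) 1 v = v := congrArg Prod.snd h
      revert h'
      clear h
      revert v
      decide)
    P.mate_ne
  have h1 : ∀ i v, σ (i, v) = σ (i, 0) * (if v = 0 then 1 else -1) := by
    intro i v
    fin_cases v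
    · simp
    · have := (hσ (i, 0)).1
      simpa using this
  have h2 : ∀ (p : Equiv.Perm (Fin 2)) (v : Fin 2), Equiv.Perm.sign p =
      (if v = 0 then 1 else -1) * (if p v = 0 then 1 else -1) := by decide
  refine P.ori_iff.2 ⟨fun i => σ (i, 0), fun F => ?_⟩
  have h3 := (hσ F).2
  change σ ((P.mate F).1, (P.mate F).2) = - σ (F.1, F.2) at h3
  rw [h1, h1 F.1] at h3
  rw [h2 _ F.2, P.perm_self]
  rw [mul_comm (ite _ _ _), ← mul_assoc, h3]
  split_ifs <;> simp

end Combinatorics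

/-! ### Affine coordinates on the hyperplane of the standard simplex -/

section Coordinates

variable {n : ℕ}

/-- The linear part of `baryCoord`. -/
def baryLinear (n : ℕ) : (Fin n → ℝ) →ₗ[ℝ] (Fin (n + 1) → ℝ) where
  toFun y := Fin.cons (- ∑ k, y k) y
  map_add' x y := by
    ext u
    refine Fin.cases ?_ (fun k => ?_) u
    · simp [Finset.sum_add_distrib, add_comm]
    · simp
  map_smul' c y := by
    ext u
    refine Fin.cases ?_ (fun k => ?_) u
    · simp [Finset.mul_sum]
    · simp

/-- The barycentric coordinates as functions of all of them but the first. -/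
def baryCoord (n : ℕ) : (Fin n → ℝ) →ᵃ[ℝ] (Fin (n + 1) → ℝ) where
  toFun y := baryLinear n y + Pi.single 0 1
  linear := baryLinear n
  map_vadd' y v := by simp [add_assoc]

/-- All the barycentric coordinates but the first. -/
def tailCoord (n : ℕ) : (Fin (n + 1) → ℝ) →ₗ[ℝ] (Fin n → ℝ) := LinearMap.funLeft ℝ ℝ Fin.succ

@[simp] theorem tailCoord_apply (x : Fin (n + 1) → ℝ) (k : Fin n) : tailCoord n x k = x k.succ := rfl

@[simp] theorem baryLinear_zero (y : Fin n → ℝ) : baryLinear n y 0 = - ∑ k, y k := rfl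

@[simp] theorem baryLinear_succ (y : Fin n → ℝ) (k : Fin n) : baryLinear n y k.succ = y k := rfl

theorem baryCoord_apply (y : Fin n → ℝ) : baryCoord n y = baryLinear n y + Pi.single 0 1 := rfl

@[simp] theorem sum_baryLinear (y : Fin n → ℝ) : ∑ u, baryLinear n y u = 0 := by
  simp [Fin.sum_univ_succ]

@[simp] theorem sum_baryCoord (y : Fin n → ℝ) : ∑ u, baryCoord n y u = 1 := by
  simp [baryCoord_apply, Finset.sum_add_distrib]

@[simp] theorem tailCoord_baryCoord (y : Fin n → ℝ) : tailCoord n (baryCoord n y) = y := by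
  ext k
  simp [baryCoord_apply]

theorem baryCoord_tailCoord {x : Fin (n + 1) → ℝ} (hx : ∑ u, x u = 1) :
    baryCoord n (tailCoord n x) = x := by
  rw [Fin.sum_univ_succ] at hx
  ext u
  refine Fin.cases ?_ (fun k => ?_) u
  · simp [baryCoord_apply]
    linarith
  · simp [baryCoord_apply]

theorem continuous_baryCoord : Continuous (baryCoord n) :=
  (baryCoord n).continuous_of_finiteDimensional

theorem continuous_tailCoord : Continuous (tailCoord n) :=
  (tailCoord n).continuous_of_finiteDimensional

/-- A linear map which preserves the sum of the coordinates has the same determinant as its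
restriction to the hyperplane of vectors of sum zero. -/
theorem det_tail_comp_baryLinear (M : (Fin (n + 1) → ℝ) →ₗ[ℝ] (Fin (n + 1) → ℝ))
    (hM : ∀ x, ∑ u, M x u = ∑ u, x u) :
    LinearMap.det (tailCoord n ∘ₗ M ∘ₗ baryLinear n) = LinearMap.det M := by
  -- In the coordinates formed by the sum and the tail, the first row of `M` is that of the
  -- identity. Laplace expansion along it leaves the block acting on the vectors of sum zero.
  let Q : (Fin (n + 1) → ℝ) ≃ₗ[ℝ] (Fin (n + 1) → ℝ) :=
    { toFun := fun x => Fin.cons (∑ u, x u) (tailCoord n x)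
      invFun := fun z => Fin.cons (z 0 - ∑ k : Fin n, z k.succ) (tailCoord n z)
      map_add' := fun x y => by
        ext u
        refine Fin.cases ?_ (fun k => ?_) u
        · simp [Finset.sum_add_distrib]
        · simp
      map_smul' := fun c y => by
        ext u
        refine Fin.cases ?_ (fun k => ?_) u
        · simp [Finset.mul_sum]
        · simp
      left_inv := fun x => by
        ext u
        refine Fin.cases ?_ (fun k => ?_) u
        · simp [Fin.sum_univ_succ]
        · simp
      right_inv := fun x => by
        ext u
        refine Fin.cases ?_ (fun k => ?_) u
        · simp [Fin.sum_univ_succ]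
        · simp }
  rw [← LinearMap.det_conj M Q, ← LinearMap.det_toMatrix', ← LinearMap.det_toMatrix',
    Matrix.det_succ_row_zero, Fin.sum_univ_succ, Finset.sum_eq_zero]
  · have h00 : LinearMap.toMatrix' (Q.toLinearMap ∘ₗ M ∘ₗ Q.symm.toLinearMap) 0 0 = 1 := by
      rw [LinearMap.toMatrix'_apply]
      change ∑ u, M (Q.symm _) u = 1
      rw [hM]
      simp [Q, Fin.sum_univ_succ]
    rw [h00]
    simp only [Fin.val_zero, pow_zero, one_mul, add_zero]
    congr 1
    ext k l
    rw [Matrix.submatrix_apply, LinearMap.toMatrix'_apply, LinearMap.toMatrix'_apply]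
    change M _ k.succ = M (Q.symm _) k.succ
    refine congrArg (fun z => M z k.succ) ?_
    ext u
    refine Fin.cases ?_ (fun k => ?_) u
    · simp [Q, Pi.single_apply]
    · simp [Q, Pi.single_apply]
  · intro k _
    have h0 : LinearMap.toMatrix' (Q.toLinearMap ∘ₗ M ∘ₗ Q.symm.toLinearMap) 0 k.succ = 0 := by
      rw [LinearMap.toMatrix'_apply]
      change ∑ u, M (Q.symm _) u = 0
      rw [hM]
      simp [Q, Fin.sum_univ_succ, Pi.single_apply]
    rw [h0]
    simp

theorem det_funLeft_perm (σ : Equiv.Perm (Fin n)) :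
    LinearMap.det (LinearMap.funLeft ℝ ℝ σ) = ((Equiv.Perm.sign σ : ℤ) : ℝ) := by
  rw [← LinearMap.det_toMatrix', ← Matrix.det_permutation]
  congr 1
  ext i j
  simp [LinearMap.toMatrix'_apply, LinearMap.funLeft_apply, Equiv.Perm.permMatrix,
    PEquiv.toMatrix_apply, Pi.single_apply, eq_comm]

/-- A linear reflection which fixes the points of the face opposite to `v` and preserves the sum of
the coordinates. -/
def faceReflection (v : Fin (n + 1)) : (Fin (n + 1) → ℝ) →ₗ[ℝ] (Fin (n + 1) → ℝ) :=
  -- For `n ≠ 0` the coefficients add up to `-2 + n * (2 / n) = 0`, which preserves the sum of the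
  -- coordinates; the determinant is `1 - 2 = -1`.
  LinearMap.transvection (LinearMap.proj v) fun u => if u = v then -2 else 2 / n

@[simp] theorem faceReflection_self (v : Fin (n + 1)) (x : Fin (n + 1) → ℝ) :
    faceReflection v x v = - x v := by
  simp [faceReflection, LinearMap.transvection.apply]
  ring

theorem faceReflection_of_ne {u v : Fin (n + 1)} (h : u ≠ v) (x : Fin (n + 1) → ℝ) :
    faceReflection v x u = x u + x v * (2 / n) := by
  simp [faceReflection, LinearMap.transvection.apply, h]

theorem faceReflection_eq_self {v : Fin (n + 1)} {x : Fin (n + 1) → ℝ} (h : x v = 0) :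
    faceReflection v x = x := by
  ext u
  by_cases hu : u = v
  · simp [hu, h]
  · simp [faceReflection_of_ne hu, h]

@[simp] theorem faceReflection_faceReflection (v : Fin (n + 1)) (x : Fin (n + 1) → ℝ) :
    faceReflection v (faceReflection v x) = x := by
  ext u
  by_cases hu : u = v
  · simp [hu]
  · simp [faceReflection_of_ne hu]

theorem sum_faceReflection (hn : n ≠ 0) (v : Fin (n + 1)) (x : Fin (n + 1) → ℝ) :
    ∑ u, faceReflection v x u = ∑ u, x u := by
  rw [← Finset.add_sum_erase _ _ (Finset.mem_univ v),
    ← Finset.add_sum_erase _ (fun u => x u) (Finset.mem_univ v),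
    Finset.sum_congr rfl fun u hu => faceReflection_of_ne (Finset.ne_of_mem_erase hu) x,
    Finset.sum_add_distrib]
  have : (n : ℝ) ≠ 0 := by exact_mod_cast hn
  simp [Finset.card_erase_of_mem]
  field_simp
  ring

theorem det_faceReflection (v : Fin (n + 1)) : LinearMap.det (faceReflection v) = -1 := by
  rw [faceReflection, LinearMap.transvection.det]
  simp
  norm_num

end Coordinates

/-! ### Points of the glued space -/

section Glued

variable {ι : Type*} {n : ℕ} (P : FacePairing ι n) (A : Set (Fin (n + 1) → ℝ))

/-- The point `x` of the face `F` is glued to the point `x'` of its mate. -/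
def FacePairing.Matched (F : ι × Fin (n + 1)) (x x' : Fin (n + 1) → ℝ) : Prop :=
  x F.2 = 0 ∧ ∀ u, x' (P.perm F u) = x u

variable {P A}

theorem FacePairing.Matched.symm {F : ι × Fin (n + 1)} {x x' : Fin (n + 1) → ℝ}
    (h : P.Matched F x x') : P.Matched (P.mate F) x' x := by
  refine ⟨by rw [← P.perm_self, h.2, h.1], fun u => ?_⟩
  obtain ⟨w, rfl⟩ := (P.perm F).surjective u
  rw [P.perm_mate, h.2]

theorem FacePairing.rel_iff {p q : Σ _ : ι, A} :
    P.Rel A p q ↔ ∃ F, p.1 = F.1 ∧ q.1 = (P.mate F).1 ∧ P.Matched F p.2.1 q.2.1 := by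
  refine exists_congr fun F => and_congr_right fun _ => and_congr_right fun _ => ?_
  constructor
  · rintro ⟨h1, h2, h3⟩
    refine ⟨h1, fun u => ?_⟩
    by_cases hu : u = F.2
    · rw [hu, P.perm_self, h1, h2]
    · rw [P.perm_of_ne F ⟨u, hu⟩, h3]
  · rintro ⟨h1, h2⟩
    refine ⟨h1, by rw [← P.perm_self, h2, h1], fun u => by rw [← P.perm_of_ne, h2]⟩

variable (P A) in
/-- The image in the glued space of the point `x` of the copy of `A` with index `i`. -/
def FacePairing.point [Nonempty A] (i : ι) (x : Fin (n + 1) → ℝ) : P.Glued A := by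
  -- The value outside `A` is arbitrary; `point` is evaluated meaningfully only at elements of `A`.
  classical exact P.proj A i (if h : x ∈ A then ⟨x, h⟩ else Classical.arbitrary A)

variable [Nonempty A]

theorem FacePairing.point_of_mem (i : ι) {x : Fin (n + 1) → ℝ} (hx : x ∈ A) :
    P.point A i x = P.proj A i ⟨x, hx⟩ := by
  simp [FacePairing.point, hx]

theorem FacePairing.exists_point (z : P.Glued A) : ∃ i, ∃ x ∈ A, z = P.point A i x := by
  induction z using Quot.inductionOn with
  | h p => exact ⟨p.1, p.2.1, p.2.2, by rw [FacePairing.point_of_mem p.1 p.2.2]; rfl⟩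

theorem FacePairing.point_eq {F : ι × Fin (n + 1)} {x x' : Fin (n + 1) → ℝ} (hx : x ∈ A)
    (hx' : x' ∈ A) (h : P.Matched F x x') : P.point A F.1 x = P.point A (P.mate F).1 x' := by
  rw [FacePairing.point_of_mem _ hx, FacePairing.point_of_mem _ hx']
  exact Quot.sound (FacePairing.rel_iff.2 ⟨F, rfl, rfl, h⟩)

theorem FacePairing.continuous_proj (i : ι) : Continuous (P.proj A i) :=
  continuous_quot_mk.comp continuous_sigmaMk

theorem FacePairing.continuousOn_point (i : ι) : ContinuousOn (P.point A i) A := by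
  rw [continuousOn_iff_continuous_domRestrict]
  refine (FacePairing.continuous_proj (P := P) (A := A) i).congr fun x => ?_
  rw [Set.domRestrict_apply, FacePairing.point_of_mem i x.2]

theorem FacePairing.isOpen_iff {N : Set (P.Glued A)} :
    IsOpen N ↔ ∀ i, ∀ x ∈ A, P.point A i x ∈ N → ∀ᶠ y in 𝓝 x, y ∈ A → P.point A i y ∈ N := by
  have h1 : IsOpen N ↔ ∀ i, IsOpen {x : A | P.proj A i x ∈ N} :=
    (isOpen_coinduced (f := Quot.mk (P.Rel A))).trans isOpen_sigma_iff
  rw [h1]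
  refine forall_congr' fun i => ?_
  rw [isOpen_iff_eventually]
  constructor
  · intro h x hx hxN
    have := h ⟨x, hx⟩ (by rwa [FacePairing.point_of_mem i hx] at hxN)
    rw [nhds_subtype_eq_comap, eventually_comap] at this
    filter_upwards [this] with y hy hyA
    rw [FacePairing.point_of_mem i hyA]
    exact hy ⟨y, hyA⟩ rfl
  · intro h x hxN
    have := h x x.2 (by rw [FacePairing.point_of_mem i x.2]; exact hxN)
    rw [nhds_subtype_eq_comap, eventually_comap]
    filter_upwards [this] with y hy a ha
    subst ha
    have := hy a.2
    rwa [FacePairing.point_of_mem i a.2] at this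

variable (P A) in
/-- The function on the glued space induced by a function on the disjoint union of the copies. -/
def FacePairing.lift {Y : Type*} (D : ι → (Fin (n + 1) → ℝ) → Y)
    (hD : ∀ (F : ι × Fin (n + 1)) (x x' : Fin (n + 1) → ℝ), x ∈ A → x' ∈ A → P.Matched F x x' →
      D F.1 x = D (P.mate F).1 x') : P.Glued A → Y :=
  Quot.lift (fun p => D p.1 p.2.1) (by
    intro p q h
    obtain ⟨F, h1, h2, h3⟩ := FacePairing.rel_iff.1 h
    simp only [h1, h2]
    exact hD F _ _ p.2.2 q.2.2 h3)

theorem FacePairing.lift_point {Y : Type*} (D : ι → (Fin (n + 1) → ℝ) → Y) (hD) (i : ι)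
    {x : Fin (n + 1) → ℝ} (hx : x ∈ A) : P.lift A D hD (P.point A i x) = D i x := by
  rw [FacePairing.point_of_mem i hx]
  rfl

/-- Glueings permute coordinates, so the set of coordinate values is an invariant. For finite `ι` it
follows that a point of the glued space has finitely many representatives. -/
theorem FacePairing.setRange_eq {i j : ι} {x y : Fin (n + 1) → ℝ} (hx : x ∈ A) (hy : y ∈ A)
    (h : P.point A i x = P.point A j y) : Set.range x = Set.range y := by
  have hD : ∀ (F : ι × Fin (n + 1)) (x x' : Fin (n + 1) → ℝ), x ∈ A → x' ∈ A →
      P.Matched F x x' → Set.range x = Set.range x' := by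
    intro F x x' _ _ h
    rw [← (P.perm F).surjective.range_comp x']
    exact congrArg Set.range (funext fun u => (h.2 u).symm)
  have := congrArg (P.lift A (fun _ x => Set.range x) hD) h
  rwa [FacePairing.lift_point _ hD i hx, FacePairing.lift_point _ hD j hy] at this

/-! ### Local finiteness of charts -/

theorem PLChart.exists_affine_of_point (φ : PLChart P A) {j : ι} {q : Fin (n + 1) → ℝ} (hq : q ∈ A)
    (hs : P.point A j q ∈ φ.source) :
    ∃ 𝒢 : Set ((Fin (n + 1) → ℝ) →ᵃ[ℝ] (Fin n → ℝ)), 𝒢.Finite ∧ ∀ᶠ q' in 𝓝 q, q' ∈ A →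
      P.point A j q' ∈ φ.source ∧ ∃ g ∈ 𝒢, φ.toFun (P.point A j q') = g q' := by
  obtain ⟨K, hK, hKC, hKn⟩ := φ.isPLOn j ⟨q, hq⟩ (by
    rw [FacePairing.point_of_mem j hq] at hs; exact hs)
  have hKC' : ∀ C : Set (Fin (n + 1) → ℝ), ∃ g : (Fin (n + 1) → ℝ) →ᵃ[ℝ] (Fin n → ℝ), C ∈ K →
      ∀ x : A, P.proj A j x ∈ φ.source → x.1 ∈ C → φ.toFun (P.proj A j x) = g x.1 := by
    intro C
    by_cases hC : C ∈ K
    · obtain ⟨-, g, hg⟩ := hKC C hC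
      exact ⟨g, fun _ x hx hxC => hg x hx hxC⟩
    · exact ⟨0, fun h => absurd h hC⟩
  choose g hg using hKC'
  refine ⟨g '' K, hK.image g, ?_⟩
  rw [nhds_subtype_eq_comap, mem_comap'] at hKn
  filter_upwards [hKn, FacePairing.isOpen_iff.1 φ.open_source j q hq hs] with q' h1 h2 hq'
  refine ⟨h2 hq', ?_⟩
  obtain ⟨C, hC, hqC⟩ := h1 (x := ⟨q', hq'⟩) rfl
  refine ⟨g C, ⟨C, hC, rfl⟩, ?_⟩
  have h2' := h2 hq'
  rw [FacePairing.point_of_mem j hq'] at h2' ⊢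
  exact hg C hC ⟨q', hq'⟩ h2' hqC

/-- Near each point of its source, a chart is given by finitely many affine maps. -/
theorem PLChart.exists_affine [Finite ι] (hA : ∀ (σ : Equiv.Perm (Fin (n + 1))), ∀ x ∈ A, x ∘ σ ∈ A)
    (φ : PLChart P A) {z : P.Glued A} (hz : z ∈ φ.source) :
    ∃ N : Set (P.Glued A), IsOpen N ∧ z ∈ N ∧ N ⊆ φ.source ∧
      ∃ 𝒢 : Set ((Fin (n + 1) → ℝ) →ᵃ[ℝ] (Fin n → ℝ)), 𝒢.Finite ∧
        ∀ j, ∀ q ∈ A, P.point A j q ∈ N → ∃ g ∈ 𝒢, φ.toFun (P.point A j q) = g q := by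
  set C : Set (ι × (Fin (n + 1) → ℝ)) := {c | c.2 ∈ A ∧ P.point A c.1 c.2 = z} with hC
  obtain ⟨i, p, hp, hzp⟩ := FacePairing.exists_point z
  have hCf : C.Finite := by
    refine (Set.finite_univ.prod (Set.Finite.pi' fun _ : Fin (n + 1) =>
      Set.finite_range p)).subset ?_
    rintro ⟨j, q⟩ ⟨hq, hjq⟩
    refine ⟨mem_univ _, fun u => ?_⟩
    rw [FacePairing.setRange_eq hp hq (hzp.symm.trans hjq.symm)]
    exact mem_range_self u
  have hloc : ∀ c : ι × (Fin (n + 1) → ℝ),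
      ∃ 𝒢 : Set ((Fin (n + 1) → ℝ) →ᵃ[ℝ] (Fin n → ℝ)), 𝒢.Finite ∧ (c ∈ C → ∀ᶠ q' in 𝓝 c.2, q' ∈ A →
        P.point A c.1 q' ∈ φ.source ∧ ∃ g ∈ 𝒢, φ.toFun (P.point A c.1 q') = g q') := by
    intro c
    by_cases hc : c ∈ C
    · obtain ⟨𝒢, h1, h2⟩ := φ.exists_affine_of_point hc.1 (hc.2.symm ▸ hz)
      exact ⟨𝒢, h1, fun _ => h2⟩
    · exact ⟨∅, finite_empty, fun h => absurd h hc⟩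
  choose 𝒢 h𝒢f h𝒢 using hloc
  -- The radius `δ` works at all representatives at once and is smaller than their nonzero
  -- coordinates. A point of a face within `δ` of a representative therefore forces the
  -- representative onto that face, which makes the union of these balls compatible with the
  -- glueings.
  have hev : ∀ c ∈ C, ∀ᶠ δ in 𝓝[>] (0 : ℝ), (∀ q', dist q' c.2 < δ → q' ∈ A →
      P.point A c.1 q' ∈ φ.source ∧ ∃ g ∈ 𝒢 c, φ.toFun (P.point A c.1 q') = g q') ∧
      ∀ u, c.2 u ≠ 0 → δ < |c.2 u| := by
    intro c hc
    obtain ⟨r, hr, h⟩ := Metric.eventually_nhds_iff.1 (h𝒢 c hc)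
    refine Eventually.and ?_ ?_
    · filter_upwards [Ioo_mem_nhdsGT hr] with δ hδ q' hq'
      exact h (hq'.trans hδ.2)
    · rw [eventually_all]
      intro u
      by_cases hu : c.2 u = 0
      · exact Eventually.of_forall fun _ h => absurd hu h
      · filter_upwards [Ioo_mem_nhdsGT (abs_pos.2 hu)] with δ hδ _ using hδ.2
  obtain ⟨δ, hδ, hδ0⟩ := (((eventually_all_finite hCf).2 hev).and self_mem_nhdsWithin).exists
  have hδ0' : 0 < δ := hδ0
  set N' : ι → (Fin (n + 1) → ℝ) → Prop := fun j y => ∃ c ∈ C, c.1 = j ∧ dist y c.2 < δ with hN'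
  have himp : ∀ (F : ι × Fin (n + 1)) (x x' : Fin (n + 1) → ℝ), P.Matched F x x' →
      N' F.1 x → N' (P.mate F).1 x' := by
    rintro F x x' hm ⟨c, hc, hcF, hd⟩
    have h0 : c.2 F.2 = 0 := by
      by_contra h
      have h1 := (hδ c hc).2 _ h
      have h2 := (dist_le_pi_dist x c.2 F.2).trans_lt hd
      rw [hm.1, dist_zero_left, Real.norm_eq_abs] at h2
      exact lt_asymm h1 h2
    have hm' : P.Matched F c.2 (c.2 ∘ (P.perm F).symm) := ⟨h0, fun u => by simp⟩
    refine ⟨((P.mate F).1, c.2 ∘ (P.perm F).symm), ⟨hA _ _ hc.1, ?_⟩, rfl, ?_⟩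
    · rw [← FacePairing.point_eq hc.1 (hA _ _ hc.1) hm', ← hcF, hc.2]
    · rw [dist_pi_lt_iff hδ0']
      intro u
      obtain ⟨w, rfl⟩ := (P.perm F).surjective u
      rw [hm.2]
      simpa using (dist_le_pi_dist x c.2 w).trans_lt hd
  have hinv : ∀ (F : ι × Fin (n + 1)) (x x' : Fin (n + 1) → ℝ), x ∈ A → x' ∈ A →
      P.Matched F x x' → N' F.1 x = N' (P.mate F).1 x' := by
    intro F x x' _ _ hm
    refine propext ⟨himp F x x' hm, fun h => ?_⟩
    have := himp _ _ _ hm.symm h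
    rwa [P.mate_mate] at this
  have hmem : ∀ j, ∀ q ∈ A, P.lift A N' hinv (P.point A j q) ↔ N' j q := fun j q hq => by
    rw [FacePairing.lift_point _ hinv j hq]
  have hall : ∀ j, ∀ q ∈ A, N' j q →
      P.point A j q ∈ φ.source ∧ ∃ g ∈ ⋃ c ∈ C, 𝒢 c, φ.toFun (P.point A j q) = g q := by
    rintro j q hq ⟨c, hc, rfl, hd⟩
    obtain ⟨h1, g, hg, h2⟩ := (hδ c hc).1 q hd hq
    exact ⟨h1, g, mem_biUnion hc hg, h2⟩
  refine ⟨{w | P.lift A N' hinv w}, ?_, ?_, ?_, ⋃ c ∈ C, 𝒢 c, hCf.biUnion fun c _ => h𝒢f c, ?_⟩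
  · rw [FacePairing.isOpen_iff]
    intro j x hx hxN
    obtain ⟨c, hc, hcj, hd⟩ := (hmem j x hx).1 hxN
    filter_upwards [Metric.isOpen_ball.mem_nhds (Metric.mem_ball.2 hd)] with y hy hyA
    exact (hmem j y hyA).2 ⟨c, hc, hcj, hy⟩
  · rw [hzp]
    exact (hmem i p hp).2 ⟨(i, p), ⟨hp, hzp.symm⟩, rfl, by simpa using hδ0'⟩
  · intro w hw
    obtain ⟨j, q, hq, rfl⟩ := FacePairing.exists_point w
    exact (hall j q hq ((hmem j q hq).1 hw)).1
  · intro j q hq hN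
    exact (hall j q hq ((hmem j q hq).1 hN)).2

end Glued

/-! ### Unfolding the glued space along a codimension-one face -/

section Fold

variable {ι : Type*} {n : ℕ} {P : FacePairing ι n} {A : Set (Fin (n + 1) → ℝ)}

/-- The sign `ε` as a real number. -/
def signR (ε : ℤˣ) : ℝ := ((ε : ℤ) : ℝ)

theorem signR_mul_self (ε : ℤˣ) : signR ε * signR ε = 1 := by
  rcases Int.units_eq_one_or ε with rfl | rfl <;> simp [signR]

theorem signR_mul (ε ε' : ℤˣ) : signR (ε * ε') = signR ε * signR ε' := by simp [signR]

theorem signR_neg (ε : ℤˣ) : signR (-ε) = - signR ε := by simp [signR]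

theorem signR_ne_zero (ε : ℤˣ) : signR ε ≠ 0 := fun h => by
  have := signR_mul_self ε
  rw [h] at this
  simp at this

/-- Unfolding along the face `F`: the affine map between the coordinates of the two simplices which
share that face. -/
def FacePairing.foldMap (P : FacePairing ι n) (F : ι × Fin (n + 1)) :
    (Fin n → ℝ) →ᵃ[ℝ] (Fin n → ℝ) :=
  (tailCoord n ∘ₗ faceReflection F.2 ∘ₗ LinearMap.funLeft ℝ ℝ (P.perm F)).toAffineMap.comp
    (baryCoord n)

theorem FacePairing.foldMap_tailCoord (F : ι × Fin (n + 1)) {x : Fin (n + 1) → ℝ}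
    (hx : ∑ u, x u = 1) :
    P.foldMap F (tailCoord n x) = tailCoord n (faceReflection F.2 (x ∘ P.perm F)) := by
  simp only [FacePairing.foldMap, AffineMap.comp_apply, baryCoord_tailCoord hx]
  rfl

/-- The minus sign in **Ori** originates here: it is the determinant of the reflection in the face.
-/
theorem FacePairing.det_foldMap (hn : n ≠ 0) (F : ι × Fin (n + 1)) :
    LinearMap.det (P.foldMap F).linear = - signR (Equiv.Perm.sign (P.perm F)) := by
  have := det_tail_comp_baryLinear (n := n)
    (faceReflection F.2 ∘ₗ LinearMap.funLeft ℝ ℝ (P.perm F)) (fun x => by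
      rw [LinearMap.comp_apply, sum_faceReflection hn]
      exact Equiv.sum_comp (P.perm F) x)
  rw [LinearMap.det_comp, det_faceReflection, det_funLeft_perm, neg_one_mul] at this
  exact this

theorem tailCoord_injOn {x x' : Fin (n + 1) → ℝ} (hx : ∑ u, x u = 1) (hx' : ∑ u, x' u = 1)
    (h : tailCoord n x = tailCoord n x') : x = x' := by
  rw [← baryCoord_tailCoord hx, h, baryCoord_tailCoord hx']

/-- The part of the hyperplane of the simplex near the interior of the face opposite to `v`. -/
def faceRegion (v : Fin (n + 1)) : Set (Fin (n + 1) → ℝ) := {x | ∀ u, u ≠ v → x v < x u}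

theorem isOpen_faceRegion (v : Fin (n + 1)) : IsOpen (faceRegion v) := by
  simp only [faceRegion, ofPred_forall]
  exact isOpen_iInter_of_finite fun u => isOpen_iInter_of_finite fun _ =>
    isOpen_lt (continuous_apply v) (continuous_apply u)

theorem notMem_faceRegion {v v' : Fin (n + 1)} (h : v ≠ v') {x : Fin (n + 1) → ℝ}
    (hx : x ∈ faceRegion v) : x ∉ faceRegion v' :=
  fun hx' => lt_asymm (hx v' h.symm) (hx' v h)

/-- A local injective map from the glued space to `ℝⁿ` which is given on each piece by affine maps
satisfying `Q`. -/
structure IsFold (P : FacePairing ι n) (A : Set (Fin (n + 1) → ℝ)) [Nonempty A]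
    (Q : ι → ((Fin n → ℝ) →ᵃ[ℝ] (Fin n → ℝ)) → Prop) (Ω : Set (P.Glued A)) (D : P.Glued A → Fin n → ℝ) : Prop where
  isOpen : IsOpen Ω
  continuousOn : ContinuousOn D Ω
  injOn : InjOn D Ω
  exists_affine : ∃ 𝒟 : Set ((Fin n → ℝ) →ᵃ[ℝ] (Fin n → ℝ)), 𝒟.Finite ∧
    ∀ j, ∀ q ∈ A, P.point A j q ∈ Ω → ∃ d ∈ 𝒟, Q j d ∧
      ∀ᶠ q' in 𝓝 q, q' ∈ A → D (P.point A j q') = d (tailCoord n q')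

variable [Nonempty A]

/-- A partially defined map on the copies, with `none` for undefined, descends to the quotient when
it respects the glueings. By symmetry of the glueings it is enough to test this on the side where
the map is defined. -/
theorem isFold_of_option {Q : ι → ((Fin n → ℝ) →ᵃ[ℝ] (Fin n → ℝ)) → Prop}
    (ψ : ι → (Fin (n + 1) → ℝ) → Option (Fin n → ℝ))
    (hψ : ∀ (F : ι × Fin (n + 1)) (x x' : Fin (n + 1) → ℝ), x ∈ A → x' ∈ A → P.Matched F x x' →
      (ψ F.1 x).isSome → ψ F.1 x = ψ (P.mate F).1 x')
    (𝒟 : Set ((Fin n → ℝ) →ᵃ[ℝ] (Fin n → ℝ))) (h𝒟 : 𝒟.Finite)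
    (h1 : ∀ j, ∀ q ∈ A, (ψ j q).isSome → ∃ d ∈ 𝒟, Q j d ∧
      ∀ᶠ q' in 𝓝 q, q' ∈ A → ψ j q' = some (d (tailCoord n q')))
    (h2 : ∀ j, ∀ q ∈ A, ∀ j', ∀ q' ∈ A, ∀ a, ψ j q = some a → ψ j' q' = some a →
      P.point A j q = P.point A j' q') :
    ∃ Ω D, IsFold P A Q Ω D ∧
      ∀ j, ∀ q ∈ A, ∀ a, ψ j q = some a ↔ P.point A j q ∈ Ω ∧ D (P.point A j q) = a := by
  have hinv : ∀ (F : ι × Fin (n + 1)) (x x' : Fin (n + 1) → ℝ), x ∈ A → x' ∈ A → P.Matched F x x' →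
      ψ F.1 x = ψ (P.mate F).1 x' := by
    intro F x x' hx hx' hm
    by_cases h : (ψ F.1 x).isSome
    · exact hψ F x x' hx hx' hm h
    · by_cases h' : (ψ (P.mate F).1 x').isSome
      · have := hψ _ _ _ hx' hx hm.symm h'
        rw [P.mate_mate] at this
        exact this.symm
      · simp only [Option.not_isSome_iff_eq_none] at h h'
        rw [h, h']
  set L := P.lift A ψ hinv with hL
  have hLp : ∀ j, ∀ q ∈ A, L (P.point A j q) = ψ j q := fun j q hq =>
    FacePairing.lift_point _ hinv j hq
  refine ⟨{z | (L z).isSome}, fun z => (L z).getD 0, ⟨?_, ?_, ?_, 𝒟, h𝒟, ?_⟩, ?_⟩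
  · rw [FacePairing.isOpen_iff]
    intro j x hx hxs
    obtain ⟨d, -, -, hd⟩ := h1 j x hx (by rw [← hLp j x hx]; exact hxs)
    filter_upwards [hd] with y hy hyA
    rw [hLp j y hyA, hy hyA]
    rfl
  · rw [continuousOn_open_iff]
    · intro O hO
      rw [FacePairing.isOpen_iff]
      rintro j x hx ⟨hxs, hxO⟩
      obtain ⟨d, -, -, hd⟩ := h1 j x hx (by rw [← hLp j x hx]; exact hxs)
      have hxd := hd.self_of_nhds hx
      have hc : Continuous fun y => d (tailCoord n y) :=
        d.continuous_of_finiteDimensional.comp continuous_tailCoord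
      have hxO' : d (tailCoord n x) ∈ O := by
        have : (L (P.point A j x)).getD 0 ∈ O := hxO
        rwa [hLp j x hx, hxd] at this
      filter_upwards [hd, hc.continuousAt.eventually (hO.mem_nhds hxO')] with y hy hyO hyA
      refine ⟨?_, ?_⟩
      · change (L _).isSome
        rw [hLp j y hyA, hy hyA]
        rfl
      · change (L _).getD 0 ∈ O
        rw [hLp j y hyA, hy hyA]
        exact hyO
    · rw [FacePairing.isOpen_iff]
      intro j x hx hxs
      obtain ⟨d, -, -, hd⟩ := h1 j x hx (by rw [← hLp j x hx]; exact hxs)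
      filter_upwards [hd] with y hy hyA
      rw [hLp j y hyA, hy hyA]
      rfl
  · intro z hz w hw h
    obtain ⟨j, q, hq, rfl⟩ := FacePairing.exists_point z
    obtain ⟨j', q', hq', rfl⟩ := FacePairing.exists_point w
    obtain ⟨a, ha⟩ := Option.isSome_iff_exists.1 hz
    obtain ⟨b, hb⟩ := Option.isSome_iff_exists.1 hw
    have hab : a = b := by
      have : (L (P.point A j q)).getD 0 = (L (P.point A j' q')).getD 0 := h
      rwa [ha, hb] at this
    subst hab
    rw [hLp j q hq] at ha
    rw [hLp j' q' hq'] at hb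
    exact h2 j q hq j' q' hq' a ha hb
  · intro j q hq hs
    obtain ⟨d, hd𝒟, hpos, hd⟩ := h1 j q hq (by rw [← hLp j q hq]; exact hs)
    refine ⟨d, hd𝒟, hpos, ?_⟩
    filter_upwards [hd] with y hy hyA
    rw [hLp j y hyA, hy hyA]
    rfl
  · intro j q hq a
    rw [← hLp j q hq]
    change _ ↔ (L (P.point A j q)).isSome = true ∧ (L (P.point A j q)).getD 0 = a
    cases L (P.point A j q) <;> simp

/-- Local coordinates at points of the interior of a simplex. -/
theorem exists_isFold_of_pos (hA : A ⊆ stdSimplex ℝ (Fin (n + 1))) (i : ι) :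
    ∃ Ω D, IsFold P A (fun j d => j = i ∧ d = AffineMap.id ℝ _) Ω D ∧
      (∀ q ∈ A, (∀ u, 0 < q u) → P.point A i q ∈ Ω) ∧
      (∀ j, ∀ q ∈ A, P.point A j q ∈ Ω → j = i ∧ D (P.point A j q) = tailCoord n q) := by
  classical
  set ψ : ι → (Fin (n + 1) → ℝ) → Option (Fin n → ℝ) := fun j q =>
    if j = i ∧ ∀ u, 0 < q u then some (tailCoord n q) else none with hψ
  have hsome : ∀ {j q a}, ψ j q = some a → j = i ∧ (∀ u, 0 < q u) ∧ a = tailCoord n q := by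
    intro j q a h
    simp only [hψ] at h
    split_ifs at h with h'
    exact ⟨h'.1, h'.2, (Option.some.inj h).symm⟩
  obtain ⟨Ω, D, h2, h3⟩ := isFold_of_option (P := P) (A := A)
    (Q := fun j d => j = i ∧ d = AffineMap.id ℝ _) ψ
    (by
      intro F x x' hx hx' hm hs
      obtain ⟨a, ha⟩ := Option.isSome_iff_exists.1 hs
      exact absurd hm.1 ((hsome ha).2.1 F.2).ne')
    {AffineMap.id ℝ _} (finite_singleton _)
    (by
      intro j q hq hs
      obtain ⟨a, ha⟩ := Option.isSome_iff_exists.1 hs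
      obtain ⟨rfl, hq0, -⟩ := hsome ha
      refine ⟨_, rfl, ⟨rfl, rfl⟩, ?_⟩
      have hev : ∀ᶠ q' in 𝓝 q, ∀ u, 0 < q' u := eventually_all.2 fun u =>
        (continuous_apply u).continuousAt.eventually_const_lt (hq0 u)
      filter_upwards [hev] with q' hq' _
      simp only [hψ, true_and]
      rw [if_pos hq']
      rfl)
    (by
      intro j q hq j' q' hq' a h h'
      obtain ⟨rfl, -, rfl⟩ := hsome h
      obtain ⟨rfl, -, h⟩ := hsome h'
      rw [tailCoord_injOn (hA hq).2 (hA hq').2 h])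
  refine ⟨Ω, D, h2, fun q hq hpos => ?_, fun j q hq hΩ => ?_⟩
  · exact ((h3 i q hq (tailCoord n q)).1 (by simp [hψ, hpos])).1
  · obtain ⟨h4, -, h5⟩ := hsome ((h3 j q hq _).2 ⟨hΩ, rfl⟩)
    exact ⟨h4, h5⟩

/-- Local coordinates near the interior of a codimension-one face. -/
theorem exists_isFold_of_face (hn : n ≠ 0) (hA : A ⊆ stdSimplex ℝ (Fin (n + 1)))
    (F : ι × Fin (n + 1)) :
    ∃ Ω D, IsFold P A (fun j d => (j = F.1 ∧ d = AffineMap.id ℝ _) ∨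
        (j = (P.mate F).1 ∧ d = P.foldMap F)) Ω D ∧
      (∀ q ∈ A, q ∈ faceRegion F.2 → P.point A F.1 q ∈ Ω ∧ D (P.point A F.1 q) = tailCoord n q) ∧
      (∀ q ∈ A, q ∈ faceRegion (P.mate F).2 → P.point A (P.mate F).1 q ∈ Ω ∧
        D (P.point A (P.mate F).1 q) = tailCoord n (faceReflection F.2 (q ∘ P.perm F))) := by
  classical
  -- A face may be glued to another face of the same simplex. The two regions are then still
  -- disjoint, so the order of the cases in `ψ` is immaterial.
  have hdisj : ∀ {x}, x ∈ faceRegion (P.mate F).2 → ¬ ((P.mate F).1 = F.1 ∧ x ∈ faceRegion F.2) := by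
    rintro x hx ⟨h1, h2⟩
    exact notMem_faceRegion (fun h => P.mate_ne F (Prod.ext h1 h)) hx h2
  set ψ : ι → (Fin (n + 1) → ℝ) → Option (Fin n → ℝ) := fun j q =>
    if j = F.1 ∧ q ∈ faceRegion F.2 then some (tailCoord n q)
    else if j = (P.mate F).1 ∧ q ∈ faceRegion (P.mate F).2 then
      some (tailCoord n (faceReflection F.2 (q ∘ P.perm F))) else none with hψ
  have hψ1 : ∀ {q}, q ∈ faceRegion F.2 → ψ F.1 q = some (tailCoord n q) := by
    intro q hq
    simp [hψ, hq]
  have hψ2 : ∀ {q}, q ∈ faceRegion (P.mate F).2 → ψ (P.mate F).1 q =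
      some (tailCoord n (faceReflection F.2 (q ∘ P.perm F))) := by
    intro q hq
    simp only [hψ]
    rw [if_neg (hdisj hq), if_pos ⟨trivial, hq⟩]
  have hsome : ∀ {j q a}, ψ j q = some a → (j = F.1 ∧ q ∈ faceRegion F.2 ∧ a = tailCoord n q) ∨
      (j = (P.mate F).1 ∧ q ∈ faceRegion (P.mate F).2 ∧
        a = tailCoord n (faceReflection F.2 (q ∘ P.perm F))) := by
    intro j q a h
    simp only [hψ] at h
    split_ifs at h with h1 h2
    · exact Or.inl ⟨h1.1, h1.2, (Option.some.inj h).symm⟩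
    · exact Or.inr ⟨h2.1, h2.2, (Option.some.inj h).symm⟩
  have hface : ∀ {v u : Fin (n + 1)} {x}, x ∈ A → x ∈ faceRegion v → x u = 0 → u = v := by
    intro v u x hx hxR hu
    by_contra h
    exact absurd (hxR u h) (by rw [hu]; exact not_lt.2 ((hA hx).1 v))
  have hmregion : ∀ {G : ι × Fin (n + 1)} {x x'}, x ∈ faceRegion G.2 → P.Matched G x x' →
      x' ∈ faceRegion (P.mate G).2 := by
    intro G x x' hx hm u hu
    obtain ⟨w, rfl⟩ := (P.perm G).surjective u
    rw [← P.perm_self, hm.2, hm.2]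
    refine hx w ?_
    rintro rfl
    exact hu (P.perm_self G)
  have hsum : ∀ q ∈ A, ∑ u, faceReflection F.2 (q ∘ P.perm F) u = 1 := by
    intro q hq
    rw [sum_faceReflection hn]
    exact (Equiv.sum_comp (P.perm F) q).trans (hA hq).2
  -- The coordinate transverse to the face is nonnegative on one side and nonpositive on the
  -- reflected side. Equal images thus lie on the face itself, where the reflection is the identity.
  have hglue : ∀ q ∈ A, ∀ q' ∈ A, tailCoord n q = tailCoord n (faceReflection F.2 (q' ∘ P.perm F)) →
      P.point A F.1 q = P.point A (P.mate F).1 q' := by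
    intro q hq q' hq' h
    have h1 := tailCoord_injOn (hA hq).2 (hsum q' hq') h
    have h2 := congrFun h1 F.2
    rw [faceReflection_self] at h2
    have h3 := (hA hq).1 F.2
    have h4 := (hA hq').1 (P.perm F F.2)
    have h5 : q' (P.perm F F.2) = 0 := by
      rw [Function.comp_apply] at h2
      linarith
    rw [faceReflection_eq_self (v := F.2) (x := q' ∘ P.perm F) h5] at h1
    refine FacePairing.point_eq hq hq' ⟨?_, fun u => ?_⟩
    · rw [h1]
      exact h5
    · rw [h1]
      rfl
  obtain ⟨Ω, D, h2, h3⟩ := isFold_of_option (P := P) (A := A)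
    (Q := fun j d => (j = F.1 ∧ d = AffineMap.id ℝ _) ∨ (j = (P.mate F).1 ∧ d = P.foldMap F)) ψ
    (by
      rintro G x x' hx hx' hm hs
      obtain ⟨a, ha⟩ := Option.isSome_iff_exists.1 hs
      rcases hsome ha with ⟨hG, hxR, -⟩ | ⟨hG, hxR, -⟩
      · obtain rfl : G = F := Prod.ext hG (hface hx hxR hm.1)
        rw [hψ1 hxR, hψ2 (hmregion hxR hm)]
        have : x' ∘ P.perm G = x := funext hm.2
        rw [this, faceReflection_eq_self hm.1]
      · obtain rfl : G = P.mate F := Prod.ext hG (hface hx hxR hm.1)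
        have hR := hmregion hxR hm
        have hm' := hm.symm
        rw [P.mate_mate] at hR hm' ⊢
        rw [hψ2 hxR, hψ1 hR]
        have : x ∘ P.perm F = x' := funext hm'.2
        rw [this, faceReflection_eq_self hm'.1])
    {AffineMap.id ℝ _, P.foldMap F} (Set.toFinite _)
    (by
      intro j q hq hs
      obtain ⟨a, ha⟩ := Option.isSome_iff_exists.1 hs
      rcases hsome ha with ⟨rfl, hqR, -⟩ | ⟨rfl, hqR, -⟩
      · refine ⟨AffineMap.id ℝ _, Or.inl rfl, Or.inl ⟨rfl, rfl⟩, ?_⟩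
        filter_upwards [(isOpen_faceRegion F.2).mem_nhds hqR] with q' hq' _
        exact hψ1 hq'
      · refine ⟨P.foldMap F, Or.inr rfl, Or.inr ⟨rfl, rfl⟩, ?_⟩
        filter_upwards [(isOpen_faceRegion (P.mate F).2).mem_nhds hqR] with q' hq' hq'A
        rw [hψ2 hq', FacePairing.foldMap_tailCoord F (hA hq'A).2])
    (by
      intro j q hq j' q' hq' a h h'
      rcases hsome h with ⟨rfl, -, e1⟩ | ⟨rfl, -, e1⟩ <;>
        rcases hsome h' with ⟨rfl, -, e2⟩ | ⟨rfl, -, e2⟩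
      · rw [tailCoord_injOn (hA hq).2 (hA hq').2 (e1.symm.trans e2)]
      · exact hglue q hq q' hq' (e1.symm.trans e2)
      · exact (hglue q' hq' q hq (e2.symm.trans e1)).symm
      · have h7 := tailCoord_injOn (hsum q hq) (hsum q' hq') (e1.symm.trans e2)
        have h8 := congrArg (faceReflection F.2) h7
        rw [faceReflection_faceReflection, faceReflection_faceReflection] at h8
        have h9 : q = q' := by
          ext u
          obtain ⟨w, rfl⟩ := (P.perm F).surjective u
          exact congrFun h8 w
        rw [h9])
  exact ⟨Ω, D, h2, fun q hq hR => (h3 _ q hq _).1 (hψ1 hR),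
    fun q hq hR => (h3 _ q hq _).1 (hψ2 hR)⟩

theorem IsFold.mono {Q Q' : ι → ((Fin n → ℝ) →ᵃ[ℝ] (Fin n → ℝ)) → Prop} {Ω : Set (P.Glued A)}
    {D : P.Glued A → Fin n → ℝ} (h : IsFold P A Q Ω D) (hQ : ∀ j d, Q j d → Q' j d) :
    IsFold P A Q' Ω D := by
  obtain ⟨h1, h2, h3, 𝒟, h4, h5⟩ := h
  refine ⟨h1, h2, h3, 𝒟, h4, fun j q hq hΩ => ?_⟩
  obtain ⟨d, h6, h7, h8⟩ := h5 j q hq hΩ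
  exact ⟨d, h6, hQ j d h7, h8⟩

/-- The equation on `ε` is used here: it makes the identity branch and the branch beyond the face
equally oriented once each is multiplied by the sign of its simplex. With at most one zero
coordinate, no deeper face has to be unfolded. -/
theorem exists_isFold (hn : n ≠ 0) (hA : A ⊆ stdSimplex ℝ (Fin (n + 1))) {ε : ι → ℤˣ}
    (hε : ∀ F, ε (P.mate F).1 * Equiv.Perm.sign (P.perm F) = - ε F.1) (i : ι)
    {p : Fin (n + 1) → ℝ} (hp : p ∈ A) (hp0 : ∀ u u', p u = 0 → p u' = 0 → u = u') :
    ∃ Ω D, P.point A i p ∈ Ω ∧ IsFold P A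
      (fun j d => 0 < signR (ε i) * (signR (ε j) * LinearMap.det d.linear)) Ω D := by
  by_cases hpos : ∀ u, 0 < p u
  · obtain ⟨Ω, D, h1, h2, -⟩ := exists_isFold_of_pos (P := P) hA i
    refine ⟨Ω, D, h2 p hp hpos, h1.mono ?_⟩
    rintro j d ⟨rfl, rfl⟩
    rw [AffineMap.id_linear, LinearMap.det_id, mul_one, signR_mul_self]
    exact one_pos
  push Not at hpos
  obtain ⟨v, hv⟩ := hpos
  have hv0 : p v = 0 := le_antisymm hv ((hA hp).1 v)
  have hpR : p ∈ faceRegion v := fun u hu => by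
    rw [hv0]
    exact lt_of_le_of_ne ((hA hp).1 u) fun h => hu (hp0 u v h.symm hv0)
  obtain ⟨Ω, D, h1, h2, -⟩ := exists_isFold_of_face (P := P) hn hA (i, v)
  refine ⟨Ω, D, (h2 p hp hpR).1, h1.mono ?_⟩
  rintro j d (⟨rfl, rfl⟩ | ⟨rfl, rfl⟩)
  · rw [AffineMap.id_linear, LinearMap.det_id, mul_one, signR_mul_self]
    exact one_pos
  · have h6 : signR (ε (P.mate (i, v)).1) * signR (Equiv.Perm.sign (P.perm (i, v))) =
        - signR (ε i) := by
      rw [← signR_mul, hε, signR_neg]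
    rw [FacePairing.det_foldMap hn, mul_neg, h6, neg_neg, signR_mul_self]
    exact one_pos

end Fold

/-! ### Regular points of charts -/

theorem exists_affine_inverse {E : Type*} [NormedAddCommGroup E] [NormedSpace ℝ E]
    [FiniteDimensional ℝ E] {m : E →ᵃ[ℝ] E} (hm : LinearMap.det m.linear ≠ 0) :
    ∃ k : E →ᵃ[ℝ] E, (∀ x, k (m x) = x) ∧ (∀ x, m (k x) = x) ∧
      LinearMap.det k.linear * LinearMap.det m.linear = 1 := by
  have hb : Function.Bijective m := by
    rw [← m.linear_bijective_iff]
    exact (LinearMap.equivOfDetNeZero m.linear hm).bijective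
  let e := AffineEquiv.ofBijective hb
  refine ⟨e.symm.toAffineMap, fun x => e.symm_apply_apply x, fun x => e.apply_symm_apply x, ?_⟩
  rw [← LinearMap.det_comp]
  have : e.symm.toAffineMap.linear ∘ₗ m.linear = LinearMap.id := by
    ext x
    exact e.linear.symm_apply_apply x
  rw [this, LinearMap.det_id]

section Charts

variable {ι : Type*} {n : ℕ} {P : FacePairing ι n} {A : Set (Fin (n + 1) → ℝ)}

/-- The affine subspace of the points whose coordinate `u` vanishes. -/
def zeroFace (u : Fin (n + 1)) : AffineSubspace ℝ (Fin n → ℝ) :=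
  (AffineSubspace.mk' (0 : ℝ) ⊥).comap
    ((LinearMap.proj u : (Fin (n + 1) → ℝ) →ₗ[ℝ] ℝ).toAffineMap.comp (baryCoord n))

theorem mem_zeroFace {u : Fin (n + 1)} {y : Fin n → ℝ} :
    y ∈ zeroFace u ↔ baryCoord n y u = 0 := by
  simp [zeroFace, AffineSubspace.mem_comap, AffineSubspace.mem_mk']

theorem baryCoord_tailCoord_single (u : Fin (n + 1)) :
    baryCoord n (tailCoord n (Pi.single u 1)) = Pi.single u 1 :=
  baryCoord_tailCoord (by simp)

theorem zeroFace_lt_top (u : Fin (n + 1)) : zeroFace u < (⊤ : AffineSubspace ℝ (Fin n → ℝ)) := by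
  rw [lt_top_iff_ne_top]
  intro h
  have : tailCoord n (Pi.single u 1) ∈ zeroFace u := h ▸ AffineSubspace.mem_top ℝ _ _
  rw [mem_zeroFace, baryCoord_tailCoord_single] at this
  simp at this

theorem finrank_zeroFace_lt (u : Fin (n + 1)) (h : (zeroFace u : Set (Fin n → ℝ)).Nonempty) :
    finrank ℝ (zeroFace u).direction < finrank ℝ (Fin n → ℝ) := by
  have := AffineSubspace.direction_lt_of_nonempty (zeroFace_lt_top u) h
  rw [AffineSubspace.direction_top] at this
  exact Submodule.finrank_lt this.ne

/-- The vertex `u'` lies on the hyperplane of `u` but not on that of `u'`, so the intersection is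
strictly smaller than a proper subspace. -/
theorem finrank_zeroFace_inf_lt {u u' : Fin (n + 1)} (hu : u ≠ u')
    (h : (zeroFace u ⊓ zeroFace u' : AffineSubspace ℝ (Fin n → ℝ)).1.Nonempty) :
    finrank ℝ (zeroFace u ⊓ zeroFace u' : AffineSubspace ℝ (Fin n → ℝ)).direction + 2 ≤
      finrank ℝ (Fin n → ℝ) := by
  have hlt : (zeroFace u ⊓ zeroFace u' : AffineSubspace ℝ (Fin n → ℝ)) < zeroFace u := by
    refine lt_of_le_of_ne inf_le_left fun he => ?_
    have h1 : tailCoord n (Pi.single u' 1) ∈ zeroFace u := by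
      rw [mem_zeroFace, baryCoord_tailCoord_single]
      simp [hu]
    rw [← he] at h1
    have h2 := mem_zeroFace.1 h1.2
    rw [baryCoord_tailCoord_single] at h2
    simp at h2
  have h1 := Submodule.finrank_lt_finrank_of_lt (AffineSubspace.direction_lt_of_nonempty hlt h)
  have h2 := finrank_zeroFace_lt u (h.mono fun x hx => hx.1)
  omega

theorem finrank_map_direction_le (m : (Fin n → ℝ) →ᵃ[ℝ] (Fin n → ℝ))
    (W : AffineSubspace ℝ (Fin n → ℝ)) :
    finrank ℝ (W.map m).direction ≤ finrank ℝ W.direction := by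
  rw [AffineSubspace.map_direction]
  exact Submodule.finrank_map_le _ _

theorem map_zeroFace_ne_top (m : (Fin n → ℝ) →ᵃ[ℝ] (Fin n → ℝ)) (u : Fin (n + 1)) :
    (zeroFace u).map m ≠ ⊤ := by
  by_cases h : (zeroFace u : Set (Fin n → ℝ)).Nonempty
  · exact affineSubspace_ne_top_of_finrank_lt
      ((finrank_map_direction_le m _).trans_lt (finrank_zeroFace_lt u h))
  · intro ht
    have h0 : (0 : Fin n → ℝ) ∈ (zeroFace u).map m := ht ▸ AffineSubspace.mem_top ℝ _ _
    obtain ⟨x, hx, -⟩ := h0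
    exact h ⟨x, hx⟩

theorem map_top_ne_top {m : (Fin n → ℝ) →ᵃ[ℝ] (Fin n → ℝ)} (hm : LinearMap.det m.linear = 0) :
    (⊤ : AffineSubspace ℝ (Fin n → ℝ)).map m ≠ ⊤ := by
  intro ht
  have h := congrArg AffineSubspace.direction ht
  rw [AffineSubspace.map_direction, AffineSubspace.direction_top, Submodule.map_top] at h
  have := (LinearMap.range_lt_top_of_det_eq_zero hm).ne
  exact this h

theorem dense_baryCoord_ne_zero : Dense {y : Fin n → ℝ | ∀ u, baryCoord n y u ≠ 0} := by
  refine (dense_notMem_affineSubspaces (Set.finite_range (zeroFace (n := n))) ?_).mono ?_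
  · rintro _ ⟨u, rfl⟩
    exact (zeroFace_lt_top u).ne
  · intro y hy u hu
    exact hy _ ⟨u, rfl⟩ (mem_zeroFace.2 hu)

variable [Nonempty A]

theorem FacePairing.point_inj_of_pos (hA : A ⊆ stdSimplex ℝ (Fin (n + 1))) {i : ι}
    {x x' : Fin (n + 1) → ℝ} (hx : x ∈ A) (hx' : x' ∈ A) (hpos : ∀ u, 0 < x u)
    (h : P.point A i x = P.point A i x') : x = x' := by
  obtain ⟨Ω, D, -, h1, h2⟩ := exists_isFold_of_pos (P := P) hA i
  have hΩ := h1 x hx hpos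
  have e1 := (h2 i x hx hΩ).2
  have e2 := (h2 i x' hx' (h ▸ hΩ)).2
  rw [h] at e1
  exact tailCoord_injOn (hA hx).2 (hA hx').2 (e1.symm.trans e2)

/-- Near `z`, the chart `φ` is defined on the simplex `j` and affine, equal to `m`. -/
def PLChart.Regular (φ : PLChart P A) (j : ι) (z : Fin n → ℝ)
    (m : (Fin n → ℝ) →ᵃ[ℝ] (Fin n → ℝ)) : Prop :=
  ∀ᶠ z' in 𝓝 z, baryCoord n z' ∈ A ∧ P.point A j (baryCoord n z') ∈ φ.source ∧
    φ.toFun (P.point A j (baryCoord n z')) = m z'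

theorem PLChart.Regular.eventually {φ : PLChart P A} {j : ι} {z : Fin n → ℝ}
    {m : (Fin n → ℝ) →ᵃ[ℝ] (Fin n → ℝ)} (h : φ.Regular j z m) :
    ∀ᶠ z' in 𝓝 z, φ.Regular j z' m :=
  eventually_eventually_nhds.2 h

/-- Arbitrarily close to `z` there are points with all coordinates positive, near which the
projection to the glued space, the chart and hence `m` are injective. -/
theorem PLChart.Regular.det_ne_zero (hA : A ⊆ stdSimplex ℝ (Fin (n + 1))) {φ : PLChart P A} {j : ι}
    {z : Fin n → ℝ} {m : (Fin n → ℝ) →ᵃ[ℝ] (Fin n → ℝ)} (h : φ.Regular j z m) :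
    LinearMap.det m.linear ≠ 0 := by
  obtain ⟨U, hU, hUo, hzU⟩ := mem_nhds_iff.1 h
  obtain ⟨y, hyU, hy⟩ := dense_baryCoord_ne_zero.inter_open_nonempty U hUo ⟨z, hzU⟩
  have hpos : ∀ᶠ y' in 𝓝 y, ∀ u, 0 < baryCoord n y' u := eventually_all.2 fun u =>
    ((continuous_apply u).comp continuous_baryCoord).continuousAt.eventually_const_lt
      (lt_of_le_of_ne ((hA (hU hyU).1).1 u) (hy u).symm)
  refine det_linear_ne_zero_of_injOn (inter_mem (hUo.mem_nhds hyU) hpos) ?_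
  rintro a ⟨haU, ha⟩ b ⟨hbU, -⟩ hab
  have h1 := hU haU
  have h2 := hU hbU
  have h3 := φ.injOn h1.2.1 h2.2.1 (h1.2.2.trans (hab.trans h2.2.2.symm))
  have h4 := FacePairing.point_inj_of_pos hA h1.1 h2.1 ha h3
  rw [← tailCoord_baryCoord a, h4, tailCoord_baryCoord]

theorem PLChart.Regular.invFun {φ : PLChart P A} {j : ι} {z : Fin n → ℝ}
    {m k : (Fin n → ℝ) →ᵃ[ℝ] (Fin n → ℝ)} (h : φ.Regular j z m) (hk : ∀ x, k (m x) = x)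
    (hk' : ∀ x, m (k x) = x) :
    ∀ᶠ y in 𝓝 (m z), φ.Regular j (k y) m ∧ baryCoord n (k y) ∈ A ∧ y ∈ φ.target ∧
      φ.invFun y = P.point A j (baryCoord n (k y)) := by
  have hlim : Tendsto k (𝓝 (m z)) (𝓝 z) := by
    have := k.continuous_of_finiteDimensional.tendsto (m z)
    rwa [hk] at this
  filter_upwards [hlim.eventually h.eventually] with y hy
  obtain ⟨h1, h2, h3⟩ := hy.self_of_nhds
  rw [hk'] at h3
  refine ⟨hy, h1, h3 ▸ φ.map_source h2, ?_⟩
  have h4 : φ.invFun (φ.toFun (P.point A j (baryCoord n (k y)))) = _ := φ.left_inv h2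
  rwa [h3] at h4

/-- If the transition between two charts preserves orientation, the charts have the same orientation
at common regular points. -/
theorem OrientedTransition.det_mul_det_pos (hA : A ⊆ stdSimplex ℝ (Fin (n + 1)))
    {φ ψ : PLChart P A} (ho : OrientedTransition φ ψ) {j : ι} {z : Fin n → ℝ}
    {m m' : (Fin n → ℝ) →ᵃ[ℝ] (Fin n → ℝ)} (h : φ.Regular j z m) (h' : ψ.Regular j z m') :
    0 < LinearMap.det m.linear * LinearMap.det m'.linear := by
  have hm := h.det_ne_zero hA
  obtain ⟨k, hk, hk', hdet⟩ := exists_affine_inverse hm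
  have hlim : Tendsto k (𝓝 (m z)) (𝓝 z) := by
    have := k.continuous_of_finiteDimensional.tendsto (m z)
    rwa [hk] at this
  have hev : ∀ᶠ y in 𝓝 (m z), y ∈ φ.target ∩ φ.invFun ⁻¹' ψ.source ∧
      ψ.toFun (φ.invFun y) = (m'.comp k) y := by
    filter_upwards [h.invFun hk hk', hlim.eventually h'] with y h1 h2
    refine ⟨⟨h1.2.2.1, ?_⟩, ?_⟩
    · rw [mem_preimage, h1.2.2.2]
      exact h2.2.1
    · rw [h1.2.2.2, h2.2.2]
      rfl
  have hint : m z ∈ interior (φ.target ∩ φ.invFun ⁻¹' ψ.source) :=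
    mem_interior_iff_mem_nhds.2 (hev.mono fun y hy => hy.1)
  have hd : HasFDerivAt (fun y => ψ.toFun (φ.invFun y))
      (LinearMap.toContinuousLinearMap (m'.comp k).linear) (m z) := by
    have h1 : HasFDerivAt (m'.comp k) (LinearMap.toContinuousLinearMap (m'.comp k).linear)
        (m z) := by
      have h2 : (m'.comp k : (Fin n → ℝ) → Fin n → ℝ) = fun y =>
          LinearMap.toContinuousLinearMap (m'.comp k).linear y + (m'.comp k) 0 :=
        AffineMap.decomp (m'.comp k)
      rw [h2]
      exact (ContinuousLinearMap.hasFDerivAt _).add_const _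
    exact h1.congr_of_eventuallyEq (hev.mono fun y hy => hy.2)
  have hpos := ho (m z) hint hd.differentiableAt
  rw [hd.fderiv] at hpos
  have h3 : 0 < LinearMap.det m'.linear * LinearMap.det k.linear := by
    rw [← LinearMap.det_comp]
    exact hpos
  have h4 : LinearMap.det m.linear * LinearMap.det m'.linear =
      (LinearMap.det m'.linear * LinearMap.det k.linear) *
        (LinearMap.det m.linear * LinearMap.det m.linear) := by
    linear_combination (-LinearMap.det m.linear * LinearMap.det m'.linear) * hdet
  rw [h4]
  exact mul_pos h3 (mul_self_pos.2 hm)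

theorem PLChart.exists_affine_tail [Finite ι] (hA : A ⊆ stdSimplex ℝ (Fin (n + 1)))
    (hsymm : ∀ (σ : Equiv.Perm (Fin (n + 1))), ∀ x ∈ A, x ∘ σ ∈ A)
    (φ : PLChart P A) {z : P.Glued A} (hz : z ∈ φ.source) :
    ∃ N : Set (P.Glued A), IsOpen N ∧ z ∈ N ∧ N ⊆ φ.source ∧
      ∃ 𝓜 : Set ((Fin n → ℝ) →ᵃ[ℝ] (Fin n → ℝ)), 𝓜.Finite ∧
        ∀ j, ∀ q ∈ A, P.point A j q ∈ N → ∃ m ∈ 𝓜, φ.toFun (P.point A j q) = m (tailCoord n q) := by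
  obtain ⟨N, h1, h2, h3, 𝒢, h4, h5⟩ := φ.exists_affine hsymm hz
  refine ⟨N, h1, h2, h3, (fun g => g.comp (baryCoord n)) '' 𝒢, h4.image _, fun j q hq hN => ?_⟩
  obtain ⟨g, hg, h⟩ := h5 j q hq hN
  refine ⟨_, ⟨g, hg, rfl⟩, ?_⟩
  rw [h, AffineMap.comp_apply, baryCoord_tailCoord (hA hq).2]

end Charts

/-! ### Orientability from the condition on the face-pairings -/

section OfOri

variable {ι : Type*} {n : ℕ} {P : FacePairing ι n} {A : Set (Fin (n + 1) → ℝ)} [Nonempty A]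

theorem PLChart.invFun_mem_source (φ : PLChart P A) {y : Fin n → ℝ} (hy : y ∈ φ.target) :
    φ.invFun y ∈ φ.source := φ.map_target hy

theorem PLChart.toFun_invFun (φ : PLChart P A) {y : Fin n → ℝ} (hy : y ∈ φ.target) :
    φ.toFun (φ.invFun y) = y := φ.right_inv hy

theorem PLChart.injOn_invFun (φ : PLChart P A) : InjOn φ.invFun φ.target := fun y hy y' hy' h => by
  rw [← φ.toFun_invFun hy, h, φ.toFun_invFun hy']

theorem PLChart.isOpen_inter_preimage_invFun (φ : PLChart P A) {V : Set (Fin n → ℝ)} (hV : IsOpen V)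
    (hVt : V ⊆ φ.target) {N : Set (P.Glued A)} (hN : IsOpen N) : IsOpen (V ∩ φ.invFun ⁻¹' N) :=
  (φ.continuousOn_invFun.mono hVt).isOpen_inter_preimage hV hN

/-- Branches of the chart with nonzero determinant can be inverted. The degenerate ones have images
in proper affine subspaces; off these the claim is direct, and it extends by density and continuity.
-/
theorem PLChart.exists_affine_comp_invFun (φ : PLChart P A) {N : Set (P.Glued A)}
    {𝓜 : Set ((Fin n → ℝ) →ᵃ[ℝ] (Fin n → ℝ))} (h𝓜 : 𝓜.Finite)
    (hN : ∀ j, ∀ q ∈ A, P.point A j q ∈ N → ∃ m ∈ 𝓜, φ.toFun (P.point A j q) = m (tailCoord n q))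
    {V : Set (Fin n → ℝ)} (hV : IsOpen V) (hVt : V ⊆ φ.target) (hVN : ∀ y ∈ V, φ.invFun y ∈ N)
    {f : (Fin n → ℝ) → Fin n → ℝ} (hf : ContinuousOn f V)
    {𝒟 : Set ((Fin n → ℝ) →ᵃ[ℝ] (Fin n → ℝ))} (h𝒟 : 𝒟.Finite)
    (hfd : ∀ y ∈ V, ∀ j, ∀ q ∈ A, φ.invFun y = P.point A j q → ∃ d ∈ 𝒟, f y = d (tailCoord n q)) :
    ∃ 𝒢 : Set ((Fin n → ℝ) →ᵃ[ℝ] (Fin n → ℝ)), 𝒢.Finite ∧ ∀ y ∈ V, ∃ g ∈ 𝒢, f y = g y := by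
  have hinv : ∀ m : (Fin n → ℝ) →ᵃ[ℝ] (Fin n → ℝ), ∃ k : (Fin n → ℝ) →ᵃ[ℝ] (Fin n → ℝ),
      LinearMap.det m.linear ≠ 0 → ∀ x, k (m x) = x := by
    intro m
    by_cases hm : LinearMap.det m.linear = 0
    · exact ⟨m, fun h => absurd hm h⟩
    · obtain ⟨k, hk, -⟩ := exists_affine_inverse hm
      exact ⟨k, fun _ => hk⟩
  choose K hK using hinv
  refine ⟨image2 (fun d m => d.comp (K m)) 𝒟 𝓜, h𝒟.image2 _ h𝓜, ?_⟩
  have hdense := dense_notMem_affineSubspaces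
    (𝒲 := (fun m => (⊤ : AffineSubspace ℝ (Fin n → ℝ)).map m) '' {m ∈ 𝓜 | LinearMap.det m.linear = 0})
    ((h𝓜.subset (sep_subset _ _)).image _) (by
      rintro _ ⟨m, ⟨-, hm⟩, rfl⟩
      exact map_top_ne_top hm)
  refine forall_exists_eq_of_dense hV (fun U hU _ hne => hdense.inter_open_nonempty U hU hne) hf
    (h𝒟.image2 _ h𝓜) ?_
  intro y hy hyW
  obtain ⟨j, q, hq, hyq⟩ := FacePairing.exists_point (φ.invFun y)
  obtain ⟨m, hm, hmq⟩ := hN j q hq (hyq ▸ hVN y hy)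
  rw [← hyq, φ.toFun_invFun (hVt hy)] at hmq
  have hdet : LinearMap.det m.linear ≠ 0 := fun h0 =>
    hyW _ ⟨m, ⟨hm, h0⟩, rfl⟩ ⟨tailCoord n q, AffineSubspace.mem_top ℝ _ _, hmq.symm⟩
  obtain ⟨d, hd, hfy⟩ := hfd y hy j q hq hyq
  refine ⟨_, ⟨d, hd, m, hm, rfl⟩, ?_⟩
  rw [hfy, hmq, AffineMap.comp_apply, hK m hdet]

theorem IsFold.comp_invFun {Q : ι → ((Fin n → ℝ) →ᵃ[ℝ] (Fin n → ℝ)) → Prop} {Ω : Set (P.Glued A)}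
    {D : P.Glued A → Fin n → ℝ} (h : IsFold P A Q Ω D) (φ : PLChart P A) {N : Set (P.Glued A)}
    {𝓜 : Set ((Fin n → ℝ) →ᵃ[ℝ] (Fin n → ℝ))} (h𝓜 : 𝓜.Finite)
    (hN : ∀ j, ∀ q ∈ A, P.point A j q ∈ N → ∃ m ∈ 𝓜, φ.toFun (P.point A j q) = m (tailCoord n q))
    {V : Set (Fin n → ℝ)} (hV : IsOpen V) (hVt : V ⊆ φ.target) (hVN : ∀ y ∈ V, φ.invFun y ∈ N)
    (hVΩ : ∀ y ∈ V, φ.invFun y ∈ Ω) :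
    ContinuousOn (fun y => D (φ.invFun y)) V ∧ InjOn (fun y => D (φ.invFun y)) V ∧
    ∃ 𝒢 : Set ((Fin n → ℝ) →ᵃ[ℝ] (Fin n → ℝ)), 𝒢.Finite ∧
      ∀ y ∈ V, ∃ g ∈ 𝒢, D (φ.invFun y) = g y := by
  have hc : ContinuousOn (fun y => D (φ.invFun y)) V :=
    h.continuousOn.comp (φ.continuousOn_invFun.mono hVt) hVΩ
  refine ⟨hc, fun y hy y' hy' he => ?_, ?_⟩
  · exact φ.injOn_invFun (hVt hy) (hVt hy') (h.injOn (hVΩ y hy) (hVΩ y' hy') he)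
  · obtain ⟨𝒟, h𝒟, hd⟩ := h.exists_affine
    refine φ.exists_affine_comp_invFun h𝓜 hN hV hVt hVN hc h𝒟 ?_
    intro y hy j q hq hyq
    obtain ⟨d, hd𝒟, -, hd'⟩ := hd j q hq (hyq ▸ hVΩ y hy)
    exact ⟨d, hd𝒟, by rw [hyq]; exact hd'.self_of_nhds hq⟩

/-- Off the images of the faces, a chart value comes from the interior of a simplex. There `D ∘ φ⁻¹`
is injective and piecewise affine, so it is affine and invertible near some value, and its inverse
is the chart. This takes the place of invariance of domain. -/
theorem PLChart.exists_regular [Finite ι] (hA : A ⊆ stdSimplex ℝ (Fin (n + 1)))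
    (hsymm : ∀ (σ : Equiv.Perm (Fin (n + 1))), ∀ x ∈ A, x ∘ σ ∈ A)
    (φ : PLChart P A) {V : Set (Fin n → ℝ)} (hV : IsOpen V) (hVt : V ⊆ φ.target)
    (hne : V.Nonempty) :
    ∃ j z m, φ.Regular j z m ∧ m z ∈ V := by
  obtain ⟨y₀, hy₀⟩ := hne
  obtain ⟨N, hNo, hy₀N, -, 𝓜, h𝓜, hN⟩ :=
    φ.exists_affine_tail hA hsymm (φ.invFun_mem_source (hVt hy₀))
  have hV₁ := φ.isOpen_inter_preimage_invFun hV hVt hNo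
  obtain ⟨y₁, ⟨hy₁V, hy₁N⟩, hy₁⟩ := (dense_notMem_affineSubspaces
    (𝒲 := image2 (fun m u => (zeroFace u).map m) 𝓜 univ)
    (h𝓜.image2 _ finite_univ) (by
      rintro _ ⟨m, -, u, -, rfl⟩
      exact map_zeroFace_ne_top m u)).inter_open_nonempty _ hV₁ ⟨y₀, hy₀, hy₀N⟩
  obtain ⟨j, q, hq, hyq⟩ := FacePairing.exists_point (φ.invFun y₁)
  obtain ⟨m, hm, hmq⟩ := hN j q hq (hyq ▸ hy₁N)
  rw [← hyq, φ.toFun_invFun (hVt hy₁V)] at hmq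
  have hpos : ∀ u, 0 < q u := by
    intro u
    refine lt_of_le_of_ne ((hA hq).1 u) fun h0 => ?_
    refine hy₁ _ ⟨m, hm, u, mem_univ _, rfl⟩ ⟨tailCoord n q, ?_, hmq.symm⟩
    change tailCoord n q ∈ zeroFace u
    rw [mem_zeroFace, baryCoord_tailCoord (hA hq).2, h0]
  obtain ⟨Ω, D, hf, hΩ, hD⟩ := exists_isFold_of_pos (P := P) hA j
  have hV₂ := φ.isOpen_inter_preimage_invFun hV hVt (hNo.inter hf.isOpen)
  obtain ⟨hc, hi, 𝒢, h𝒢, hg⟩ := hf.comp_invFun φ h𝓜 hN hV₂ (fun y hy => hVt hy.1)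
    (fun y hy => hy.2.1) (fun y hy => hy.2.2)
  obtain ⟨y, hy, k, -, hk⟩ := exists_eventuallyEq hV₂
    ⟨y₁, hy₁V, hy₁N, show φ.invFun y₁ ∈ Ω from hyq ▸ hΩ q hq hpos⟩ hc h𝒢 hg
  have hdet := det_linear_ne_zero_of_eventuallyEq hi (hV₂.mem_nhds hy) hk
  obtain ⟨m', hm'k, hkm', -⟩ := exists_affine_inverse hdet
  have hlim : Tendsto m' (𝓝 (k y)) (𝓝 y) := by
    have := m'.continuous_of_finiteDimensional.tendsto (k y)
    rwa [hm'k] at this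
  refine ⟨j, k y, m', ?_, by rw [hm'k]; exact hy.1⟩
  filter_upwards [hlim.eventually (hk.and (hV₂.mem_nhds hy))] with z hz
  obtain ⟨j', q', hq', hyq'⟩ := FacePairing.exists_point (φ.invFun (m' z))
  have h1 : D (φ.invFun (m' z)) = k (m' z) := hz.1
  obtain ⟨rfl, h2⟩ := hD j' q' hq' (hyq' ▸ hz.2.2.2)
  rw [hyq', h2, hkm'] at h1
  have h3 : baryCoord n z = q' := by rw [← h1, baryCoord_tailCoord (hA hq').2]
  rw [h3, ← hyq']
  exact ⟨hq', φ.invFun_mem_source (hVt hz.2.1), φ.toFun_invFun (hVt hz.2.1)⟩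

/-- The values of the chart `φ` at regular points where its orientation, compared with the
orientations `ε` of the simplices, is that of `s`. -/
def PLChart.signSet (φ : PLChart P A) (ε : ι → ℤˣ) (s : ℝ) : Set (Fin n → ℝ) :=
  {y | ∃ j z m, φ.Regular j z m ∧ m z = y ∧ 0 < s * (signR (ε j) * LinearMap.det m.linear)}

theorem PLChart.mem_nhds_of_mem_signSet (hA : A ⊆ stdSimplex ℝ (Fin (n + 1))) (φ : PLChart P A)
    {ε : ι → ℤˣ} {s : ℝ} {y : Fin n → ℝ} (hy : y ∈ φ.signSet ε s) :
    φ.signSet ε s ∩ φ.target ∈ 𝓝 y := by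
  obtain ⟨j, z, m, h, rfl, hs⟩ := hy
  obtain ⟨k, hk, hk', -⟩ := exists_affine_inverse (h.det_ne_zero hA)
  filter_upwards [h.invFun hk hk'] with y h1
  exact ⟨⟨j, k y, m, h1.1, hk' y, hs⟩, h1.2.2.1⟩

theorem PLChart.isOpen_signSet (hA : A ⊆ stdSimplex ℝ (Fin (n + 1))) (φ : PLChart P A)
    (ε : ι → ℤˣ) (s : ℝ) : IsOpen (φ.signSet ε s) :=
  isOpen_iff_mem_nhds.2 fun _ hy =>
    mem_of_superset (φ.mem_nhds_of_mem_signSet hA hy) inter_subset_left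

theorem PLChart.signSet_subset (hA : A ⊆ stdSimplex ℝ (Fin (n + 1))) (φ : PLChart P A)
    (ε : ι → ℤˣ) (s : ℝ) : φ.signSet ε s ⊆ interior φ.target := fun _ hy =>
  mem_interior_iff_mem_nhds.2 (mem_of_superset (φ.mem_nhds_of_mem_signSet hA hy) inter_subset_right)

theorem PLChart.subset_closure_signSet [Finite ι] (hA : A ⊆ stdSimplex ℝ (Fin (n + 1)))
    (hsymm : ∀ (σ : Equiv.Perm (Fin (n + 1))), ∀ x ∈ A, x ∘ σ ∈ A) (φ : PLChart P A)
    (ε : ι → ℤˣ) : interior φ.target ⊆ closure (φ.signSet ε 1 ∪ φ.signSet ε (-1)) := by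
  intro y hy
  rw [mem_closure_iff]
  intro U hU hyU
  obtain ⟨j, z, m, h, hz⟩ := φ.exists_regular hA hsymm (hU.inter isOpen_interior)
    (inter_subset_right.trans interior_subset) ⟨y, hyU, hy⟩
  refine ⟨m z, hz.1, ?_⟩
  rcases (mul_ne_zero (signR_ne_zero (ε j)) (h.det_ne_zero hA)).lt_or_gt with h1 | h1
  · exact Or.inr ⟨j, z, m, h, rfl, by linarith⟩
  · exact Or.inl ⟨j, z, m, h, rfl, by linarith⟩

/-- The sign of the simplex `j` occurs both in the fold and in the chart, and cancels. The
orientation of the fold read in the chart therefore depends on `s` and `σ` only. -/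
theorem exists_eventuallyEq_of_mem_signSet (hA : A ⊆ stdSimplex ℝ (Fin (n + 1))) {ε : ι → ℤˣ}
    {s σ : ℝ} {Ω : Set (P.Glued A)} {D : P.Glued A → Fin n → ℝ}
    (hf : IsFold P A (fun j d => 0 < s * (signR (ε j) * LinearMap.det d.linear)) Ω D)
    (φ : PLChart P A) {y : Fin n → ℝ} (hy : y ∈ φ.signSet ε σ) (hyΩ : φ.invFun y ∈ Ω) :
    ∃ g : (Fin n → ℝ) →ᵃ[ℝ] (Fin n → ℝ), (fun y => D (φ.invFun y)) =ᶠ[𝓝 y] g ∧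
      0 < σ * (s * LinearMap.det g.linear) := by
  obtain ⟨j, z, m, h, rfl, hs⟩ := hy
  obtain ⟨k, hk, hk', hdet⟩ := exists_affine_inverse (h.det_ne_zero hA)
  have hinv := h.invFun hk hk'
  obtain ⟨-, hzA, -, hz⟩ := hinv.self_of_nhds
  rw [hk] at hz hzA
  obtain ⟨𝒟, -, hd⟩ := hf.exists_affine
  obtain ⟨d, -, hds, hdev⟩ := hd j _ hzA (hz ▸ hyΩ)
  have hlim : Tendsto (fun y => baryCoord n (k y)) (𝓝 (m z)) (𝓝 (baryCoord n z)) := by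
    have := (continuous_baryCoord.comp k.continuous_of_finiteDimensional).tendsto (m z)
    rwa [Function.comp_apply, hk] at this
  refine ⟨d.comp k, ?_, ?_⟩
  · filter_upwards [hinv, hlim.eventually hdev] with y h1 h2
    rw [h1.2.2.2, h2 h1.2.1, tailCoord_baryCoord]
    rfl
  · have h1 : LinearMap.det (d.comp k).linear = LinearMap.det d.linear * LinearMap.det k.linear :=
      LinearMap.det_comp _ _
    have h2 := mul_pos hds hs
    have h3 := signR_mul_self (ε j)
    have h4 : σ * (s * LinearMap.det (d.comp k).linear) = (s * (signR (ε j) * LinearMap.det d.linear)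
        * (σ * (signR (ε j) * LinearMap.det m.linear))) *
        (LinearMap.det k.linear * LinearMap.det k.linear) := by
      rw [h1]
      linear_combination (-(σ * s * LinearMap.det d.linear * LinearMap.det k.linear)) * hdet -
        (σ * s * LinearMap.det d.linear * LinearMap.det m.linear *
          (LinearMap.det k.linear * LinearMap.det k.linear)) * h3
    rw [h4]
    refine mul_pos h2 (mul_self_pos.2 fun h0 => ?_)
    rw [h0, zero_mul] at hdet
    exact zero_ne_one hdet

/-- Otherwise `D ∘ φ⁻¹`, injective and piecewise affine on a small ball, would have branches of
opposite orientations, against `det_mul_det_pos`. -/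
theorem PLChart.notMem_closure_signSet [Finite ι] (hn : n ≠ 0)
    (hA : A ⊆ stdSimplex ℝ (Fin (n + 1)))
    (hsymm : ∀ (σ : Equiv.Perm (Fin (n + 1))), ∀ x ∈ A, x ∘ σ ∈ A) {ε : ι → ℤˣ}
    (hε : ∀ F, ε (P.mate F).1 * Equiv.Perm.sign (P.perm F) = - ε F.1) (φ : PLChart P A)
    {y : Fin n → ℝ} (hy : y ∈ interior φ.target) {i : ι} {p : Fin (n + 1) → ℝ} (hp : p ∈ A)
    (hyp : φ.invFun y = P.point A i p) (hp0 : ∀ u u', p u = 0 → p u' = 0 → u = u') :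
    y ∉ closure (φ.signSet ε 1) ∨ y ∉ closure (φ.signSet ε (-1)) := by
  by_contra! hcon
  obtain ⟨Ω, D, hΩ, hf⟩ := exists_isFold hn hA hε i hp hp0
  obtain ⟨N, hNo, hyN, -, 𝓜, h𝓜, hN⟩ :=
    φ.exists_affine_tail hA hsymm (φ.invFun_mem_source (interior_subset hy))
  have hV := φ.isOpen_inter_preimage_invFun isOpen_interior interior_subset (hNo.inter hf.isOpen)
  obtain ⟨r, hr, hball⟩ := Metric.isOpen_iff.1 hV y ⟨hy, hyN, show φ.invFun y ∈ Ω from hyp ▸ hΩ⟩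
  obtain ⟨hc, hi, 𝒢, h𝒢, hg⟩ := hf.comp_invFun φ h𝓜 hN (V := Metric.ball y r) Metric.isOpen_ball
    (fun x hx => interior_subset (hball hx).1) (fun x hx => (hball hx).2.1)
    (fun x hx => (hball hx).2.2)
  obtain ⟨x₁, hx₁, hs₁⟩ := mem_closure_iff.1 hcon.1 _ Metric.isOpen_ball (Metric.mem_ball_self hr)
  obtain ⟨x₂, hx₂, hs₂⟩ := mem_closure_iff.1 hcon.2 _ Metric.isOpen_ball (Metric.mem_ball_self hr)
  obtain ⟨g₁, hg₁, hp₁⟩ := exists_eventuallyEq_of_mem_signSet hA hf φ hs₁ (hball hx₁).2.2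
  obtain ⟨g₂, hg₂, hp₂⟩ := exists_eventuallyEq_of_mem_signSet hA hf φ hs₂ (hball hx₂).2.2
  have hpos := det_mul_det_pos (convex_ball y r) Metric.isOpen_ball hc hi h𝒢 hg hx₁ hx₂ hg₁ hg₂
  have hs := signR_mul_self (ε i)
  have h1 := mul_pos hp₁ hp₂
  have h2 : 1 * (signR (ε i) * LinearMap.det g₁.linear) *
      (-1 * (signR (ε i) * LinearMap.det g₂.linear)) =
      - (LinearMap.det g₁.linear * LinearMap.det g₂.linear) := by
    linear_combination (-(LinearMap.det g₁.linear * LinearMap.det g₂.linear)) * hs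
  rw [h2] at h1
  linarith

/-! ### Restriction and linear change of charts -/

theorem IsPLOn.mono {E F : Type*} [AddCommGroup E] [Module ℝ E] [TopologicalSpace E]
    [AddCommGroup F] [Module ℝ F] {B : Set E} {f : B → F} {U U' : Set B} (h : IsPLOn f U)
    (hU : U' ⊆ U) : IsPLOn f U' := by
  intro a ha
  obtain ⟨K, h1, h2, h3⟩ := h a (hU ha)
  refine ⟨K, h1, fun C hC => ⟨(h2 C hC).1, ?_⟩, h3⟩
  obtain ⟨g, hg⟩ := (h2 C hC).2
  exact ⟨g, fun x hx hxC => hg x (hU hx) hxC⟩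

/-- The restriction of a chart to the preimage of an open set. -/
def PLChart.restrict (φ : PLChart P A) (W : Set (Fin n → ℝ)) (hW : IsOpen W) : PLChart P A where
  toFun := φ.toFun
  invFun := φ.invFun
  source := φ.source ∩ φ.toFun ⁻¹' W
  target := φ.target ∩ W
  map_source' x hx := ⟨φ.map_source hx.1, hx.2⟩
  map_target' y hy := ⟨φ.map_target hy.1, by rw [mem_preimage, φ.toFun_invFun hy.1]; exact hy.2⟩
  left_inv' x hx := φ.left_inv hx.1
  right_inv' y hy := φ.right_inv hy.1
  open_source := φ.continuousOn_toFun.isOpen_inter_preimage φ.open_source hW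
  continuousOn_toFun := φ.continuousOn_toFun.mono inter_subset_left
  continuousOn_invFun := φ.continuousOn_invFun.mono inter_subset_left
  exists_halfSpace := by
    obtain ⟨ℓ, O, hO, h⟩ := φ.exists_halfSpace
    exact ⟨ℓ, O ∩ W, hO.inter hW, by rw [h, inter_right_comm]⟩
  isPLOn i := (φ.isPLOn i).mono fun _ hx => hx.1

/-- The composition of a chart with a linear automorphism of `ℝⁿ`. -/
def PLChart.transLinear (φ : PLChart P A) (L : (Fin n → ℝ) ≃ₗ[ℝ] (Fin n → ℝ)) : PLChart P A where
  toFun x := L (φ.toFun x)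
  invFun y := φ.invFun (L.symm y)
  source := φ.source
  target := L.symm ⁻¹' φ.target
  map_source' x hx := by
    rw [mem_preimage, L.symm_apply_apply]
    exact φ.map_source hx
  map_target' y hy := φ.map_target hy
  left_inv' x hx := by
    rw [L.symm_apply_apply]
    exact φ.left_inv hx
  right_inv' y hy := by
    rw [φ.toFun_invFun hy, L.apply_symm_apply]
  open_source := φ.open_source
  continuousOn_toFun :=
    (L.toLinearMap.continuous_of_finiteDimensional).comp_continuousOn φ.continuousOn_toFun
  continuousOn_invFun := φ.continuousOn_invFun.comp
    (L.symm.toLinearMap.continuous_of_finiteDimensional).continuousOn fun _ hy => hy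
  exists_halfSpace := by
    obtain ⟨ℓ, O, hO, h⟩ := φ.exists_halfSpace
    refine ⟨ℓ ∘ₗ L.symm.toLinearMap, L.symm ⁻¹' O,
      hO.preimage L.symm.toLinearMap.continuous_of_finiteDimensional, ?_⟩
    rw [h]
    rfl
  isPLOn i := by
    intro a ha
    obtain ⟨K, h1, h2, h3⟩ := φ.isPLOn i a ha
    refine ⟨K, h1, fun C hC => ⟨(h2 C hC).1, ?_⟩, h3⟩
    obtain ⟨g, hg⟩ := (h2 C hC).2
    exact ⟨L.toLinearMap.toAffineMap.comp g, fun x hx hxC => congrArg L (hg x hx hxC)⟩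

theorem PLChart.signSet_transLinear (φ : PLChart P A) {L : (Fin n → ℝ) ≃ₗ[ℝ] (Fin n → ℝ)}
    (hL : LinearMap.det L.toLinearMap < 0) {ε : ι → ℤˣ} (h : φ.signSet ε 1 = ∅) :
    (φ.transLinear L).signSet ε (-1) = ∅ := by
  rw [eq_empty_iff_forall_notMem] at h ⊢
  rintro _ ⟨j, z, m, hr, rfl, hs⟩
  refine h _ ⟨j, z, L.symm.toLinearMap.toAffineMap.comp m, ?_, rfl, ?_⟩
  · filter_upwards [hr] with z' hz'
    refine ⟨hz'.1, hz'.2.1, ?_⟩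
    have h3 : L (φ.toFun (P.point A j (baryCoord n z'))) = m z' := hz'.2.2
    rw [AffineMap.comp_apply, ← h3]
    exact (L.symm_apply_apply _).symm
  · have h1 : LinearMap.det (L.symm.toLinearMap.toAffineMap.comp m).linear =
        LinearMap.det L.symm.toLinearMap * LinearMap.det m.linear := LinearMap.det_comp _ _
    have h2 : LinearMap.det L.toLinearMap * LinearMap.det L.symm.toLinearMap = 1 := by
      rw [← LinearMap.det_comp, LinearEquiv.comp_symm, LinearMap.det_id]
    rw [h1]
    have h3 : LinearMap.det L.symm.toLinearMap < 0 := by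
      by_contra h0
      nlinarith
    nlinarith

theorem exists_linearEquiv_det_neg (hn : n ≠ 0) :
    ∃ L : (Fin n → ℝ) ≃ₗ[ℝ] (Fin n → ℝ), LinearMap.det L.toLinearMap < 0 := by
  let k : Fin n := ⟨0, Nat.pos_of_ne_zero hn⟩
  have h : LinearMap.det (LinearMap.transvection (LinearMap.proj k : (Fin n → ℝ) →ₗ[ℝ] ℝ)
      (Pi.single k (-2))) = -1 := by
    rw [LinearMap.transvection.det]
    simp
    norm_num
  refine ⟨LinearMap.equivOfDetNeZero _ (by rw [h]; norm_num), ?_⟩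
  have h2 : (LinearMap.equivOfDetNeZero _ (by rw [h]; norm_num) :
    (Fin n → ℝ) ≃ₗ[ℝ] (Fin n → ℝ)).toLinearMap = LinearMap.transvection
      (LinearMap.proj k : (Fin n → ℝ) →ₗ[ℝ] ℝ) (Pi.single k (-2)) := rfl
  rw [h2, h]
  norm_num

end OfOri

/-! ### Charts and transitions compatible with the orientations of the simplices -/

section OfOri

variable {ι : Type*} {n : ℕ} {P : FacePairing ι n} {A : Set (Fin (n + 1) → ℝ)} [Nonempty A]

/-- Restricting to a ball makes the interior of the target convex, also at a boundary point, since a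
ball meets a half-space in a convex set. One of the two signs is then absent by `sign_propagation`,
and a reflection decides which. -/
theorem exists_chart_signSet_eq_empty [Finite ι] (hn : n ≠ 0)
    (hA : A ⊆ stdSimplex ℝ (Fin (n + 1)))
    (hsymm : ∀ (σ : Equiv.Perm (Fin (n + 1))), ∀ x ∈ A, x ∘ σ ∈ A) {ε : ι → ℤˣ}
    (hε : ∀ F, ε (P.mate F).1 * Equiv.Perm.sign (P.perm F) = - ε F.1) (φ₀ : PLChart P A)
    {z : P.Glued A} (hz : z ∈ φ₀.source) :
    ∃ φ : PLChart P A, z ∈ φ.source ∧ φ.signSet ε (-1) = ∅ := by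
  obtain ⟨N, hNo, hzN, -, 𝓜, h𝓜, hN⟩ := φ₀.exists_affine_tail hA hsymm hz
  obtain ⟨ℓ, O, hO, htarget⟩ := φ₀.exists_halfSpace
  have hy₀ : φ₀.toFun z ∈ φ₀.target := φ₀.map_source hz
  have hyO : φ₀.toFun z ∈ O := (htarget ▸ hy₀).1
  have hzinv : φ₀.invFun (φ₀.toFun z) = z := φ₀.left_inv hz
  have hev : ∀ᶠ y in 𝓝 (φ₀.toFun z), y ∈ O ∧ (y ∈ φ₀.target → φ₀.invFun y ∈ N) := by
    refine Eventually.and (hO.mem_nhds hyO) ?_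
    have := φ₀.continuousOn_invFun _ hy₀ (hNo.mem_nhds (hzinv.symm ▸ hzN))
    rw [mem_map] at this
    exact eventually_nhdsWithin_iff.1 this
  obtain ⟨r, hr, hball⟩ := Metric.eventually_nhds_iff_ball.1 hev
  set φ := φ₀.restrict (Metric.ball (φ₀.toFun z) r) Metric.isOpen_ball with hφ
  have hφz : z ∈ φ.source := ⟨hz, Metric.mem_ball_self hr⟩
  have hφt : φ.target = Metric.ball (φ₀.toFun z) r ∩ {y | 0 ≤ ℓ y} := by
    change φ₀.target ∩ Metric.ball (φ₀.toFun z) r = _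
    rw [htarget]
    ext y
    exact ⟨fun h => ⟨h.2, h.1.2⟩, fun h => ⟨⟨(hball y h.1).1, h.2⟩, h.1⟩⟩
  have hconv : Convex ℝ (interior φ.target) := by
    rw [hφt]
    exact ((convex_ball _ _).inter (convex_halfSpace_ge ℓ.isLinear 0)).interior
  -- A value of the chart off these subspaces is attained only at points with at most one zero
  -- coordinate, where a fold is available.
  set 𝒮 : Set (AffineSubspace ℝ (Fin n → ℝ)) := {W | (∃ m ∈ 𝓜, ∃ u u', W = (zeroFace u ⊓ zeroFace u').map m) ∧
    finrank ℝ W.direction + 2 ≤ finrank ℝ (Fin n → ℝ)} with h𝒮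
  have h𝒮f : 𝒮.Finite := by
    refine ((h𝓜.prod (finite_univ (α := Fin (n + 1) × Fin (n + 1)))).image
      fun c => (zeroFace c.2.1 ⊓ zeroFace c.2.2).map c.1).subset ?_
    rintro _ ⟨⟨m, hm, u, u', rfl⟩, -⟩
    exact ⟨(m, u, u'), ⟨hm, mem_univ _⟩, rfl⟩
  have hprop := sign_propagation hconv isOpen_interior h𝒮f (fun W hW => hW.2)
    (φ.isOpen_signSet hA ε 1) (φ.isOpen_signSet hA ε (-1)) (φ.subset_closure_signSet hA hsymm ε) (by
      intro y hy hyS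
      obtain ⟨j, q, hq, hyq⟩ := FacePairing.exists_point (φ.invFun y)
      refine φ.notMem_closure_signSet hn hA hsymm hε hy hq hyq ?_
      have hyt : y ∈ φ₀.target ∩ Metric.ball (φ₀.toFun z) r := interior_subset hy
      have hyq' : φ₀.invFun y = P.point A j q := hyq
      obtain ⟨m, hm, hmq⟩ := hN j q hq (hyq' ▸ (hball y hyt.2).2 hyt.1)
      rw [← hyq', φ₀.toFun_invFun hyt.1] at hmq
      intro u u' hu hu'
      by_contra hne
      have hmem : tailCoord n q ∈ zeroFace u ⊓ zeroFace u' :=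
        ⟨mem_zeroFace.2 (by rw [baryCoord_tailCoord (hA hq).2, hu]),
          mem_zeroFace.2 (by rw [baryCoord_tailCoord (hA hq).2, hu'])⟩
      refine hyS ((zeroFace u ⊓ zeroFace u').map m) ⟨⟨m, hm, u, u', rfl⟩, ?_⟩
        ⟨tailCoord n q, hmem, hmq.symm⟩
      have h1 := finrank_zeroFace_inf_lt hne ⟨_, hmem⟩
      have h2 := finrank_map_direction_le m (zeroFace u ⊓ zeroFace u')
      omega)
  rw [inter_eq_right.2 (φ.signSet_subset hA ε 1), inter_eq_right.2 (φ.signSet_subset hA ε (-1))]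
    at hprop
  rcases hprop with h | h
  · obtain ⟨L, hL⟩ := exists_linearEquiv_det_neg hn
    exact ⟨φ.transLinear L, hφz, φ.signSet_transLinear hL h⟩
  · exact ⟨φ, hφz, h⟩

/-- A derivative of the transition is the linear part `m₀` of a branch on some open set. At a
regular point `z` of `φ` with value in that set, `ψ` is also regular, with map `m₀ ∘ m`; both charts
have the sign of the simplex there, so `det m₀ > 0`. -/
theorem orientedTransition_of_signSet_eq_empty [Finite ι]
    (hA : A ⊆ stdSimplex ℝ (Fin (n + 1)))
    (hsymm : ∀ (σ : Equiv.Perm (Fin (n + 1))), ∀ x ∈ A, x ∘ σ ∈ A) {ε : ι → ℤˣ}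
    {φ ψ : PLChart P A} (hφ : φ.signSet ε (-1) = ∅) (hψ : ψ.signSet ε (-1) = ∅) :
    OrientedTransition φ ψ := by
  intro y hy hd
  have hyt := interior_subset hy
  obtain ⟨N, hNo, hyN, -, 𝓜, h𝓜, hN⟩ :=
    φ.exists_affine_tail hA hsymm (φ.invFun_mem_source hyt.1)
  obtain ⟨N', hNo', hyN', -, 𝓜', h𝓜', hN'⟩ := ψ.exists_affine_tail hA hsymm hyt.2
  have hV := φ.isOpen_inter_preimage_invFun
    (V := interior (φ.target ∩ φ.invFun ⁻¹' ψ.source)) isOpen_interior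
    (interior_subset.trans inter_subset_left) (hNo.inter hNo')
  set V := interior (φ.target ∩ φ.invFun ⁻¹' ψ.source) ∩ φ.invFun ⁻¹' (N ∩ N') with hVdef
  have hVt : ∀ x ∈ V, x ∈ φ.target ∧ φ.invFun x ∈ ψ.source := fun x hx =>
    (interior_subset hx.1 : x ∈ φ.target ∩ φ.invFun ⁻¹' ψ.source)
  have hc : ContinuousOn (fun x => ψ.toFun (φ.invFun x)) V :=
    ψ.continuousOn_toFun.comp (φ.continuousOn_invFun.mono fun x hx => (hVt x hx).1)
      fun x hx => (hVt x hx).2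
  obtain ⟨𝒢, h𝒢, hg⟩ := φ.exists_affine_comp_invFun h𝓜 hN hV (fun x hx => (hVt x hx).1)
    (fun x hx => hx.2.1) hc h𝓜' (by
      intro x hx j q hq hxq
      rw [hxq]
      exact hN' j q hq (hxq ▸ hx.2.2))
  obtain ⟨m₀, hm₀, x, hx, hxm⟩ := exists_fderiv_eq hV hc h𝒢 hg ⟨hy, hyN, hyN'⟩ hd
  have hdet : (fderiv ℝ (fun z => ψ.toFun (φ.invFun z)) y).det = LinearMap.det m₀.linear := by
    rw [← hm₀]
  rw [hdet]
  obtain ⟨U, hU, hUo, hxU⟩ := mem_nhds_iff.1 (inter_mem hxm (hV.mem_nhds hx))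
  obtain ⟨j, z, m, hr, hzU⟩ := φ.exists_regular hA hsymm hUo
    (fun w hw => (hVt w (hU hw).2).1) ⟨x, hxU⟩
  have hr' : ψ.Regular j z (m₀.comp m) := by
    have hmc : Tendsto m (𝓝 z) (𝓝 (m z)) := m.continuous_of_finiteDimensional.tendsto z
    filter_upwards [hr, hmc.eventually (hUo.mem_nhds hzU)] with z' h1 h2
    have h3 : φ.invFun (m z') = P.point A j (baryCoord n z') := by
      rw [← h1.2.2]
      exact φ.left_inv h1.2.1
    have h4 := (hVt _ (hU h2).2).2
    have h5 : ψ.toFun (φ.invFun (m z')) = m₀ (m z') := (hU h2).1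
    rw [h3] at h4 h5
    exact ⟨h1.1, h4, h5⟩
  have aux : ∀ {χ : PLChart P A} {m' : (Fin n → ℝ) →ᵃ[ℝ] (Fin n → ℝ)}, χ.signSet ε (-1) = ∅ →
      χ.Regular j z m' → 0 < signR (ε j) * LinearMap.det m'.linear := by
    intro χ m' hχ hm'
    by_contra hneg
    have h0 := mul_ne_zero (signR_ne_zero (ε j)) (hm'.det_ne_zero hA)
    have h1 := lt_of_le_of_ne (not_lt.1 hneg) h0
    exact (eq_empty_iff_forall_notMem.1 hχ) _ ⟨j, z, m', hm', rfl, by linarith⟩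
  have h1 := mul_pos (aux hφ hr) (aux hψ hr')
  have h2 : LinearMap.det (m₀.comp m).linear = LinearMap.det m₀.linear * LinearMap.det m.linear :=
    LinearMap.det_comp _ _
  rw [h2] at h1
  have h3 := signR_mul_self (ε j)
  have h4 : signR (ε j) * LinearMap.det m.linear *
      (signR (ε j) * (LinearMap.det m₀.linear * LinearMap.det m.linear)) =
      LinearMap.det m₀.linear * (LinearMap.det m.linear * LinearMap.det m.linear) := by
    linear_combination (LinearMap.det m₀.linear * LinearMap.det m.linear * LinearMap.det m.linear) * h3
  rw [h4] at h1
  exact pos_of_mul_pos_left h1 (mul_self_nonneg _)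

end OfOri

theorem orientable_of_ori {ι : Type*} [Finite ι] {n : ℕ} (hn : n ≠ 0) {P : FacePairing ι n}
    {A : Set (Fin (n + 1) → ℝ)} (hA : A ⊆ stdSimplex ℝ (Fin (n + 1)))
    (hsymm : ∀ (σ : Equiv.Perm (Fin (n + 1))), ∀ x ∈ A, x ∘ σ ∈ A)
    (hchart : ∀ z : P.Glued A, ∃ φ : PLChart P A, z ∈ φ.source) (h : P.Ori) : Orientable P A := by
  obtain ⟨ε, hε⟩ := P.ori_iff.1 h
  by_cases hne : Nonempty A
  · refine ⟨{φ | φ.signSet ε (-1) = ∅}, fun z => ?_, fun φ hφ ψ hψ =>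
      orientedTransition_of_signSet_eq_empty hA hsymm hφ hψ⟩
    obtain ⟨φ₀, hz⟩ := hchart z
    obtain ⟨φ, h1, h2⟩ := exists_chart_signSet_eq_empty hn hA hsymm hε φ₀ hz
    exact ⟨φ, h2, h1⟩
  · refine ⟨∅, fun z => ?_, fun φ hφ => absurd hφ (notMem_empty φ)⟩
    induction z using Quot.inductionOn with
    | h p => exact absurd ⟨p.2⟩ hne

/-- Every endomorphism of ℝ⁰ is the identity, of determinant 1. -/
theorem orientable_of_dim_zero {ι : Type*} {P : FacePairing ι 0} {A : Set (Fin (0 + 1) → ℝ)}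
    (hchart : ∀ z : P.Glued A, ∃ φ : PLChart P A, z ∈ φ.source) : Orientable P A := by
  refine ⟨univ, fun z => ?_, fun φ _ ψ _ y _ _ => ?_⟩
  · obtain ⟨φ, h⟩ := hchart z
    exact ⟨φ, mem_univ _, h⟩
  · have : (fderiv ℝ (fun z => ψ.toFun (φ.invFun z)) y) = ContinuousLinearMap.id ℝ _ := by
      ext w k
      exact k.elim0
    rw [this]
    have h1 : (ContinuousLinearMap.id ℝ (Fin 0 → ℝ)).det = 1 := LinearMap.det_id
    rw [h1]
    exact one_pos

/-! ### The condition on the face-pairings from orientability -/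

section OfOrientable

variable {ι : Type*} {n : ℕ} {P : FacePairing ι n} {A : Set (Fin (n + 1) → ℝ)} [Nonempty A]

theorem PLChart.continuousOn_comp_point (φ : PLChart P A) {i : ι}
    {e : (Fin n → ℝ) → (Fin (n + 1) → ℝ)} (he : Continuous e) {V : Set (Fin n → ℝ)}
    (hV : ∀ y ∈ V, e y ∈ A ∧ P.point A i (e y) ∈ φ.source) :
    ContinuousOn (fun y => φ.toFun (P.point A i (e y))) V :=
  φ.continuousOn_toFun.comp
    ((FacePairing.continuousOn_point i).comp he.continuousOn fun y hy => (hV y hy).1)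
    fun y hy => (hV y hy).2

theorem eventually_point_mem {N : Set (P.Glued A)} (hN : IsOpen N) {i : ι}
    {e : (Fin n → ℝ) → (Fin (n + 1) → ℝ)} (he : Continuous e) {y : Fin n → ℝ} (hy : e y ∈ A)
    (hyN : P.point A i (e y) ∈ N) : ∀ᶠ y' in 𝓝 y, e y' ∈ A → P.point A i (e y') ∈ N :=
  he.continuousAt.eventually (FacePairing.isOpen_iff.1 hN i _ hy hyN)

theorem PLChart.exists_regular_of_subset [Finite ι] (hA : A ⊆ stdSimplex ℝ (Fin (n + 1)))
    (hsymm : ∀ (σ : Equiv.Perm (Fin (n + 1))), ∀ x ∈ A, x ∘ σ ∈ A)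
    (φ : PLChart P A) (i : ι) {V : Set (Fin n → ℝ)} (hV : IsOpen V)
    (hVA : ∀ y ∈ V, baryCoord n y ∈ A ∧ P.point A i (baryCoord n y) ∈ φ.source)
    (hne : V.Nonempty) : ∃ y ∈ V, ∃ m, φ.Regular i y m := by
  obtain ⟨y₀, hy₀⟩ := hne
  obtain ⟨N, hNo, hyN, -, 𝓜, h𝓜, hN⟩ := φ.exists_affine_tail hA hsymm (hVA y₀ hy₀).2
  obtain ⟨U, hU, hUo, hyU⟩ := mem_nhds_iff.1 (inter_mem (hV.mem_nhds hy₀)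
    (eventually_point_mem hNo continuous_baryCoord (hVA y₀ hy₀).1 hyN))
  obtain ⟨y, hy, m, -, hm⟩ := exists_eventuallyEq hUo ⟨y₀, hyU⟩
    (φ.continuousOn_comp_point continuous_baryCoord fun y hy => hVA y (hU hy).1) h𝓜 (by
      intro y hy
      obtain ⟨m, hm, h⟩ := hN i _ (hVA y (hU hy).1).1 ((hU hy).2 (hVA y (hU hy).1).1)
      rw [tailCoord_baryCoord] at h
      exact ⟨m, hm, h⟩)
  refine ⟨y, (hU hy).1, m, ?_⟩
  filter_upwards [hm, hUo.mem_nhds hy] with z hz hzU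
  exact ⟨(hVA z (hU hzU).1).1, (hVA z (hU hzU).1).2, hz⟩

/-- The charts of an oriented atlas have the same orientation on a convex open subset of the
interior of a simplex. -/
theorem exists_sign_of_oriented [Finite ι] (hA : A ⊆ stdSimplex ℝ (Fin (n + 1)))
    (hsymm : ∀ (σ : Equiv.Perm (Fin (n + 1))), ∀ x ∈ A, x ∘ σ ∈ A)
    {𝒜 : Set (PLChart P A)} (hcover : ∀ x : P.Glued A, ∃ φ ∈ 𝒜, x ∈ φ.source)
    (hor : ∀ φ ∈ 𝒜, ∀ ψ ∈ 𝒜, OrientedTransition φ ψ) (i : ι) {V : Set (Fin n → ℝ)}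
    (hVo : IsOpen V) (hVc : Convex ℝ V)
    (hVA : ∀ y ∈ V, baryCoord n y ∈ A ∧ ∀ u, 0 < baryCoord n y u) :
    ∃ ε : ℤˣ, ∀ φ ∈ 𝒜, ∀ y ∈ V, ∀ m, φ.Regular i y m → 0 < signR ε * LinearMap.det m.linear := by
  set R : ℝ → Set (Fin n → ℝ) := fun s =>
    {y | ∃ φ ∈ 𝒜, ∃ m, φ.Regular i y m ∧ 0 < s * LinearMap.det m.linear} with hR
  have hRo : ∀ s, IsOpen (R s) := by
    intro s
    rw [isOpen_iff_mem_nhds]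
    rintro y ⟨φ, hφ, m, hr, hs⟩
    filter_upwards [hr.eventually] with y' hy' using ⟨φ, hφ, m, hy', hs⟩
  have hreg : ∀ φ : PLChart P A, ∀ U, IsOpen U → U ⊆ V → U.Nonempty →
      (∀ y ∈ U, P.point A i (baryCoord n y) ∈ φ.source) → ∃ y ∈ U, ∃ m, φ.Regular i y m :=
    fun φ U hU hUV hne hs => φ.exists_regular_of_subset hA hsymm i hU
      (fun y hy => ⟨(hVA y (hUV hy)).1, hs y hy⟩) hne
  have hsource : ∀ y ∈ V, ∀ {N : Set (P.Glued A)}, IsOpen N → P.point A i (baryCoord n y) ∈ N →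
      ∃ r > 0, ∀ y' ∈ Metric.ball y r, y' ∈ V ∧ P.point A i (baryCoord n y') ∈ N := by
    intro y hy N hN hyN
    obtain ⟨r, hr, h⟩ := Metric.eventually_nhds_iff_ball.1 (Eventually.and (hVo.mem_nhds hy)
      (eventually_point_mem hN continuous_baryCoord (hVA y hy).1 hyN))
    exact ⟨r, hr, fun y' hy' => ⟨(h y' hy').1, (h y' hy').2 (hVA y' (h y' hy').1).1⟩⟩
  -- No subspace has to be removed: in the interior of a simplex the projection is injective, so the
  -- sign is locally constant at every point.
  have hprop := sign_propagation hVc hVo (finite_empty (α := AffineSubspace ℝ (Fin n → ℝ)))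
    (fun W hW => absurd hW (notMem_empty W)) (hRo 1) (hRo (-1)) (by
      intro y hy
      rw [mem_closure_iff]
      intro U hU hyU
      obtain ⟨φ, hφ, hys⟩ := hcover (P.point A i (baryCoord n y))
      obtain ⟨r, hr, hball⟩ := hsource y hy φ.open_source hys
      obtain ⟨y', hy', m, hm⟩ := hreg φ (U ∩ Metric.ball y r) (hU.inter Metric.isOpen_ball)
        (fun x hx => (hball x hx.2).1) ⟨y, hyU, Metric.mem_ball_self hr⟩
        (fun x hx => (hball x hx.2).2)
      refine ⟨y', hy'.1, ?_⟩
      rcases (hm.det_ne_zero hA).lt_or_gt with h | h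
      · exact Or.inr ⟨φ, hφ, m, hm, by linarith⟩
      · exact Or.inl ⟨φ, hφ, m, hm, by linarith⟩) (by
      intro y hy _
      by_contra! hcon
      obtain ⟨φ, hφ, hys⟩ := hcover (P.point A i (baryCoord n y))
      obtain ⟨N, hNo, hyN, hNs, 𝓜, h𝓜, hN⟩ := φ.exists_affine_tail hA hsymm hys
      obtain ⟨r, hr, hball⟩ := hsource y hy hNo hyN
      -- The sign seen by any chart `ψ` of the atlas is transferred to the fixed chart `φ` at a
      -- nearby common regular point, so that both signs would occur for the single map `φ`.
      have aux : ∀ s, y ∈ closure (R s) → ∃ x ∈ Metric.ball y r, ∃ m, φ.Regular i x m ∧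
          0 < s * LinearMap.det m.linear := by
        intro s hs
        obtain ⟨x, hx, ψ, hψ, m', hm', hpos⟩ :=
          mem_closure_iff.1 hs _ Metric.isOpen_ball (Metric.mem_ball_self hr)
        obtain ⟨U, hU, hUo, hxU⟩ := mem_nhds_iff.1
          (Eventually.and hm'.eventually (Metric.isOpen_ball.mem_nhds hx))
        obtain ⟨x', hx', m, hm⟩ := hreg φ U hUo (fun w hw => (hball w (hU hw).2).1) ⟨x, hxU⟩
          (fun w hw => hNs (hball w (hU hw).2).2)
        refine ⟨x', (hU hx').2, m, hm, ?_⟩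
        have h1 := (hor φ hφ ψ hψ).det_mul_det_pos hA hm (hU hx').1
        have h2 := mul_pos h1 hpos
        have h3 : LinearMap.det m.linear * LinearMap.det m'.linear * (s * LinearMap.det m'.linear) =
          (s * LinearMap.det m.linear) * (LinearMap.det m'.linear * LinearMap.det m'.linear) := by
          ring
        rw [h3] at h2
        exact pos_of_mul_pos_left h2 (mul_self_nonneg _)
      obtain ⟨x₁, hx₁, m₁, hm₁, hp₁⟩ := aux 1 hcon.1
      obtain ⟨x₂, hx₂, m₂, hm₂, hp₂⟩ := aux (-1) hcon.2
      have hpos := det_mul_det_pos (convex_ball y r) Metric.isOpen_ball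
        (φ.continuousOn_comp_point continuous_baryCoord (V := Metric.ball y r) fun x hx =>
          ⟨(hVA x (hball x hx).1).1, hNs (hball x hx).2⟩)
        (by
          intro a ha b hb hab
          have h1 := φ.injOn (hNs (hball a ha).2) (hNs (hball b hb).2) hab
          have h2 := FacePairing.point_inj_of_pos hA (hVA a (hball a ha).1).1
            (hVA b (hball b hb).1).1 (hVA a (hball a ha).1).2 h1
          rw [← tailCoord_baryCoord a, h2, tailCoord_baryCoord])
        h𝓜 (by
          intro x hx
          obtain ⟨m, hm, h⟩ := hN i _ (hVA x (hball x hx).1).1 (hball x hx).2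
          rw [tailCoord_baryCoord] at h
          exact ⟨m, hm, h⟩) hx₁ hx₂ (hm₁.mono fun z hz => hz.2.2) (hm₂.mono fun z hz => hz.2.2)
      nlinarith)
  have hfinal : ∀ s : ℝ, s ≠ 0 → V ∩ R s = ∅ → ∀ φ ∈ 𝒜, ∀ y ∈ V, ∀ m, φ.Regular i y m →
      0 < (-s) * LinearMap.det m.linear := by
    intro s hs h φ hφ y hy m hm
    have h0 := mul_ne_zero hs (hm.det_ne_zero hA)
    have h1 : ¬ 0 < s * LinearMap.det m.linear := fun h' =>
      (eq_empty_iff_forall_notMem.1 h) y ⟨hy, φ, hφ, m, hm, h'⟩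
    have := lt_of_le_of_ne (not_lt.1 h1) h0
    linarith
  rcases hprop with h | h
  · refine ⟨-1, fun φ hφ y hy m hm => ?_⟩
    have := hfinal 1 one_ne_zero h φ hφ y hy m hm
    rwa [signR_neg, show signR 1 = 1 by simp [signR]]
  · refine ⟨1, fun φ hφ y hy m hm => ?_⟩
    have := hfinal (-1) (by norm_num) h φ hφ y hy m hm
    rw [show signR 1 = 1 by simp [signR]]
    linarith

end OfOrientable

/-! ### Comparison of orientations across a face -/

section OfOrientable

variable {ι : Type*} {n : ℕ} {P : FacePairing ι n} {A : Set (Fin (n + 1) → ℝ)}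

/-- The barycentric coordinates, in the mate of the face `F`, of the points beyond `F`. -/
def FacePairing.unfoldCoord (P : FacePairing ι n) (F : ι × Fin (n + 1)) :
    (Fin n → ℝ) →ᵃ[ℝ] (Fin (n + 1) → ℝ) :=
  (LinearMap.funLeft ℝ ℝ (P.perm F).symm ∘ₗ faceReflection F.2).toAffineMap.comp (baryCoord n)

theorem FacePairing.unfoldCoord_perm (F : ι × Fin (n + 1)) (y : Fin n → ℝ) (u : Fin (n + 1)) :
    P.unfoldCoord F y (P.perm F u) = faceReflection F.2 (baryCoord n y) u := by
  change faceReflection F.2 (baryCoord n y) ((P.perm F).symm (P.perm F u)) = _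
  rw [Equiv.symm_apply_apply]

theorem FacePairing.unfoldCoord_comp_perm (F : ι × Fin (n + 1)) (y : Fin n → ℝ) :
    P.unfoldCoord F y ∘ P.perm F = faceReflection F.2 (baryCoord n y) :=
  funext fun u => FacePairing.unfoldCoord_perm F y u

theorem FacePairing.sum_unfoldCoord (hn : n ≠ 0) (F : ι × Fin (n + 1)) (y : Fin n → ℝ) :
    ∑ u, P.unfoldCoord F y u = 1 := by
  rw [← Equiv.sum_comp (P.perm F)]
  simp only [FacePairing.unfoldCoord_perm]
  rw [sum_faceReflection hn, sum_baryCoord]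

/-- The inverse of `foldMap`. -/
def FacePairing.unfoldMap (P : FacePairing ι n) (F : ι × Fin (n + 1)) :
    (Fin n → ℝ) →ᵃ[ℝ] (Fin n → ℝ) :=
  (tailCoord n).toAffineMap.comp (P.unfoldCoord F)

theorem FacePairing.unfoldMap_apply (F : ι × Fin (n + 1)) (y : Fin n → ℝ) :
    P.unfoldMap F y = tailCoord n (P.unfoldCoord F y) := rfl

theorem FacePairing.baryCoord_unfoldMap (hn : n ≠ 0) (F : ι × Fin (n + 1)) (y : Fin n → ℝ) :
    baryCoord n (P.unfoldMap F y) = P.unfoldCoord F y :=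
  baryCoord_tailCoord (FacePairing.sum_unfoldCoord hn F y)

theorem FacePairing.foldMap_unfoldMap (hn : n ≠ 0) (F : ι × Fin (n + 1)) (y : Fin n → ℝ) :
    P.foldMap F (P.unfoldMap F y) = y := by
  rw [FacePairing.unfoldMap_apply, FacePairing.foldMap_tailCoord F
    (FacePairing.sum_unfoldCoord hn F y), FacePairing.unfoldCoord_comp_perm,
    faceReflection_faceReflection, tailCoord_baryCoord]

theorem FacePairing.unfoldMap_foldMap (hn : n ≠ 0) (F : ι × Fin (n + 1)) (z : Fin n → ℝ) :
    P.unfoldMap F (P.foldMap F z) = z := by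
  have hdet : LinearMap.det (P.foldMap F).linear ≠ 0 := by
    rw [FacePairing.det_foldMap hn]
    exact neg_ne_zero.2 (signR_ne_zero _)
  obtain ⟨k, hk, -⟩ := exists_affine_inverse hdet
  rw [← hk (P.unfoldMap F (P.foldMap F z)), FacePairing.foldMap_unfoldMap hn, hk]

theorem mul_eq_neg_of_signR_pos {ε ε' σ : ℤˣ} (h : 0 < signR ε * (signR ε' * -signR σ)) :
    ε' * σ = -ε := by
  rcases Int.units_eq_one_or ε with rfl | rfl <;> rcases Int.units_eq_one_or ε' with rfl | rfl <;>
    rcases Int.units_eq_one_or σ with rfl | rfl <;> simp [signR] at h ⊢ <;> linarith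

variable [Nonempty A]

/-- In an oriented glued space, the orientations of the two simplices which share a face are
compared through this face. -/
theorem mul_sign_perm_eq_neg [Finite ι] (hn : n ≠ 0) (hA : A ⊆ stdSimplex ℝ (Fin (n + 1)))
    (hsymm : ∀ (σ : Equiv.Perm (Fin (n + 1))), ∀ x ∈ A, x ∘ σ ∈ A)
    {c : ℝ} (hc : 1 / (n : ℝ) < c)
    (hcA : ∀ x ∈ stdSimplex ℝ (Fin (n + 1)), (∀ u, x u < c) → x ∈ A)
    {𝒜 : Set (PLChart P A)} (hcover : ∀ x : P.Glued A, ∃ φ ∈ 𝒜, x ∈ φ.source)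
    (F : ι × Fin (n + 1)) {ε ε' : ℤˣ}
    (hε : ∀ φ ∈ 𝒜, ∀ y, (∀ u, 0 < baryCoord n y u ∧ baryCoord n y u < c) →
      ∀ m, φ.Regular F.1 y m → 0 < signR ε * LinearMap.det m.linear)
    (hε' : ∀ φ ∈ 𝒜, ∀ y, (∀ u, 0 < baryCoord n y u ∧ baryCoord n y u < c) →
      ∀ m, φ.Regular (P.mate F).1 y m → 0 < signR ε' * LinearMap.det m.linear) :
    ε' * Equiv.Perm.sign (P.perm F) = - ε := by
  classical
  have hn0 : (0 : ℝ) < n := Nat.cast_pos.2 (Nat.pos_of_ne_zero hn)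
  have hn1 : (0 : ℝ) < 1 / n := by positivity
  -- The barycentre of the face. Its coordinates are 0 and `1 / n`, all below `c`, so it lies in
  -- `A`.
  set b : Fin (n + 1) → ℝ := fun u => if u = F.2 then 0 else 1 / n with hb
  have hbF : b F.2 = 0 := by simp [hb]
  have hbu : ∀ u, u ≠ F.2 → b u = 1 / n := fun u hu => by simp [hb, hu]
  have hbsum : ∑ u, b u = 1 := by
    rw [← Finset.add_sum_erase _ _ (Finset.mem_univ F.2), hbF,
      Finset.sum_congr rfl fun u hu => hbu u (Finset.ne_of_mem_erase hu)]
    simp [Finset.card_erase_of_mem]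
    field_simp
  have hb0 : ∀ u, 0 ≤ b u := fun u => by
    by_cases hu : u = F.2
    · rw [hu, hbF]
    · rw [hbu u hu]; exact hn1.le
  have hbc : ∀ u, b u < c := fun u => by
    by_cases hu : u = F.2
    · rw [hu, hbF]; exact hn1.trans hc
    · rw [hbu u hu]; exact hc
  have hbR : b ∈ faceRegion F.2 := fun u hu => by rw [hbF, hbu u hu]; exact hn1
  have hbA : b ∈ A := hcA b ⟨hb0, hbsum⟩ hbc
  set y₀ := tailCoord n b with hy₀
  have hβ₀ : baryCoord n y₀ = b := baryCoord_tailCoord hbsum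
  have hS₀ : faceReflection F.2 (baryCoord n y₀) = b := by
    rw [hβ₀, faceReflection_eq_self hbF]
  have he₀ : P.unfoldCoord F y₀ ∈ A := by
    have : P.unfoldCoord F y₀ = b ∘ (P.perm F).symm := by
      rw [← hS₀, ← FacePairing.unfoldCoord_comp_perm (P := P)]
      ext u
      simp
    rw [this]
    exact hsymm _ _ hbA
  have hmatched : ∀ y, baryCoord n y F.2 = 0 →
      P.Matched F (baryCoord n y) (P.unfoldCoord F y) := fun y hy =>
    ⟨hy, fun u => by rw [FacePairing.unfoldCoord_perm, faceReflection_eq_self hy]⟩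
  obtain ⟨φ, hφ, hφs⟩ := hcover (P.point A F.1 b)
  obtain ⟨N, hNo, hbN, hNs, 𝓜, h𝓜, hN⟩ := φ.exists_affine_tail hA hsymm hφs
  have heN : P.point A (P.mate F).1 (P.unfoldCoord F y₀) ∈ N := by
    rw [← FacePairing.point_eq (hβ₀.symm ▸ hbA) he₀ (hmatched y₀ (by rw [hβ₀, hbF])), hβ₀]
    exact hbN
  have hec : Continuous (P.unfoldCoord F) := (P.unfoldCoord F).continuous_of_finiteDimensional
  have hSc : Continuous fun y => faceReflection F.2 (baryCoord n y) :=
    (faceReflection F.2).continuous_of_finiteDimensional.comp continuous_baryCoord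
  have hltc : ∀ {e : (Fin n → ℝ) → Fin (n + 1) → ℝ}, Continuous e → e y₀ = b →
      ∀ᶠ y in 𝓝 y₀, e y ∈ faceRegion F.2 ∧ ∀ u, e y u < c := by
    intro e he h0
    refine Eventually.and (he.continuousAt.eventually ?_) (eventually_all.2 fun u =>
      ((continuous_apply u).comp he).continuousAt.eventually_lt_const ?_)
    · rw [h0]
      exact (isOpen_faceRegion F.2).mem_nhds hbR
    · rw [Function.comp_apply, h0]
      exact hbc u
  -- The ball is closed so that the face cuts it into two closed halves, from which the continuity
  -- of `g` is assembled.
  obtain ⟨r, hr, hball⟩ := Metric.nhds_basis_closedBall.eventually_iff.1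
    (((hltc continuous_baryCoord hβ₀).and (hltc hSc hS₀)).and
      ((eventually_point_mem hNo continuous_baryCoord (i := F.1) (y := y₀) (hβ₀.symm ▸ hbA)
        (hβ₀.symm ▸ hbN)).and (eventually_point_mem hNo hec he₀ heN)))
  have hplus : ∀ y ∈ Metric.closedBall y₀ r, 0 ≤ baryCoord n y F.2 → baryCoord n y ∈ A := by
    intro y hy h
    refine hcA _ ⟨fun u => ?_, sum_baryCoord y⟩ (hball hy).1.1.2
    by_cases hu : u = F.2
    · rw [hu]; exact h
    · exact h.trans ((hball hy).1.1.1 u hu).le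
  have hregion : ∀ y ∈ Metric.closedBall y₀ r, P.unfoldCoord F y ∈ faceRegion (P.mate F).2 ∧
      ∀ u, P.unfoldCoord F y u < c := by
    intro y hy
    refine ⟨fun u hu => ?_, fun u => ?_⟩
    · obtain ⟨w, rfl⟩ := (P.perm F).surjective u
      rw [← P.perm_self, FacePairing.unfoldCoord_perm, FacePairing.unfoldCoord_perm]
      refine (hball hy).1.2.1 w ?_
      rintro rfl
      exact hu (P.perm_self F)
    · obtain ⟨w, rfl⟩ := (P.perm F).surjective u
      rw [FacePairing.unfoldCoord_perm]
      exact (hball hy).1.2.2 w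
  have hmate : ∀ y, P.unfoldCoord F y (P.mate F).2 = - baryCoord n y F.2 := fun y => by
    rw [← P.perm_self, FacePairing.unfoldCoord_perm, faceReflection_self]
  have hminus : ∀ y ∈ Metric.closedBall y₀ r, baryCoord n y F.2 ≤ 0 → P.unfoldCoord F y ∈ A := by
    intro y hy h
    refine hcA _ ⟨fun u => ?_, FacePairing.sum_unfoldCoord hn F y⟩ (hregion y hy).2
    have h1 : 0 ≤ P.unfoldCoord F y (P.mate F).2 := by rw [hmate]; linarith
    by_cases hu : u = (P.mate F).2
    · rw [hu]; exact h1
    · exact h1.trans ((hregion y hy).1 u hu).le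
  -- The unfolding: a neighbourhood of `y₀` in ℝⁿ is mapped to the simplex of `F` on one side of the
  -- face and to its mate on the other. The fold coordinate `D` is a left inverse on the ball, which
  -- makes `φ ∘ g` injective.
  set g : (Fin n → ℝ) → P.Glued A := fun y => if 0 ≤ baryCoord n y F.2 then
    P.point A F.1 (baryCoord n y) else P.point A (P.mate F).1 (P.unfoldCoord F y) with hg
  have hg1 : ∀ y, 0 ≤ baryCoord n y F.2 → g y = P.point A F.1 (baryCoord n y) := fun y hy =>
    if_pos hy
  have hg2 : ∀ y ∈ Metric.closedBall y₀ r, baryCoord n y F.2 ≤ 0 →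
      g y = P.point A (P.mate F).1 (P.unfoldCoord F y) := by
    intro y hyr hy
    rcases hy.lt_or_eq with h | h
    · exact if_neg (not_le.2 h)
    · rw [hg1 y h.ge]
      exact FacePairing.point_eq (hplus y hyr h.ge) (hminus y hyr hy) (hmatched y h)
  have hcoord : Continuous fun y => baryCoord n y F.2 :=
    (continuous_apply F.2).comp continuous_baryCoord
  have hgc : ContinuousOn g (Metric.closedBall y₀ r) := by
    have h1 : ContinuousOn g (Metric.closedBall y₀ r ∩ {y | 0 ≤ baryCoord n y F.2}) :=
      ((FacePairing.continuousOn_point F.1).comp continuous_baryCoord.continuousOn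
        fun y hy => hplus y hy.1 hy.2).congr fun y hy => hg1 y hy.2
    have h2 : ContinuousOn g (Metric.closedBall y₀ r ∩ {y | baryCoord n y F.2 ≤ 0}) :=
      ((FacePairing.continuousOn_point (P.mate F).1).comp hec.continuousOn
        fun y hy => hminus y hy.1 hy.2).congr fun y hy => hg2 y hy.1 hy.2
    refine (h1.union_of_isClosed h2
      (Metric.isClosed_closedBall.inter (isClosed_le continuous_const hcoord))
      (Metric.isClosed_closedBall.inter (isClosed_le hcoord continuous_const))).mono ?_
    intro y hy
    exact (le_total 0 (baryCoord n y F.2)).imp (fun h => ⟨hy, h⟩) fun h => ⟨hy, h⟩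
  have hgN : ∀ y ∈ Metric.closedBall y₀ r, g y ∈ N := by
    intro y hy
    rcases le_total 0 (baryCoord n y F.2) with h | h
    · rw [hg1 y h]
      exact (hball hy).2.1 (hplus y hy h)
    · rw [hg2 y hy h]
      exact (hball hy).2.2 (hminus y hy h)
  obtain ⟨Ω, D, -, hD1, hD2⟩ := exists_isFold_of_face (P := P) hn hA F
  have hDg : ∀ y ∈ Metric.closedBall y₀ r, D (g y) = y := by
    intro y hy
    rcases le_total 0 (baryCoord n y F.2) with h | h
    · rw [hg1 y h, (hD1 _ (hplus y hy h) (hball hy).1.1.1).2, tailCoord_baryCoord]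
    · rw [hg2 y hy h, (hD2 _ (hminus y hy h) (hregion y hy).1).2,
        FacePairing.unfoldCoord_comp_perm, faceReflection_faceReflection, tailCoord_baryCoord]
  have hbc' : Metric.ball y₀ r ⊆ Metric.closedBall y₀ r := Metric.ball_subset_closedBall
  set f : (Fin n → ℝ) → Fin n → ℝ := fun y => φ.toFun (g y) with hf
  have hfc : ContinuousOn f (Metric.ball y₀ r) :=
    φ.continuousOn_toFun.comp (hgc.mono hbc') fun y hy => hNs (hgN y (hbc' hy))
  have hfi : InjOn f (Metric.ball y₀ r) := by
    intro y hy y' hy' h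
    have := φ.injOn (hNs (hgN y (hbc' hy))) (hNs (hgN y' (hbc' hy'))) h
    rw [← hDg y (hbc' hy), this, hDg y' (hbc' hy')]
  have hfg : ∀ y ∈ Metric.ball y₀ r, ∃ m ∈ 𝓜 ∪ (fun m => m.comp (P.unfoldMap F)) '' 𝓜,
      f y = m y := by
    intro y hy
    have hyN := hgN y (hbc' hy)
    rcases le_total 0 (baryCoord n y F.2) with h | h
    · rw [hg1 y h] at hyN
      obtain ⟨m, hm, hmy⟩ := hN _ _ (hplus y (hbc' hy) h) hyN
      refine ⟨m, Or.inl hm, ?_⟩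
      rw [tailCoord_baryCoord] at hmy
      simp only [hf, hg1 y h, hmy]
    · rw [hg2 y (hbc' hy) h] at hyN
      obtain ⟨m, hm, hmy⟩ := hN _ _ (hminus y (hbc' hy) h) hyN
      refine ⟨_, Or.inr ⟨m, hm, rfl⟩, ?_⟩
      simp only [hf, hg2 y (hbc' hy) h, hmy]
      rfl
  -- The line from `b` towards the vertex opposite to the face crosses the face at parameter 0, so
  -- both sides of the ball are nonempty.
  have hcurve : ∀ t : ℝ, baryCoord n (tailCoord n (AffineMap.lineMap b (Pi.single F.2 1) t)) F.2
      = t := by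
    intro t
    rw [baryCoord_tailCoord]
    · simp [AffineMap.lineMap_apply, hbF]
    · simp [AffineMap.lineMap_apply, Finset.sum_add_distrib, ← Finset.mul_sum, hbsum]
  have hcurve' : ∀ᶠ t in 𝓝 (0 : ℝ),
      tailCoord n (AffineMap.lineMap b (Pi.single F.2 1) t) ∈ Metric.ball y₀ r := by
    have hcc : Continuous fun t : ℝ =>
        tailCoord n (AffineMap.lineMap b (Pi.single F.2 1 : Fin (n + 1) → ℝ) t) :=
      continuous_tailCoord.comp AffineMap.lineMap_continuous
    refine hcc.continuousAt.eventually (Metric.isOpen_ball.mem_nhds ?_)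
    change tailCoord n (AffineMap.lineMap b (Pi.single F.2 1 : Fin (n + 1) → ℝ) (0 : ℝ)) ∈ _
    rw [AffineMap.lineMap_apply_zero]
    exact Metric.mem_ball_self hr
  have hfin := h𝓜.union (h𝓜.image fun m => m.comp (P.unfoldMap F))
  obtain ⟨t₁, ht₁, ht₁'⟩ := ((hcurve'.filter_mono nhdsWithin_le_nhds).and
    (self_mem_nhdsWithin (s := Ioi (0 : ℝ)))).exists
  obtain ⟨y₁, ⟨hy₁, hy₁v⟩, g₁, -, hg₁⟩ := exists_eventuallyEq
    (Metric.isOpen_ball.inter (isOpen_lt continuous_const hcoord)) ⟨_, ht₁, by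
      change 0 < baryCoord n _ F.2
      rw [hcurve]
      exact ht₁'⟩ (hfc.mono inter_subset_left) hfin fun y hy => hfg y hy.1
  obtain ⟨t₂, ht₂, ht₂'⟩ := ((hcurve'.filter_mono nhdsWithin_le_nhds).and
    (self_mem_nhdsWithin (s := Iio (0 : ℝ)))).exists
  obtain ⟨y₂, ⟨hy₂, hy₂v⟩, g₂, -, hg₂⟩ := exists_eventuallyEq
    (Metric.isOpen_ball.inter (isOpen_lt hcoord continuous_const)) ⟨_, ht₂, by
      change baryCoord n _ F.2 < 0
      rw [hcurve]
      exact ht₂'⟩ (hfc.mono inter_subset_left) hfin fun y hy => hfg y hy.1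
  have hpos := det_mul_det_pos (convex_ball y₀ r) Metric.isOpen_ball hfc hfi hfin hfg hy₁ hy₂
    hg₁ hg₂
  have hy₁v' : 0 < baryCoord n y₁ F.2 := hy₁v
  have hy₂v' : baryCoord n y₂ F.2 < 0 := hy₂v
  have hp₁ := hε φ hφ y₁ (fun u => ⟨by
      by_cases hu : u = F.2
      · rw [hu]; exact hy₁v'
      · exact hy₁v'.trans ((hball (hbc' hy₁)).1.1.1 u hu), (hball (hbc' hy₁)).1.1.2 u⟩) g₁ (by
    filter_upwards [hg₁, Metric.isOpen_ball.mem_nhds hy₁,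
      (isOpen_lt continuous_const hcoord).mem_nhds hy₁v'] with y h1 h2 h3
    have h3' : 0 ≤ baryCoord n y F.2 := le_of_lt h3
    have h4 := hgN y (hbc' h2)
    have h5 : φ.toFun (g y) = g₁ y := h1
    rw [hg1 y h3'] at h4 h5
    exact ⟨hplus y (hbc' h2) h3', hNs h4, h5⟩)
  have hUlim : Tendsto (P.foldMap F) (𝓝 (P.unfoldMap F y₂)) (𝓝 y₂) := by
    have := (P.foldMap F).continuous_of_finiteDimensional.tendsto (P.unfoldMap F y₂)
    rwa [FacePairing.foldMap_unfoldMap hn] at this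
  have hp₂ := hε' φ hφ (P.unfoldMap F y₂) (fun u => by
      rw [FacePairing.baryCoord_unfoldMap hn]
      have h1 := hregion y₂ (hbc' hy₂)
      have h2 : 0 < P.unfoldCoord F y₂ (P.mate F).2 := by rw [hmate]; linarith
      refine ⟨?_, h1.2 u⟩
      by_cases hu : u = (P.mate F).2
      · rw [hu]; exact h2
      · exact h2.trans (h1.1 u hu)) (g₂.comp (P.foldMap F)) (by
    have hev : ∀ᶠ y in 𝓝 y₂, f y = g₂ y ∧ y ∈ Metric.ball y₀ r ∧ baryCoord n y F.2 < 0 :=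
      hg₂.and (Eventually.and (Metric.isOpen_ball.mem_nhds hy₂)
        ((isOpen_lt hcoord continuous_const).mem_nhds hy₂v'))
    filter_upwards [hUlim.eventually hev] with z hz
    obtain ⟨h1, h2, h3⟩ := hz
    have h4 := hgN _ (hbc' h2)
    have h5 : φ.toFun (g (P.foldMap F z)) = g₂ (P.foldMap F z) := h1
    have h6 := hminus _ (hbc' h2) h3.le
    rw [hg2 _ (hbc' h2) h3.le] at h4 h5
    rw [← FacePairing.baryCoord_unfoldMap hn, FacePairing.unfoldMap_foldMap hn] at h4 h5 h6
    exact ⟨h6, hNs h4, h5⟩)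
  have hcomp : LinearMap.det (g₂.comp (P.foldMap F)).linear =
      LinearMap.det g₂.linear * - signR (Equiv.Perm.sign (P.perm F)) := by
    rw [← FacePairing.det_foldMap hn]
    exact LinearMap.det_comp _ _
  rw [hcomp] at hp₂
  apply mul_eq_neg_of_signR_pos
  -- In this product the determinants of `g₁` and `g₂` occur squared, so only the three signs
  -- remain.
  have h1 := mul_pos (mul_pos hp₁ hp₂) hpos
  have h2 : signR ε * LinearMap.det g₁.linear *
      (signR ε' * (LinearMap.det g₂.linear * -signR (Equiv.Perm.sign (P.perm F)))) *
      (LinearMap.det g₁.linear * LinearMap.det g₂.linear) =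
      (signR ε * (signR ε' * -signR (Equiv.Perm.sign (P.perm F)))) *
        ((LinearMap.det g₁.linear * LinearMap.det g₂.linear) *
          (LinearMap.det g₁.linear * LinearMap.det g₂.linear)) := by ring
  rw [h2] at h1
  exact pos_of_mul_pos_left h1 (mul_self_nonneg _)

end OfOrientable

/-- The points with all coordinates in `(0, c)` form a convex open part of each simplex contained in
`A`, on which one sign per simplex is defined; since `c > 1 / n`, this part reaches the barycentre
of every face. -/
theorem ori_of_orientable {ι : Type*} [Finite ι] {n : ℕ} (hn : n ≠ 0) {P : FacePairing ι n}
    {A : Set (Fin (n + 1) → ℝ)} (hA : A ⊆ stdSimplex ℝ (Fin (n + 1)))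
    (hsymm : ∀ (σ : Equiv.Perm (Fin (n + 1))), ∀ x ∈ A, x ∘ σ ∈ A)
    {c : ℝ} (hc : 1 / (n : ℝ) < c)
    (hcA : ∀ x ∈ stdSimplex ℝ (Fin (n + 1)), (∀ u, x u < c) → x ∈ A) (h : Orientable P A) :
    P.Ori := by
  have hn0 : (0 : ℝ) < n := Nat.cast_pos.2 (Nat.pos_of_ne_zero hn)
  have hne : Nonempty A := by
    refine ⟨⟨fun _ => 1 / ((n : ℝ) + 1), hcA _ ⟨fun _ => by positivity, ?_⟩ fun _ => ?_⟩⟩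
    · simp
      field_simp
    · refine lt_trans ?_ hc
      exact one_div_lt_one_div_of_lt hn0 (by linarith)
  obtain ⟨𝒜, hcover, hor⟩ := h
  set V : Set (Fin n → ℝ) := {y | ∀ u, 0 < baryCoord n y u ∧ baryCoord n y u < c} with hV
  have hVo : IsOpen V := by
    simp only [hV, ofPred_forall]
    refine isOpen_iInter_of_finite fun u => ?_
    have hcu : Continuous fun y => baryCoord n y u := (continuous_apply u).comp continuous_baryCoord
    exact (isOpen_lt continuous_const hcu).inter (isOpen_lt hcu continuous_const)
  have hVc : Convex ℝ V := by
    have : V = (baryCoord n) ⁻¹' (Set.univ.pi fun _ => Ioo 0 c) := by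
      ext y
      simp [hV, Set.mem_pi]
    rw [this]
    exact (convex_pi fun _ _ => convex_Ioo 0 c).affine_preimage (baryCoord n)
  have hsign := fun i : ι => exists_sign_of_oriented hA hsymm hcover hor i hVo hVc fun y hy =>
    ⟨hcA _ ⟨fun u => (hy u).1.le, sum_baryCoord y⟩ fun u => (hy u).2, fun u => (hy u).1⟩
  choose ε hε using hsign
  exact P.ori_iff.2 ⟨ε, fun F => mul_sign_perm_eq_neg hn hA hsymm hc hcA hcover F
    (hε F.1) (hε (P.mate F).1)⟩

/-! ### Symmetry and size of the truncated simplices -/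

theorem sdPos_eq {V E : Type*} [AddCommGroup E] [Module ℝ E] (p : V → E) (s : Finset V) :
    sdPos p s = (s.card : ℝ)⁻¹ • ∑ u ∈ s, p u := by
  simp [sdPos, Finset.centerMass]

theorem map_sdPos {V W E F : Type*} [AddCommGroup E] [Module ℝ E] [AddCommGroup F] [Module ℝ F]
    {p : V → E} {q : W → F} (e : V ≃ W) (L : E →ₗ[ℝ] F) (h : ∀ u, L (p u) = q (e u))
    (s : Finset V) : L (sdPos p s) = sdPos q (e.finsetCongr s) := by
  simp [sdPos_eq, h]

theorem finsetCongr_mem_sdFaces {V W : Type*} {K : Set (Finset V)} {K' : Set (Finset W)}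
    (e : V ≃ W) (h : ∀ s ∈ K, e.finsetCongr s ∈ K') :
    ∀ c ∈ sdFaces K, e.finsetCongr.finsetCongr c ∈ sdFaces K' := by
  rintro c ⟨hne, hcK, hc⟩
  refine ⟨by simpa using hne, fun s hs => ?_, ?_⟩
  · simp only [Equiv.finsetCongr_apply, Finset.mem_map] at hs
    obtain ⟨s, hs, rfl⟩ := hs
    exact h s (hcK s hs)
  · rw [Equiv.finsetCongr_apply, Finset.coe_map]
    exact IsChain.image_of_map_rel _ _ _ (fun a b hab => Finset.map_subset_map.2 hab) hc

theorem map_mem_openStar {V W E F : Type*} [AddCommGroup E] [Module ℝ E] [AddCommGroup F]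
    [Module ℝ F] {K : Set (Finset V)} {K' : Set (Finset W)} {p : V → E} {q : W → F} (e : V ≃ W)
    (L : E →ₗ[ℝ] F) (hK : ∀ s ∈ K, e.finsetCongr s ∈ K') (h : ∀ u, L (p u) = q (e u)) {v : V}
    {x : E} (hx : x ∈ openStar K p v) : L x ∈ openStar K' q (e v) := by
  obtain ⟨s, hs, hv, w, hw, hw1, rfl⟩ := hx
  refine ⟨e.finsetCongr s, hK s hs, by simpa using hv, w ∘ e.symm, ?_, ?_, ?_⟩
  · intro u hu
    simp only [Equiv.finsetCongr_apply, Finset.mem_map] at hu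
    obtain ⟨u, hu, rfl⟩ := hu
    simpa using hw u hu
  · simpa using hw1
  · simp [h]

theorem comp_mem_stdSimplex {V : Type*} [Fintype V] (σ : Equiv.Perm V) {x : V → ℝ}
    (hx : x ∈ stdSimplex ℝ V) : x ∘ σ ∈ stdSimplex ℝ V :=
  ⟨fun u => hx.1 (σ u), (Equiv.sum_comp σ x).trans hx.2⟩

/-- A permutation of the vertices induces automorphisms of both barycentric subdivisions, compatible
with the placement of their vertices, and so permutes the removed stars. -/
theorem comp_mem_truncatedSimplex {n : ℕ} (σ : Equiv.Perm (Fin (n + 1))) {x : Fin (n + 1) → ℝ}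
    (hx : x ∈ truncatedSimplex n) : x ∘ σ ∈ truncatedSimplex n := by
  refine ⟨comp_mem_stdSimplex σ hx.1, fun hmem => hx.2 ?_⟩
  obtain ⟨v, hv⟩ := mem_iUnion.1 hmem
  refine mem_iUnion.2 ⟨σ v, ?_⟩
  have hL : ∀ u, LinearMap.funLeft ℝ ℝ σ.symm (Pi.single u 1 : Fin (n + 1) → ℝ)
      = Pi.single (σ u) 1 := fun u => by
    ext w
    simp [LinearMap.funLeft_apply, Pi.single_apply, Equiv.symm_apply_eq]
  have hK : ∀ s ∈ {s : Finset (Fin (n + 1)) | s.Nonempty},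
      σ.finsetCongr s ∈ {s : Finset (Fin (n + 1)) | s.Nonempty} := fun s hs => by
    rw [Set.mem_ofPred_eq] at hs ⊢
    simpa using hs
  have := map_mem_openStar σ.finsetCongr.finsetCongr (LinearMap.funLeft ℝ ℝ σ.symm)
    (finsetCongr_mem_sdFaces _ <| finsetCongr_mem_sdFaces _ hK)
    (map_sdPos _ _ <| map_sdPos (q := fun u => (Pi.single u 1 : Fin (n + 1) → ℝ)) _ _ hL) hv
  have hx' : LinearMap.funLeft ℝ ℝ σ.symm (x ∘ σ) = x := by
    ext w
    simp [LinearMap.funLeft_apply]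
  rw [hx'] at this
  simpa using this

theorem sdPos_single_apply {V : Type*} [DecidableEq V] {s : Finset V} {v : V} (hv : v ∈ s) :
    sdPos (fun u => (Pi.single u 1 : V → ℝ)) s v = (s.card : ℝ)⁻¹ := by
  simp [sdPos_eq, Finset.sum_apply, Pi.single_apply, hv]

/-- Cardinality is injective on a chain and takes values between 1 and the number of vertices. -/
theorem card_le_of_isChain {V : Type*} [Fintype V] {c : Finset (Finset V)}
    (hne : ∀ s ∈ c, s.Nonempty) (hc : IsChain (· ⊆ ·) (c : Set (Finset V))) :
    c.card ≤ Fintype.card V := by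
  have := Finset.card_le_card_of_injOn (t := Finset.Icc 1 (Fintype.card V)) Finset.card
    (fun s hs => by
      simpa using ⟨hne s hs, Finset.card_le_univ s⟩)
    (fun s hs t ht hst => by
      rcases hc.total hs ht with h | h
      · exact Finset.eq_of_subset_of_card_le h hst.ge
      · exact (Finset.eq_of_subset_of_card_le h hst.le).symm)
  simpa using this

/-- The coordinate at `v` is the mean of `1 / |s|` over the chain. The member `{v}` contributes 1
and each other member at least `1 / (n + 1)`; the mean is smallest for `n + 1` members, namely `(1 +
n / (n + 1)) / (n + 1)`. -/
theorem le_sdPos_sdPos_apply {n : ℕ} {c : Finset (Finset (Fin (n + 1)))}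
    (hc : c ∈ sdFaces {s : Finset (Fin (n + 1)) | s.Nonempty}) {v : Fin (n + 1)} (hv : {v} ∈ c) :
    (2 * n + 1) / (n + 1 : ℝ) ^ 2 ≤
      sdPos (sdPos fun u => (Pi.single u 1 : Fin (n + 1) → ℝ)) c v := by
  have hmem : ∀ s ∈ c, v ∈ s := fun s hs => by
    rcases hc.2.2.total hs hv with h | h
    · obtain ⟨u, hu⟩ := hc.2.1 s hs
      rwa [← Finset.mem_singleton.1 (h hu)]
    · exact h (Finset.mem_singleton_self v)
  have hcard : (c.card : ℝ) ≤ n + 1 := by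
    have := card_le_of_isChain hc.2.1 hc.2.2
    rw [Fintype.card_fin] at this
    exact_mod_cast this
  have hpos : (0 : ℝ) < c.card := by exact_mod_cast hc.1.card_pos
  have hn : (0 : ℝ) < n + 1 := by positivity
  have hsum : n / (n + 1 : ℝ) + c.card * (n + 1 : ℝ)⁻¹ ≤ ∑ s ∈ c, (s.card : ℝ)⁻¹ := by
    have hle : ∀ s ∈ c.erase {v}, (n + 1 : ℝ)⁻¹ ≤ (s.card : ℝ)⁻¹ := fun s hs => by
      have h1 := (hc.2.1 s (Finset.mem_of_mem_erase hs)).card_pos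
      have h2 := Finset.card_le_univ s
      rw [Fintype.card_fin] at h2
      exact inv_anti₀ (by exact_mod_cast h1) (by exact_mod_cast h2)
    have h := Finset.card_nsmul_le_sum _ _ _ hle
    rw [Finset.card_erase_of_mem hv, nsmul_eq_mul, Nat.cast_sub hc.1.card_pos] at h
    rw [← Finset.add_sum_erase _ _ hv, Finset.card_singleton]
    refine le_trans (le_of_eq ?_) (add_le_add_right h _)
    push_cast
    field_simp
    ring
  rw [sdPos_eq, Pi.smul_apply, Finset.sum_apply, smul_eq_mul,
    Finset.sum_congr rfl fun s hs => sdPos_single_apply (hmem s hs), ← div_eq_inv_mul,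
    le_div_iff₀ hpos]
  refine le_trans ?_ hsum
  rw [div_mul_eq_mul_div, div_add' _ _ _ hn.ne', div_le_div_iff₀ (by positivity) hn]
  have h3 : c.card * (n + 1 : ℝ)⁻¹ * (n + 1) = c.card := by field_simp
  rw [h3]
  nlinarith [mul_le_mul_of_nonneg_left hcard (mul_nonneg n.cast_nonneg hn.le : (0 : ℝ) ≤ n * (n + 1))]

/-- A point of the open star of `v` is a convex combination of vertices whose chains all contain
`{v}`, so its coordinate at `v` is at least the bound for these vertices. -/
theorem mem_truncatedSimplex {n : ℕ} {x : Fin (n + 1) → ℝ} (hx : x ∈ stdSimplex ℝ (Fin (n + 1)))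
    (h : ∀ u, x u < (2 * n + 1) / (n + 1 : ℝ) ^ 2) : x ∈ truncatedSimplex n := by
  refine ⟨hx, fun hmem => ?_⟩
  obtain ⟨v, s, hs, hv, w, hw, hw1, rfl⟩ := mem_iUnion.1 hmem
  refine (h v).not_ge ?_
  rw [Finset.sum_apply]
  calc (2 * n + 1) / (n + 1 : ℝ) ^ 2 = ∑ c ∈ s, w c * ((2 * n + 1) / (n + 1 : ℝ) ^ 2) := by
        rw [← Finset.sum_mul, hw1, one_mul]
    _ ≤ _ := Finset.sum_le_sum fun c hc => by
        refine mul_le_mul_of_nonneg_left (le_sdPos_sdPos_apply (hs.2.1 c hc) ?_) (hw c hc).le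
        rcases hs.2.2.total hv hc with h | h
        · exact h (Finset.mem_singleton_self _)
        · obtain ⟨a, ha⟩ := (hs.2.1 c hc).1
          rwa [← Finset.mem_singleton.1 (h ha)]

end

end SimplexGluing

theorem mainTheorem7 {ι : Type*} [Finite ι] {n : ℕ} (P : SimplexGluing.FacePairing ι n) :
    (P.XIsManifold → (P.XIsOrientable ↔ P.Ori)) ∧
      (P.XBoundaryIsManifold → (P.XBoundaryIsOrientable ↔ P.Ori)) := by
  open SimplexGluing in
  rcases eq_or_ne n 0 with rfl | hn
  · exact ⟨fun h => ⟨fun _ => P.ori_of_dim_zero, fun _ => orientable_of_dim_zero fun z =>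
        (h.2.2 z).imp fun _ h => h.1⟩,
      fun h => ⟨fun _ => P.ori_of_dim_zero, fun _ => orientable_of_dim_zero h.2.2⟩⟩
  have hn1 : (1 : ℝ) ≤ n := by exact_mod_cast Nat.one_le_iff_ne_zero.2 hn
  refine ⟨fun h => ⟨fun ho => ?_, fun ho => ?_⟩, fun h => ⟨fun ho => ?_, fun ho => ?_⟩⟩
  -- The full simplex needs no bound on the coordinates; any `c > 1 / n` serves, and 2 is one for
  -- every `n ≥ 1`.
  · refine ori_of_orientable hn subset_rfl (fun σ x => comp_mem_stdSimplex σ) (c := 2) ?_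
      (fun x hx _ => hx) ho
    rw [div_lt_iff₀ (by linarith)]
    linarith
  · exact orientable_of_ori hn subset_rfl (fun σ x => comp_mem_stdSimplex σ)
      (fun z => (h.2.2 z).imp fun _ h => h.1) ho
  -- For `n = 1` the bound `(2n + 1) / (n + 1)²` is `3/4`, less than `1 / n`, and the general
  -- argument does not apply.
  · rcases eq_or_ne n 1 with rfl | hn'
    · exact P.ori_of_dim_one
    have hn2 : (2 : ℝ) ≤ n := by
      have : 2 ≤ n := by omega
      exact_mod_cast this
    refine ori_of_orientable hn Set.sdiff_subset (fun σ x => comp_mem_truncatedSimplex σ) ?_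
      (fun x => mem_truncatedSimplex) ho
    -- The inequality `1 / n < (2n + 1) / (n + 1)²` amounts to `n + 1 < n²`, true from `n = 2` on.
    rw [div_lt_div_iff₀ (by linarith) (by positivity)]
    nlinarith
  · exact orientable_of_ori hn Set.sdiff_subset (fun σ x => comp_mem_truncatedSimplex σ) h.2.2 ho
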